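/- **Setting.** Let $H\ge 2$, $d\ge 1$, $d_e\ge 0$ be integers. A sequence $x=(x_1,\dots,x_H)$ of vectors in $\mathbb R^d$ has the Gaussian law $\mathcal N(\mu,\Gamma\otimes\Lambda)$ with $\Gamma\in\mathbb R^{H\times H}$ and $\Lambda\in\mathbb R^{d\times d}$ positive definite. There are embeddings $e_1,\dots,e_H\in\mathbb R^{d_e}$ with $\|e_i\|_2=r$ and $\|e_i-e_j\|_2=f(|i-j|)$, where $f$ takes different values at different time gaps in $\{0,\dots,H-1\}$, and $\Gamma_{ij}$ depends only on $\|e_i-e_j\|_2$. For a set $I\subset\{1,\dots,H\}$ of observed indices, $\emptyset\ne I\ne\{1,\dots,H\}$, let $x_{\rm obs}=(x_i)_{i\in I}$, $x_{\rm miss}=(x_j)_{j\notin I}$, with means $\mu_{\rm obs},\mu_{\rm miss}$. Let $\Sigma_{\rm obs},\Sigma_{\rm miss}$ be their covariances and $\Gamma_{\rm obs},\Gamma_{\rm miss}$ the corresponding principal submatrices of $\Gamma$; let $\Sigma_{\rm cor}=\mathrm{Cov}[x_{\rm obs},x_{\rm miss}]$ and $\Sigma_{\rm cond}=\Sigma_{\rm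 miss}-\Sigma_{\rm cor}^\top\Sigma_{\rm obs}^{-1}\Sigma_{\rm cor}$. Write $\kappa=\lambda_{\max}/\lambda_{\min}$ and $\kappa_{\max}(\cdot)=\sup_I\kappa(\cdot)$. Put $\alpha_t=e^{-t/2}$, $\sigma_t=\sqrt{1-e^{-t}}$, and let $p_t(\cdot\mid x_{\rm obs})$ be the density of $\alpha_t x_{\rm miss}+\sigma_t z$ given $x_{\rm obs}$, where $z\sim\mathcal N(0,\mathrm{Id})$ is independent of $x$. This is the marginal at time $t$ of $dx_t=-\tfrac12x_t\,dt+dw_t$ started from the conditional law of $x_{\rm miss}$. **Transformers.** On $Y\in\mathbb R^{D\times H}$ a block is $\mathrm{FFN}\circ\mathrm{Attn}$ with $$\mathrm{Attn}(Y)=Y+\sum_{m=1}^{M}V^mY\,\mathrm{ReLU}\big((Q^mY)^\top K^mY\big),\qquad \mathrm{FFN}(Y)=Y+W_1\mathrm{ReLU}(W_2Y+b_2\mathbf 1^\top)+b_1\mathbf 1^\top,$$ all weight matrices being $D\times D$. The class $\mathcal T(D,L,M,B,R)$ consists of the maps $f_{\rm out}\circ(\text{$L$ blocks with $M$ heads})\circ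 f_{\rm in}$ in which every weight matrix has Frobenius norm (and every offset vector has Euclidean norm) at most $B$ and the output has norm at most $R$. The encoder $f_{\rm in}$ sends $(I,v,x_{\rm obs},t)$ to the matrix with $i$-th column $(y_i,e_i,\phi(t),1,\mathbf 1_{i\in I},\mathbf 1_{i\notin I},\mathbf 1_{i\in I}\,y_i,0,\dots,0)$. Here $y_i=(x_{\rm obs}-\mu_{\rm obs})_i$ for $i\in I$ and $y_i=(v-\alpha_t\mu_{\rm miss})_i$ for $i\notin I$; $\phi(t)=(\eta_t,\alpha_t,\sigma_t^2,\alpha_t^2)$ with $\eta_t=2/(\lambda_{\min}(S_t)+\lambda_{\max}(S_t))$ and $S_t=\alpha_t^2\Sigma_{\rm cond}+\sigma_t^2\mathrm{Id}$. The decoder $f_{\rm out}$ reads $d$ fixed coordinates of the columns $j\notin I$, flattens them, and truncates the vector to the ball of radius $R$. **Theorem.** For all $\ell>0$, $u$, $\Delta>0$ and $c$ there is a constant $C>0$, depending only on $\ell,u,\Delta,c$, such that the following holds for every model as above with - $\ell\le\lambda_{\max}(\Gamma_{\rm obs}),\lambda_{\max}(\Gamma_{\rm miss}),\lambda_{\max}(\Lambda)\le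 u$ for all $I$; - $|f(m)^2-f(m')^2|\ge\Delta$ for all $m\ne m'$ in $\{0,\dots,H-1\}$; - in the case $H=2$ also $\lambda_{\min}(\Gamma)\ge\ell$. For all $0<t_0\le T$ and $\epsilon\in(0,1)$ there are $D,L,B,R$ with $$D\le C(d+d_e),\qquad L\le C\,\kappa_{\max}^2(\Sigma_{\rm cond})\,\kappa_{\max}(\Sigma_{\rm obs})\log^3\!\Big(\frac{Hd\,\kappa_{\max}^2(\Sigma_{\rm cond})\kappa_{\max}(\Sigma_{\rm obs})}{\epsilon}\Big),\qquad M=4H,$$ $$B\le C\sqrt{Hd^3}\,\big(r^2+\kappa_{\max}(\Sigma_{\rm obs})\sigma_{t_0}^{-1}\big),\qquad R\le C\,\sigma_{t_0}^{-2}\sqrt{Hd}\,\kappa_{\max}(\Sigma_{\rm obs}),$$ and a single $\tilde s\in\mathcal T(D,L,M,B,R)$ such that $$\|\tilde s(I,v,x_{\rm obs},t)-\nabla_v\log p_t(v\mid x_{\rm obs})\|_2\le\sigma_t^{-1}\epsilon$$ for all observed sets $I$, all $t\in[t_0,T]$ and all $v,x_{\rm obs}$ with $\|x_{\rm obs}-\mu_{\rm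 obs}\|_2\le c\sqrt{Hd}$ and $\|v-\alpha_t\mu_{\rm miss}\|_2\le c\sqrt{Hd}$. -/

import Mathlib

open scoped Kronecker

noncomputable section

/-! ### Eigenvalues and condition numbers -/

/-- Largest eigenvalue of a (symmetric) real matrix. -/
def lamMax {ι : Type*} [Fintype ι] [DecidableEq ι] (A : Matrix ι ι ℝ) : ℝ := sSup (spectrum ℝ A)

/-- Smallest eigenvalue of a (symmetric) real matrix. -/
def lamMin {ι : Type*} [Fintype ι] [DecidableEq ι] (A : Matrix ι ι ℝ) : ℝ := sInf (spectrum ℝ A)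

/-- Condition number of a positive definite matrix. -/
def condNum {ι : Type*} [Fintype ι] [DecidableEq ι] (A : Matrix ι ι ℝ) : ℝ := lamMax A / lamMin A

/-- Frobenius norm. -/
def frob {m n : Type*} [Fintype m] [Fintype n] (A : Matrix m n ℝ) : ℝ :=
  Real.sqrt (∑ i, ∑ j, A i j ^ 2)

/-- Euclidean norm of a coordinate vector. -/
def vecNorm {n : Type*} [Fintype n] (b : n → ℝ) : ℝ := Real.sqrt (∑ i, b i ^ 2)

/-! ### The Gaussian process, missing patterns and covariances -/

/-- The set of observed time indices: some, but not all, frames are observed. -/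
abbrev Pattern (H : ℕ) : Type := {I : Finset (Fin H) // I.Nonempty ∧ I ≠ Finset.univ}

/-- Coordinates of the observed part. -/
abbrev ObsIdx {H : ℕ} (d : ℕ) (I : Pattern H) : Type := {i : Fin H // i ∈ I.1} × Fin d

/-- Coordinates of the missing part. -/
abbrev MissIdx {H : ℕ} (d : ℕ) (I : Pattern H) : Type := {j : Fin H // j ∉ I.1} × Fin d

/-- The time gap `|i - j|`. -/
def timeGap {H : ℕ} (i j : Fin H) : ℕ := ((i : ℤ) - (j : ℤ)).natAbs

/-- Parameters of a `d`-dimensional Gaussian process on `H` time points with law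
`N(mean, Γ ⊗ Λ)`, together with `dₑ`-dimensional positional embeddings. -/
structure GPModel (H d dₑ : ℕ) where
  mean : EuclideanSpace ℝ (Fin H × Fin d)
  emb : Fin H → EuclideanSpace ℝ (Fin dₑ)
  Γ : Matrix (Fin H) (Fin H) ℝ
  Λ : Matrix (Fin d) (Fin d) ℝ

namespace GPModel

variable {H d dₑ : ℕ}

/-- The embeddings lie on a sphere of radius `r`, their distances are a function of the time gap
that separates different gaps, the kernel depends only on the distance of the embeddings, and
`Γ`, `Λ` are positive definite. -/
structure KernelAssumption (G : GPModel H d dₑ) (r : ℝ) : Prop where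
  norm_emb : ∀ i, ‖G.emb i‖ = r
  dist_emb : ∃ f : ℕ → ℝ, (∀ i j, ‖G.emb i - G.emb j‖ = f (timeGap i j)) ∧
    ∀ i₁ j₁ i₂ j₂ : Fin H, timeGap i₁ j₁ ≠ timeGap i₂ j₂ →
      f (timeGap i₁ j₁) ≠ f (timeGap i₂ j₂)
  kernel : ∃ g : ℝ → ℝ, ∀ i j, G.Γ i j = g ‖G.emb i - G.emb j‖
  posDef_Γ : G.Γ.PosDef
  posDef_Λ : G.Λ.PosDef

/-- Covariance of the whole sequence. -/
def cov (G : GPModel H d dₑ) : Matrix (Fin H × Fin d) (Fin H × Fin d) ℝ := G.Γ ⊗ₖ G.Λ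

/-- Temporal covariance among the observed indices. -/
def gamObs (G : GPModel H d dₑ) (I : Pattern H) : Matrix {i // i ∈ I.1} {i // i ∈ I.1} ℝ :=
  G.Γ.submatrix Subtype.val Subtype.val

/-- Temporal covariance among the missing indices. -/
def gamMiss (G : GPModel H d dₑ) (I : Pattern H) : Matrix {i // i ∉ I.1} {i // i ∉ I.1} ℝ :=
  G.Γ.submatrix Subtype.val Subtype.val

def covObs (G : GPModel H d dₑ) (I : Pattern H) : Matrix (ObsIdx d I) (ObsIdx d I) ℝ :=
  G.cov.submatrix (fun p => (p.1.1, p.2)) (fun p => (p.1.1, p.2))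

def covMiss (G : GPModel H d dₑ) (I : Pattern H) : Matrix (MissIdx d I) (MissIdx d I) ℝ :=
  G.cov.submatrix (fun p => (p.1.1, p.2)) (fun p => (p.1.1, p.2))

/-- `Cov[x_obs, x_miss]`. -/
def covCor (G : GPModel H d dₑ) (I : Pattern H) : Matrix (ObsIdx d I) (MissIdx d I) ℝ :=
  G.cov.submatrix (fun p => (p.1.1, p.2)) (fun p => (p.1.1, p.2))

/-- Covariance of `x_miss` given `x_obs`. -/
def covCond (G : GPModel H d dₑ) (I : Pattern H) : Matrix (MissIdx d I) (MissIdx d I) ℝ :=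
  G.covMiss I - (G.covCor I).transpose * (G.covObs I)⁻¹ * G.covCor I

def meanObs (G : GPModel H d dₑ) (I : Pattern H) : EuclideanSpace ℝ (ObsIdx d I) :=
  WithLp.toLp 2 fun p => G.mean (p.1.1, p.2)

def meanMiss (G : GPModel H d dₑ) (I : Pattern H) : EuclideanSpace ℝ (MissIdx d I) :=
  WithLp.toLp 2 fun p => G.mean (p.1.1, p.2)

/-- `κ_max(Σ_obs)`, the worst case over all missing patterns. -/
def kapObs (G : GPModel H d dₑ) : ℝ := ⨆ I : Pattern H, condNum (G.covObs I)

/-- `κ_max(Σ_cond)`, the worst case over all missing patterns. -/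
def kapCond (G : GPModel H d dₑ) : ℝ := ⨆ I : Pattern H, condNum (G.covCond I)

end GPModel

/-! ### The forward diffusion and the conditional score -/

/-- `α_t`. -/
def alph (t : ℝ) : ℝ := Real.exp (-t / 2)

/-- `σ_t`. -/
def sigm (t : ℝ) : ℝ := Real.sqrt (1 - Real.exp (-t))

/-- Density of the Gaussian law `N(m, S)`. -/
def gaussDensity {ι : Type*} [Fintype ι] [DecidableEq ι] (m : EuclideanSpace ℝ ι)
    (S : Matrix ι ι ℝ) (x : EuclideanSpace ℝ ι) : ℝ :=
  (Real.sqrt ((2 * Real.pi) ^ Fintype.card ι * S.det))⁻¹ *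
    Real.exp (-(1 / 2) * ((x - m).ofLp ⬝ᵥ S⁻¹.mulVec (x - m).ofLp))

namespace GPModel

variable {H d dₑ : ℕ}

/-- The full sequence with observed part `x` and missing part `y`. -/
def glue (I : Pattern H) (x : EuclideanSpace ℝ (ObsIdx d I)) (y : EuclideanSpace ℝ (MissIdx d I)) :
    EuclideanSpace ℝ (Fin H × Fin d) :=
  WithLp.toLp 2 fun p =>
    if h : p.1 ∈ I.1 then x (⟨p.1, h⟩, p.2) else y (⟨p.1, h⟩, p.2)

/-- Conditional density of `x_miss` at `y` given `x_obs = x`: joint over marginal density. -/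
def condDensity (G : GPModel H d dₑ) (I : Pattern H) (x : EuclideanSpace ℝ (ObsIdx d I))
    (y : EuclideanSpace ℝ (MissIdx d I)) : ℝ :=
  gaussDensity G.mean G.cov (glue I x y) / ∫ z, gaussDensity G.mean G.cov (glue I x z)

/-- Density `p_t(v | x_obs)` at time `t > 0` of the Ornstein-Uhlenbeck forward process started
from the conditional law of `x_miss` given `x_obs = x`; its transition law from `y` is
`N(α_t y, σ_t² I)`. -/
def diffDensity (G : GPModel H d dₑ) (I : Pattern H) (x : EuclideanSpace ℝ (ObsIdx d I)) (t : ℝ)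
    (v : EuclideanSpace ℝ (MissIdx d I)) : ℝ :=
  ∫ y, G.condDensity I x y *
    gaussDensity (alph t • y) (sigm t ^ 2 • (1 : Matrix (MissIdx d I) (MissIdx d I) ℝ)) v

/-- The conditional score `∇ log p_t(v | x_obs)`. -/
def score (G : GPModel H d dₑ) (I : Pattern H) (v : EuclideanSpace ℝ (MissIdx d I))
    (x : EuclideanSpace ℝ (ObsIdx d I)) (t : ℝ) : EuclideanSpace ℝ (MissIdx d I) :=
  gradient (fun w => Real.log (G.diffDensity I x t w)) v

end GPModel

/-! ### Transformers -/

/-- One attention head. -/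
structure Head (ι : Type) where
  V : Matrix ι ι ℝ
  Q : Matrix ι ι ℝ
  K : Matrix ι ι ℝ

/-- Parameters of one transformer block with `M` heads acting on tokens with channels `ι`. -/
structure Block (ι : Type) (M : ℕ) where
  head : Fin M → Head ι
  W₁ : Matrix ι ι ℝ
  W₂ : Matrix ι ι ℝ
  b₁ : ι → ℝ
  b₂ : ι → ℝ

namespace Block

variable {ι : Type} [Fintype ι] {M H : ℕ}

/-- Entrywise ReLU. -/
def relu {m n : Type*} (A : Matrix m n ℝ) : Matrix m n ℝ := A.map fun a => max a 0

/-- Multi-head attention with ReLU activation. -/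
def attn (b : Block ι M) (Y : Matrix ι (Fin H) ℝ) : Matrix ι (Fin H) ℝ :=
  Y + ∑ m, (b.head m).V * Y *
    relu (((b.head m).Q * Y).transpose * ((b.head m).K * Y))

/-- Feedforward layer. -/
def ffn (b : Block ι M) (Y : Matrix ι (Fin H) ℝ) : Matrix ι (Fin H) ℝ :=
  Y + b.W₁ * relu (b.W₂ * Y + Matrix.of fun c _ => b.b₂ c) + Matrix.of fun c _ => b.b₁ c

/-- One block: attention followed by feedforward. -/
def apply (b : Block ι M) (Y : Matrix ι (Fin H) ℝ) : Matrix ι (Fin H) ℝ := b.ffn (b.attn Y)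

/-- All parameters of the block are bounded by `B` in Frobenius norm. -/
def BoundedBy (b : Block ι M) (B : ℝ) : Prop :=
  (∀ m, frob (b.head m).V ≤ B ∧ frob (b.head m).Q ≤ B ∧ frob (b.head m).K ≤ B) ∧
    frob b.W₁ ≤ B ∧ frob b.W₂ ≤ B ∧ vecNorm b.b₁ ≤ B ∧ vecNorm b.b₂ ≤ B

/-- Apply a list of blocks, the head of the list first. -/
def run (bs : List (Block ι M)) (Y : Matrix ι (Fin H) ℝ) : Matrix ι (Fin H) ℝ :=
  bs.foldl (fun Z b => b.apply Z) Y

end Block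

/-- Channels of a token: frame, positional embedding, time embedding, three indicators, copy of
the observed frame, and `p` buffer channels. -/
abbrev Channel (d dₑ p : ℕ) : Type :=
  Fin d ⊕ Fin dₑ ⊕ Fin 4 ⊕ Fin 3 ⊕ Fin d ⊕ Fin p

namespace GPModel

variable {H d dₑ : ℕ}

/-- Step size of gradient descent for the quadratic problem whose solution is the score. -/
def stepSize (G : GPModel H d dₑ) (I : Pattern H) (t : ℝ) : ℝ :=
  2 / (lamMin (alph t ^ 2 • G.covCond I + sigm t ^ 2 • (1 : Matrix (MissIdx d I) (MissIdx d I) ℝ)) +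
    lamMax (alph t ^ 2 • G.covCond I + sigm t ^ 2 • (1 : Matrix (MissIdx d I) (MissIdx d I) ℝ)))

/-- Time embedding `φ(t) = (η_t, α_t, σ_t², α_t²)`. -/
def timeEmb (G : GPModel H d dₑ) (I : Pattern H) (t : ℝ) : Fin 4 → ℝ :=
  ![G.stepSize I t, alph t, sigm t ^ 2, alph t ^ 2]

/-- The (centred) input frames: observed frames minus their mean and diffused missing frames minus
`α_t` times their mean. -/
def frame (G : GPModel H d dₑ) (I : Pattern H) (v : EuclideanSpace ℝ (MissIdx d I))
    (x : EuclideanSpace ℝ (ObsIdx d I)) (t : ℝ) : EuclideanSpace ℝ (Fin H × Fin d) :=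
  glue I (x - G.meanObs I) (v - alph t • G.meanMiss I)

/-- The encoder: the column of time `i` is
`(frame_i, e_i, φ(t), 1, 1{i observed}, 1{i missing}, 1{i observed} frame_i, 0)`. -/
def encode (G : GPModel H d dₑ) (p : ℕ) (I : Pattern H) (v : EuclideanSpace ℝ (MissIdx d I))
    (x : EuclideanSpace ℝ (ObsIdx d I)) (t : ℝ) : Matrix (Channel d dₑ p) (Fin H) ℝ :=
  fun c i => match c with
    | .inl k => G.frame I v x t (i, k)
    | .inr (.inl k) => G.emb i k
    | .inr (.inr (.inl k)) => G.timeEmb I t k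
    | .inr (.inr (.inr (.inl k))) => ![1, if i ∈ I.1 then 1 else 0, if i ∈ I.1 then 0 else 1] k
    | .inr (.inr (.inr (.inr (.inl k)))) => if i ∈ I.1 then G.frame I v x t (i, k) else 0
    | .inr (.inr (.inr (.inr (.inr _)))) => 0

end GPModel

/-- Truncation of a vector to the ball of radius `R`. -/
def clip {E : Type*} [NormedAddCommGroup E] [NormedSpace ℝ E] (R : ℝ) (s : E) : E :=
  open Classical in if ‖s‖ ≤ R then s else (R / ‖s‖) • s

/-- The decoder: read `d` channels at the missing time points, flatten, and truncate. -/
def decode {H d : ℕ} {ι : Type} (out : Fin d ↪ ι) (R : ℝ) (I : Pattern H)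
    (Y : Matrix ι (Fin H) ℝ) : EuclideanSpace ℝ (MissIdx d I) :=
  clip R (WithLp.toLp 2 fun q => Y (out q.2) q.1.1)

/-- Functions of a missing pattern, a diffused missing part, an observed part and a time. -/
abbrev ScoreFun (H d : ℕ) : Type :=
  (I : Pattern H) → EuclideanSpace ℝ (MissIdx d I) → EuclideanSpace ℝ (ObsIdx d I) → ℝ →
    EuclideanSpace ℝ (MissIdx d I)

/-- The transformer class `𝒯(D, L, M, B, R)`: token dimension `D`, `L` blocks, `M` heads per block
(fewer heads are obtained with zero weights), parameters bounded by `B`, output bounded by `R`. -/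
def transformerClass {H d dₑ : ℕ} (G : GPModel H d dₑ) (D L M : ℕ) (B R : ℝ) :
    Set (ScoreFun H d) :=
  {s | ∃ (p : ℕ) (bs : List (Block (Channel d dₑ p) M)) (out : Fin d ↪ Channel d dₑ p),
    Fintype.card (Channel d dₑ p) = D ∧ bs.length = L ∧ (∀ b ∈ bs, b.BoundedBy B) ∧
    (∀ I v x t, s I v x t = decode out R I (Block.run bs (G.encode p I v x t))) ∧
    ∀ I v x t, ‖s I v x t‖ ≤ R}

end

open Matrix

noncomputable section

/-! The score comes from one linear system. The observed frames together with the diffused missing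
frames form a Gaussian vector with covariance `diffCov`, which is `cov` rescaled by `α_t` on the
missing frames plus `σ_t²` on their diagonal. Call it `M`. Completing the square in the defining
integral shows that `p_t(v | x_obs)` is a constant in `v` times `exp(-w·M⁻¹w/2)`, where `w` is the
centred frame. Hence the score is the missing part of the solution of `M s = -w` (`score_eq`). The
observed covariance never has to be inverted in a nested loop.

Gradient descent `z ↦ z - h(w + M z)` started at `0` solves this system. If `l ≤ M ≤ u + 1` and `h =
(u + 1)⁻¹`, each step shrinks the squared error by `1 - h l`, so one fixed step size serves every
pattern and time. The upper bound `u` is an absolute constant. The lower bound (`le_dotProduct_cov`)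
uses that the conditional covariance is a partial minimum of the full quadratic form: observing one
frame controls all the other frames, and two choices of that frame control everything. This gives
`l` of order `1/(κ_obs κ_cond)`, so `κ_obs κ_cond` times a logarithm bounds the number of steps,
within the depth budget.

Each step is one attention block. Since the embeddings lie on a sphere, their inner products
determine the time gap, and values for different gaps are at least `gap/2` apart. So `Γ` is a sum of
`H` hat functions of the inner product, each made of three ReLU ramps (`sum_ramp_eq_Γ`). Two more
heads add `w` and the noise term, and `3H + 2 ≤ 4H`. A preliminary block stores the scaling factors
and the scaled embeddings; homogeneity of ReLU then produces the factors `α_t`. Orthogonal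
projection onto the span of the embeddings keeps query and key norms independent of `dₑ`.

Truncation at most doubles the error once the score lies in the ball. An energy estimate for the
missing part alone (`norm_score_le`) supplies that radius with only `κ_obs` and `σ⁻²`. -/

theorem dotProduct_self_nonneg_real {ι : Type*} [Fintype ι] (x : ι → ℝ) : 0 ≤ x ⬝ᵥ x :=
  Finset.sum_nonneg fun _ _ => mul_self_nonneg _

/-! ### Extreme eigenvalues and Rayleigh quotients -/

section Eigen

variable {ι : Type*} [Fintype ι] [DecidableEq ι] {A : Matrix ι ι ℝ}

theorem bddAbove_spectrum_real (hA : A.IsHermitian) : BddAbove (spectrum ℝ A) := by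
  rw [hA.spectrum_real_eq_range_eigenvalues]
  exact (Set.finite_range _).bddAbove

theorem bddBelow_spectrum_real (hA : A.IsHermitian) : BddBelow (spectrum ℝ A) := by
  rw [hA.spectrum_real_eq_range_eigenvalues]
  exact (Set.finite_range _).bddBelow

theorem dotProduct_mulVec_eq_sum_eigenvalues (hA : A.IsHermitian) (x : ι → ℝ) :
    ∃ y : ι → ℝ, y ⬝ᵥ y = x ⬝ᵥ x ∧ x ⬝ᵥ A *ᵥ x = ∑ i, hA.eigenvalues i * y i ^ 2 := by
  set U : Matrix ι ι ℝ := (hA.eigenvectorUnitary : Matrix ι ι ℝ) with hU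
  have hUU : U * star U = 1 := Unitary.mul_star_self_of_mem hA.eigenvectorUnitary.2
  have hs : star U = Uᵀ := by rw [star_eq_conjTranspose, conjTranspose_eq_transpose_of_trivial]
  refine ⟨Uᵀ *ᵥ x, ?_, ?_⟩
  · rw [dotProduct_mulVec, ← mulVec_transpose, transpose_transpose, mulVec_mulVec, ← hs, hUU,
      one_mulVec]
  · have h := hA.spectral_theorem
    rw [Unitary.conjStarAlgAut_apply] at h
    have h' : A = U * diagonal hA.eigenvalues * Uᵀ := by
      rw [← hs]
      exact h
    have : A *ᵥ x = U *ᵥ (diagonal hA.eigenvalues *ᵥ (Uᵀ *ᵥ x)) := by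
      rw [mulVec_mulVec, mulVec_mulVec]
      conv_lhs => rw [h']
    rw [this, dotProduct_mulVec, ← mulVec_transpose]
    simp only [dotProduct, mulVec_diagonal]
    exact Finset.sum_congr rfl fun i _ => by ring

theorem dotProduct_mulVec_le_lamMax (hA : A.IsHermitian) (x : ι → ℝ) :
    x ⬝ᵥ A *ᵥ x ≤ lamMax A * (x ⬝ᵥ x) := by
  obtain ⟨y, hy, h⟩ := dotProduct_mulVec_eq_sum_eigenvalues hA x
  rw [h, ← hy, dotProduct, Finset.mul_sum]
  refine Finset.sum_le_sum fun i _ => ?_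
  rw [← sq]
  exact mul_le_mul_of_nonneg_right
    (le_csSup (bddAbove_spectrum_real hA) (hA.eigenvalues_mem_spectrum_real i)) (sq_nonneg _)

theorem lamMin_mul_le_dotProduct_mulVec (hA : A.IsHermitian) (x : ι → ℝ) :
    lamMin A * (x ⬝ᵥ x) ≤ x ⬝ᵥ A *ᵥ x := by
  obtain ⟨y, hy, h⟩ := dotProduct_mulVec_eq_sum_eigenvalues hA x
  rw [h, ← hy, dotProduct, Finset.mul_sum]
  refine Finset.sum_le_sum fun i _ => ?_
  rw [← sq]
  exact mul_le_mul_of_nonneg_right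
    (csInf_le (bddBelow_spectrum_real hA) (hA.eigenvalues_mem_spectrum_real i)) (sq_nonneg _)

theorem exists_eigenvector_of_mem_spectrum {μ : ℝ} (h : μ ∈ spectrum ℝ A) :
    ∃ x : ι → ℝ, 0 < x ⬝ᵥ x ∧ A *ᵥ x = μ • x := by
  rw [← Matrix.spectrum_toLin', ← Module.End.hasEigenvalue_iff_mem_spectrum] at h
  obtain ⟨x, hx⟩ := h.exists_hasEigenvector
  refine ⟨x, ?_, by simpa using hx.apply_eq_smul⟩
  simpa using (Matrix.dotProduct_star_self_pos_iff (v := x)).2 hx.2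

theorem spectrum_real_nonempty [Nonempty ι] (hA : A.IsHermitian) : (spectrum ℝ A).Nonempty := by
  rw [hA.spectrum_real_eq_range_eigenvalues]
  exact Set.range_nonempty _

theorem spectrum_real_finite (hA : A.IsHermitian) : (spectrum ℝ A).Finite := by
  rw [hA.spectrum_real_eq_range_eigenvalues]
  exact Set.finite_range _

theorem exists_eigenvector_lamMax [Nonempty ι] (hA : A.IsHermitian) :
    ∃ x : ι → ℝ, 0 < x ⬝ᵥ x ∧ A *ᵥ x = lamMax A • x :=
  exists_eigenvector_of_mem_spectrum
    ((spectrum_real_nonempty hA).csSup_mem (spectrum_real_finite hA))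

theorem exists_eigenvector_lamMin [Nonempty ι] (hA : A.IsHermitian) :
    ∃ x : ι → ℝ, 0 < x ⬝ᵥ x ∧ A *ᵥ x = lamMin A • x :=
  exists_eigenvector_of_mem_spectrum
    ((spectrum_real_nonempty hA).csInf_mem (spectrum_real_finite hA))

theorem le_lamMax (hA : A.IsHermitian) {c : ℝ} {x : ι → ℝ} (hx : 0 < x ⬝ᵥ x)
    (h : c * (x ⬝ᵥ x) ≤ x ⬝ᵥ A *ᵥ x) : c ≤ lamMax A :=
  le_of_mul_le_mul_right (h.trans (dotProduct_mulVec_le_lamMax hA x)) hx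

theorem lamMin_le (hA : A.IsHermitian) {c : ℝ} {x : ι → ℝ} (hx : 0 < x ⬝ᵥ x)
    (h : x ⬝ᵥ A *ᵥ x ≤ c * (x ⬝ᵥ x)) : lamMin A ≤ c :=
  le_of_mul_le_mul_right ((lamMin_mul_le_dotProduct_mulVec hA x).trans h) hx

theorem lamMin_pos [Nonempty ι] (hA : A.PosDef) : 0 < lamMin A := by
  obtain ⟨x, hx, h⟩ := exists_eigenvector_lamMin hA.1
  have h0 : x ≠ 0 := by rintro rfl; simp at hx
  have := hA.dotProduct_mulVec_pos h0
  rw [star_trivial, h, dotProduct_smul, smul_eq_mul] at this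
  exact (pos_iff_pos_of_mul_pos this).2 hx

theorem lamMin_le_lamMax [Nonempty ι] (hA : A.IsHermitian) : lamMin A ≤ lamMax A := by
  obtain ⟨x, hx, h⟩ := exists_eigenvector_lamMax hA
  exact lamMin_le hA hx (by rw [h, dotProduct_smul, smul_eq_mul])

theorem one_le_condNum [Nonempty ι] (hA : A.PosDef) : 1 ≤ condNum A := by
  rw [condNum, one_le_div (lamMin_pos hA)]
  exact lamMin_le_lamMax hA.1

theorem lamMax_div_le_lamMin [Nonempty ι] (hA : A.PosDef) {κ : ℝ} (h : condNum A ≤ κ) :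
    lamMax A / κ ≤ lamMin A := by
  have h1 := (one_le_condNum hA).trans h
  rw [condNum, div_le_iff₀ (lamMin_pos hA)] at h
  rw [div_le_iff₀ (by linarith)]
  linarith

end Eigen

/-! ### Linear convergence of gradient descent -/

section Richardson

variable {ι : Type*} [Fintype ι]

theorem dotProduct_mulVec_comm {A : Matrix ι ι ℝ} (hA : A.IsHermitian) (x y : ι → ℝ) :
    x ⬝ᵥ A *ᵥ y = y ⬝ᵥ A *ᵥ x := by
  rw [dotProduct_mulVec, ← mulVec_transpose, ← conjTranspose_eq_transpose_of_trivial, hA.eq,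
    dotProduct_comm]

/-- This is `A² ≤ A` for `0 ≤ A ≤ 1`, obtained without a square root: test `0 ≤ A` at `e - A e` and
`A ≤ 1` at `A e`, then add. -/
theorem mulVec_dotProduct_mulVec_le {A : Matrix ι ι ℝ} (hA : A.IsHermitian)
    (h0 : ∀ x, 0 ≤ x ⬝ᵥ A *ᵥ x) (h1 : ∀ x, x ⬝ᵥ A *ᵥ x ≤ x ⬝ᵥ x) (e : ι → ℝ) :
    (A *ᵥ e) ⬝ᵥ (A *ᵥ e) ≤ e ⬝ᵥ A *ᵥ e := by
  set a := A *ᵥ e with ha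
  have k1 := h1 a
  have k2 := h0 (e - a)
  have e1 : e ⬝ᵥ A *ᵥ a = a ⬝ᵥ a := by rw [dotProduct_mulVec_comm hA]
  have e2 : (e - a) ⬝ᵥ A *ᵥ (e - a) = e ⬝ᵥ a - 2 * (a ⬝ᵥ a) + a ⬝ᵥ A *ᵥ a := by
    rw [mulVec_sub, sub_dotProduct, dotProduct_sub, dotProduct_sub, e1, ← ha]
    ring
  rw [e2] at k2
  linarith

theorem mulVec_dotProduct_mulVec_le_sq {A : Matrix ι ι ℝ} (hA : A.IsHermitian) {u : ℝ} (hu : 0 < u)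
    (h0 : ∀ x, 0 ≤ x ⬝ᵥ A *ᵥ x) (h1 : ∀ x, x ⬝ᵥ A *ᵥ x ≤ u * (x ⬝ᵥ x)) (e : ι → ℝ) :
    (A *ᵥ e) ⬝ᵥ (A *ᵥ e) ≤ u ^ 2 * (e ⬝ᵥ e) := by
  have hq : ∀ x, x ⬝ᵥ (u⁻¹ • A) *ᵥ x = u⁻¹ * (x ⬝ᵥ A *ᵥ x) := fun x => by
    rw [smul_mulVec, dotProduct_smul, smul_eq_mul]
  have hq1 : ∀ x, x ⬝ᵥ (u⁻¹ • A) *ᵥ x ≤ x ⬝ᵥ x := fun x => by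
    rw [hq, inv_mul_le_iff₀ hu]
    exact h1 x
  have h := (mulVec_dotProduct_mulVec_le (hA.smul (IsSelfAdjoint.all u⁻¹))
    (fun x => by rw [hq]; exact mul_nonneg (inv_nonneg.2 hu.le) (h0 x)) hq1 e).trans (hq1 e)
  rw [smul_mulVec, smul_dotProduct, dotProduct_smul, smul_eq_mul, smul_eq_mul, ← mul_assoc,
    ← mul_inv, ← sq, inv_mul_le_iff₀ (by positivity)] at h
  exact h

/-- A step of gradient descent with a step size below the inverse smoothness contracts. -/
theorem dotProduct_sub_mulVec_self_le {A : Matrix ι ι ℝ} (hA : A.IsHermitian) {l : ℝ}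
    (h0 : ∀ x, l * (x ⬝ᵥ x) ≤ x ⬝ᵥ A *ᵥ x) (hl : 0 ≤ l) (h1 : ∀ x, x ⬝ᵥ A *ᵥ x ≤ x ⬝ᵥ x)
    (e : ι → ℝ) :
    (e - A *ᵥ e) ⬝ᵥ (e - A *ᵥ e) ≤ (1 - l) * (e ⬝ᵥ e) := by
  have hnn : ∀ x : ι → ℝ, 0 ≤ x ⬝ᵥ A *ᵥ x := fun x =>
    (mul_nonneg hl (dotProduct_self_nonneg_real x)).trans (h0 x)
  have k1 := mulVec_dotProduct_mulVec_le hA hnn h1 e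
  have k3 := h0 e
  rw [sub_dotProduct, dotProduct_sub, dotProduct_sub, dotProduct_comm (A *ᵥ e) e]
  linarith

/-- The solution `s` is the fixed point, so the error evolves by `1 - h M`. Starting from `0` makes
the initial error equal to `s` in norm. -/
theorem iterate_richardson_sub {M : Matrix ι ι ℝ} (hM : M.IsHermitian) {l h : ℝ}
    (h0 : ∀ x, l * (x ⬝ᵥ x) ≤ x ⬝ᵥ M *ᵥ x) (hl : 0 ≤ l) (hh : 0 ≤ h) (hle : h * l ≤ 1)
    (h1 : ∀ x, h * (x ⬝ᵥ M *ᵥ x) ≤ x ⬝ᵥ x) (w s : ι → ℝ) (hs : M *ᵥ s = -w) (k : ℕ) :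
    ((fun z => z - h • (w + M *ᵥ z))^[k] 0 - s) ⬝ᵥ ((fun z => z - h • (w + M *ᵥ z))^[k] 0 - s)
      ≤ (1 - h * l) ^ k * (s ⬝ᵥ s) := by
  induction k with
  | zero => simp
  | succ k ih =>
    rw [Function.iterate_succ_apply']
    set z := (fun z => z - h • (w + M *ᵥ z))^[k] 0
    have e : z - h • (w + M *ᵥ z) - s = (z - s) - (h • M) *ᵥ (z - s) := by
      rw [smul_mulVec, mulVec_sub, hs]
      simp only [smul_add, smul_sub, smul_neg]
      abel
    rw [e, pow_succ', mul_assoc]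
    refine (dotProduct_sub_mulVec_self_le (A := h • M) (l := h * l) ?_ ?_ (by positivity) ?_ _).trans
      (mul_le_mul_of_nonneg_left ih (by linarith))
    · exact hM.smul (IsSelfAdjoint.all h)
    · intro x
      rw [smul_mulVec, dotProduct_smul, smul_eq_mul, mul_assoc]
      exact mul_le_mul_of_nonneg_left (h0 x) hh
    · intro x
      rw [smul_mulVec, dotProduct_smul, smul_eq_mul]
      exact h1 x

end Richardson

/-! ### Quadratic forms of Kronecker products -/

section Kron

set_option linter.unusedSectionVars false
variable {m n : Type*} [Fintype m] [Fintype n] [DecidableEq m] [DecidableEq n]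

theorem PosSemidef_of_dotProduct_le {A B : Matrix m m ℝ} (hA : A.IsHermitian) (hB : B.IsHermitian)
    (h : ∀ x, x ⬝ᵥ A *ᵥ x ≤ x ⬝ᵥ B *ᵥ x) : (B - A).PosSemidef := by
  refine Matrix.PosSemidef.of_dotProduct_mulVec_nonneg (hB.sub hA) fun x => ?_
  rw [star_trivial, sub_mulVec, dotProduct_sub]
  exact sub_nonneg.2 (h x)

theorem Matrix.PosSemidef.dotProduct_le_of_sub {A B : Matrix m m ℝ} (h : (B - A).PosSemidef)
    (x : m → ℝ) : x ⬝ᵥ A *ᵥ x ≤ x ⬝ᵥ B *ᵥ x := by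
  have := h.dotProduct_mulVec_nonneg x
  rw [star_trivial, sub_mulVec, dotProduct_sub] at this
  linarith

theorem dotProduct_smul_one_mulVec (a : ℝ) (x : m → ℝ) :
    x ⬝ᵥ (a • (1 : Matrix m m ℝ)) *ᵥ x = a * (x ⬝ᵥ x) := by
  rw [smul_mulVec, one_mulVec, dotProduct_smul, smul_eq_mul]

theorem isHermitian_smul_one (a : ℝ) : (a • (1 : Matrix m m ℝ)).IsHermitian :=
  isHermitian_one.smul (IsSelfAdjoint.all a)

theorem sub_kronecker' (A A' : Matrix m m ℝ) (B : Matrix n n ℝ) :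
    (A - A') ⊗ₖ B = A ⊗ₖ B - A' ⊗ₖ B := by
  ext; simp [sub_mul]

theorem kronecker_sub' (A : Matrix m m ℝ) (B B' : Matrix n n ℝ) :
    A ⊗ₖ (B - B') = A ⊗ₖ B - A ⊗ₖ B' := by
  ext; simp [mul_sub]

/-- Replace one factor at a time in the Loewner order, `A ⊗ B ≤ a ⊗ B ≤ a ⊗ b`; each difference is a
Kronecker product of positive semidefinite matrices. -/
theorem dotProduct_kronecker_le {A : Matrix m m ℝ} {B : Matrix n n ℝ} (hA : A.IsHermitian)
    (hB : B.PosSemidef) {a b : ℝ} (ha : 0 ≤ a) (h1 : ∀ x, x ⬝ᵥ A *ᵥ x ≤ a * (x ⬝ᵥ x))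
    (h2 : ∀ x, x ⬝ᵥ B *ᵥ x ≤ b * (x ⬝ᵥ x)) (x : m × n → ℝ) :
    x ⬝ᵥ (A ⊗ₖ B) *ᵥ x ≤ a * b * (x ⬝ᵥ x) := by
  have p1 : (a • (1 : Matrix m m ℝ) - A).PosSemidef :=
    PosSemidef_of_dotProduct_le hA (isHermitian_smul_one a) fun x => by
      rw [dotProduct_smul_one_mulVec]; exact h1 x
  have p2 : (b • (1 : Matrix n n ℝ) - B).PosSemidef :=
    PosSemidef_of_dotProduct_le hB.1 (isHermitian_smul_one b) fun x => by
      rw [dotProduct_smul_one_mulVec]; exact h2 x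
  have q1 : ((a • (1 : Matrix m m ℝ)) ⊗ₖ B - A ⊗ₖ B).PosSemidef := by
    rw [← sub_kronecker']; exact p1.kronecker hB
  have q2 : ((a • (1 : Matrix m m ℝ)) ⊗ₖ (b • (1 : Matrix n n ℝ)) -
      (a • (1 : Matrix m m ℝ)) ⊗ₖ B).PosSemidef := by
    rw [← kronecker_sub']; exact (PosSemidef.one.smul ha).kronecker p2
  have e : (a • (1 : Matrix m m ℝ)) ⊗ₖ (b • (1 : Matrix n n ℝ)) = (a * b) • 1 := by
    rw [smul_kronecker, kronecker_smul, one_kronecker_one, smul_smul]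
  rw [← dotProduct_smul_one_mulVec, ← e]
  exact (q1.dotProduct_le_of_sub x).trans (q2.dotProduct_le_of_sub x)

theorem le_dotProduct_kronecker {A : Matrix m m ℝ} {B : Matrix n n ℝ} (hA : A.IsHermitian)
    (hB : B.PosSemidef) {a b : ℝ} (ha : 0 ≤ a) (h1 : ∀ x, a * (x ⬝ᵥ x) ≤ x ⬝ᵥ A *ᵥ x)
    (h2 : ∀ x, b * (x ⬝ᵥ x) ≤ x ⬝ᵥ B *ᵥ x) (x : m × n → ℝ) :
    a * b * (x ⬝ᵥ x) ≤ x ⬝ᵥ (A ⊗ₖ B) *ᵥ x := by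
  have p1 : (A - a • (1 : Matrix m m ℝ)).PosSemidef :=
    PosSemidef_of_dotProduct_le (isHermitian_smul_one a) hA fun x => by
      rw [dotProduct_smul_one_mulVec]; exact h1 x
  have p2 : (B - b • (1 : Matrix n n ℝ)).PosSemidef :=
    PosSemidef_of_dotProduct_le (isHermitian_smul_one b) hB.1 fun x => by
      rw [dotProduct_smul_one_mulVec]; exact h2 x
  have q1 : (A ⊗ₖ B - (a • (1 : Matrix m m ℝ)) ⊗ₖ B).PosSemidef := by
    rw [← sub_kronecker']; exact p1.kronecker hB
  have q2 : ((a • (1 : Matrix m m ℝ)) ⊗ₖ B -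
      (a • (1 : Matrix m m ℝ)) ⊗ₖ (b • (1 : Matrix n n ℝ))).PosSemidef := by
    rw [← kronecker_sub']; exact (PosSemidef.one.smul ha).kronecker p2
  have e : (a • (1 : Matrix m m ℝ)) ⊗ₖ (b • (1 : Matrix n n ℝ)) = (a * b) • 1 := by
    rw [smul_kronecker, kronecker_smul, one_kronecker_one, smul_smul]
  rw [← dotProduct_smul_one_mulVec, ← e]
  exact (q2.dotProduct_le_of_sub x).trans (q1.dotProduct_le_of_sub x)

theorem single_tensor_dotProduct_self (i : m) (w : n → ℝ) :
    (fun p : m × n => if p.1 = i then w p.2 else 0) ⬝ᵥ (fun p => if p.1 = i then w p.2 else 0)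
      = w ⬝ᵥ w := by
  simp [dotProduct, Fintype.sum_prod_type]

theorem single_tensor_dotProduct_kronecker (A : Matrix m m ℝ) (B : Matrix n n ℝ) (i : m)
    (w : n → ℝ) :
    (fun p : m × n => if p.1 = i then w p.2 else 0) ⬝ᵥ
      (A ⊗ₖ B) *ᵥ (fun p => if p.1 = i then w p.2 else 0) = A i i * (w ⬝ᵥ B *ᵥ w) := by
  simp only [dotProduct, mulVec, Fintype.sum_prod_type, kroneckerMap_apply, mul_ite, mul_zero,
    ite_mul, zero_mul]
  have : ∀ a b, (∑ x : m, ∑ y : n, if x = i then A a x * B b y * w y else 0)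
      = ∑ y, A a i * B b y * w y := fun a b => by
    rw [Finset.sum_comm]; simp
  simp_rw [this]
  rw [Finset.sum_comm]
  simp only [Finset.sum_ite_eq', Finset.mem_univ, if_true, Finset.mul_sum]
  exact Finset.sum_congr rfl fun _ _ => Finset.sum_congr rfl fun _ _ => by ring

end Kron

/-! ### Observed and missing blocks, Schur complement -/

namespace GPModel

variable {H d dₑ : ℕ}

/-- Glue two coordinate vectors on the observed and on the missing part. -/
def join (I : Pattern H) (x : ObsIdx d I → ℝ) (y : MissIdx d I → ℝ) : Fin H × Fin d → ℝ :=
  fun p => if h : p.1 ∈ I.1 then x (⟨p.1, h⟩, p.2) else y (⟨p.1, h⟩, p.2)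

/-- The coordinates are the observed and the missing ones. -/
def splitEquiv (d : ℕ) (I : Pattern H) : ObsIdx d I ⊕ MissIdx d I ≃ Fin H × Fin d where
  toFun := Sum.elim (fun p => (p.1.1, p.2)) (fun p => (p.1.1, p.2))
  invFun p := if h : p.1 ∈ I.1 then .inl (⟨p.1, h⟩, p.2) else .inr (⟨p.1, h⟩, p.2)
  left_inv := by
    rintro (p | p)
    · simp [p.1.2]
    · simp [p.1.2]
  right_inv p := by
    dsimp only
    split <;> rfl

theorem join_splitEquiv (I : Pattern H) (x : ObsIdx d I → ℝ) (y : MissIdx d I → ℝ) :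
    join I x y ∘ splitEquiv d I = Sum.elim x y := by
  ext (p | p)
  · simp [join, splitEquiv, p.1.2]
  · simp [join, splitEquiv, p.1.2]

@[simp] theorem join_obs (I : Pattern H) (x : ObsIdx d I → ℝ) (y : MissIdx d I → ℝ)
    (p : ObsIdx d I) : join I x y (p.1.1, p.2) = x p := by
  simp [join, p.1.2]

@[simp] theorem join_miss (I : Pattern H) (x : ObsIdx d I → ℝ) (y : MissIdx d I → ℝ)
    (p : MissIdx d I) : join I x y (p.1.1, p.2) = y p := by
  simp [join, p.1.2]

theorem exists_eq_join (I : Pattern H) (z : Fin H × Fin d → ℝ) :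
    z = join I (fun p => z (p.1.1, p.2)) (fun p => z (p.1.1, p.2)) := by
  ext p
  simp [join]

theorem sum_split (I : Pattern H) (f : Fin H × Fin d → ℝ) :
    ∑ p, f p = ∑ p : ObsIdx d I, f (p.1.1, p.2) + ∑ p : MissIdx d I, f (p.1.1, p.2) := by
  rw [← (splitEquiv d I).sum_comp, Fintype.sum_sum_type]
  rfl

theorem join_dotProduct (I : Pattern H) (x x' : ObsIdx d I → ℝ) (y y' : MissIdx d I → ℝ) :
    join I x y ⬝ᵥ join I x' y' = x ⬝ᵥ x' + y ⬝ᵥ y' := by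
  simp only [dotProduct, sum_split I, join_obs, join_miss]

variable (G : GPModel H d dₑ)

theorem KernelAssumption.posDef_cov {G : GPModel H d dₑ} {r : ℝ} (hG : G.KernelAssumption r) :
    G.cov.PosDef :=
  hG.posDef_Γ.kronecker hG.posDef_Λ

theorem cov_submatrix_split {r : ℝ} (hG : G.KernelAssumption r) (I : Pattern H) :
    G.cov.submatrix (splitEquiv d I) (splitEquiv d I) =
      fromBlocks (G.covObs I) (G.covCor I) (G.covCor I)ᴴ (G.covMiss I) := by
  ext (p | p) (q | q)
  · rfl
  · rfl
  · have := hG.posDef_cov.1.apply (p.1.1, p.2) (q.1.1, q.2)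
    simpa [splitEquiv, covCor] using this.symm
  · rfl

theorem posDef_covObs {r : ℝ} (hG : G.KernelAssumption r) (I : Pattern H) :
    (G.covObs I).PosDef := by
  refine hG.posDef_cov.submatrix ?_
  intro p q h
  simp only [Prod.mk.injEq] at h
  exact Prod.ext (Subtype.ext h.1) h.2

theorem covCond_eq (I : Pattern H) :
    G.covCond I = G.covMiss I - (G.covCor I)ᴴ * (G.covObs I)⁻¹ * G.covCor I := by
  rw [covCond, conjTranspose_eq_transpose_of_trivial]

/-- Schur complement by completing the square in `x`. Since the first term is nonnegative and can be
made zero, the form of `covCond` is the minimum over `x` of the full form; the lower bound on the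
covariance rests on this. -/
theorem dotProduct_cov_join {r : ℝ} (hG : G.KernelAssumption r) (I : Pattern H)
    (x : ObsIdx d I → ℝ) (y : MissIdx d I → ℝ) :
    join I x y ⬝ᵥ G.cov *ᵥ join I x y =
      (x + ((G.covObs I)⁻¹ * G.covCor I) *ᵥ y) ⬝ᵥ
        G.covObs I *ᵥ (x + ((G.covObs I)⁻¹ * G.covCor I) *ᵥ y) + y ⬝ᵥ G.covCond I *ᵥ y := by
  have := (G.posDef_covObs hG I).isUnit.invertible
  have h := schur_complement_eq₁₁ (G.covCor I) (G.covMiss I) x y (G.posDef_covObs hG I).1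
  rw [← cov_submatrix_split G hG, ← covCond_eq] at h
  simp only [star_trivial, ← dotProduct_mulVec] at h
  rw [← h, ← join_splitEquiv, submatrix_mulVec_equiv]
  simp only [Function.comp_assoc, Equiv.self_comp_symm, Function.comp_id]
  exact (comp_equiv_dotProduct_comp_equiv _ _ _).symm

theorem dotProduct_covObs (I : Pattern H) (x : ObsIdx d I → ℝ) :
    join I x 0 ⬝ᵥ G.cov *ᵥ join I x 0 = x ⬝ᵥ G.covObs I *ᵥ x := by
  simp [dotProduct, mulVec, sum_split I, covObs]

theorem dotProduct_covCond_le {r : ℝ} (hG : G.KernelAssumption r) (I : Pattern H)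
    (x : ObsIdx d I → ℝ) (y : MissIdx d I → ℝ) :
    y ⬝ᵥ G.covCond I *ᵥ y ≤ join I x y ⬝ᵥ G.cov *ᵥ join I x y := by
  rw [dotProduct_cov_join G hG]
  have := (G.posDef_covObs hG I).posSemidef.dotProduct_mulVec_nonneg
    (x + ((G.covObs I)⁻¹ * G.covCor I) *ᵥ y)
  rw [star_trivial] at this
  linarith

theorem exists_dotProduct_covCond_eq {r : ℝ} (hG : G.KernelAssumption r) (I : Pattern H)
    (y : MissIdx d I → ℝ) :
    ∃ x, y ⬝ᵥ G.covCond I *ᵥ y = join I x y ⬝ᵥ G.cov *ᵥ join I x y :=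
  ⟨-(((G.covObs I)⁻¹ * G.covCor I) *ᵥ y), by rw [dotProduct_cov_join G hG]; simp⟩

theorem posDef_covCond {r : ℝ} (hG : G.KernelAssumption r) (I : Pattern H) :
    (G.covCond I).PosDef := by
  refine Matrix.PosDef.of_dotProduct_mulVec_pos ?_ fun y hy => ?_
  · rw [covCond_eq]
    refine IsHermitian.sub ?_ (isHermitian_conjTranspose_mul_mul _ (G.posDef_covObs hG I).1.inv)
    exact hG.posDef_cov.1.submatrix _
  · obtain ⟨x, hx⟩ := G.exists_dotProduct_covCond_eq hG I y
    rw [star_trivial, hx]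
    have h0 : join I x y ≠ 0 := by
      intro h
      refine hy (funext fun p => ?_)
      have := congrFun h (p.1.1, p.2)
      simpa using this
    simpa using hG.posDef_cov.dotProduct_mulVec_pos h0

end GPModel

/-! ### Two-sided bounds on the covariance from the condition numbers -/

namespace GPModel

variable {H d dₑ : ℕ} {G : GPModel H d dₑ} {r lo hi : ℝ}

theorem condNum_covObs_le_kapObs (I : Pattern H) : condNum (G.covObs I) ≤ G.kapObs :=
  le_ciSup (Set.finite_range fun I : Pattern H => condNum (G.covObs I)).bddAbove I

theorem condNum_covCond_le_kapCond (I : Pattern H) : condNum (G.covCond I) ≤ G.kapCond :=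
  le_ciSup (Set.finite_range fun I : Pattern H => condNum (G.covCond I)).bddAbove I

theorem nonempty_obsIdx (hd : 1 ≤ d) (I : Pattern H) : Nonempty (ObsIdx d I) := by
  obtain ⟨i, hi⟩ := I.2.1
  exact ⟨(⟨i, hi⟩, ⟨0, hd⟩)⟩

theorem nonempty_missIdx (hd : 1 ≤ d) (I : Pattern H) : Nonempty (MissIdx d I) := by
  obtain ⟨i, hi⟩ : ∃ i, i ∉ I.1 := by
    by_contra! h
    exact I.2.2 (Finset.eq_univ_iff_forall.2 h)
  exact ⟨(⟨i, hi⟩, ⟨0, hd⟩)⟩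

/-- The pattern in which a single frame is observed. -/
def singlePattern (hH : 2 ≤ H) (i : Fin H) : Pattern H :=
  ⟨{i}, by simp, fun h => by
    have := congrArg Finset.card h
    simp at this
    omega⟩

/-- The pattern in which at most two frames are observed. -/
def pairPattern (hH : 3 ≤ H) (i j : Fin H) : Pattern H :=
  ⟨{i, j}, by simp, fun h => by
    have := congrArg Finset.card h
    have h2 := Finset.card_le_two (a := i) (b := j)
    simp at this
    omega⟩

theorem one_le_kapObs (hG : G.KernelAssumption r) (hH : 2 ≤ H) (hd : 1 ≤ d) : 1 ≤ G.kapObs := by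
  let I := singlePattern hH ⟨0, by omega⟩
  have := nonempty_obsIdx hd I
  exact (one_le_condNum (G.posDef_covObs hG I)).trans (condNum_covObs_le_kapObs I)

theorem one_le_kapCond (hG : G.KernelAssumption r) (hH : 2 ≤ H) (hd : 1 ≤ d) : 1 ≤ G.kapCond := by
  let I := singlePattern hH ⟨0, by omega⟩
  have := nonempty_missIdx hd I
  exact (one_le_condNum (G.posDef_covCond hG I)).trans (condNum_covCond_le_kapCond I)

theorem eq_join_zero {I : Pattern H} {x : Fin H × Fin d → ℝ} (hx : ∀ p, p.1 ∉ I.1 → x p = 0) :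
    x = join I (fun p => x (p.1.1, p.2)) 0 := by
  ext p
  by_cases h : p.1 ∈ I.1
  · simp [join, h]
  · simp [join, h, hx p h]

/-- Quadratic forms of vectors supported on observed frames are comparable up to `κ_max`. -/
theorem dotProduct_cov_mul_le (hG : G.KernelAssumption r) (hd : 1 ≤ d) (I : Pattern H)
    {x y : Fin H × Fin d → ℝ} (hx : ∀ p, p.1 ∉ I.1 → x p = 0) (hy : ∀ p, p.1 ∉ I.1 → y p = 0) :
    (x ⬝ᵥ G.cov *ᵥ x) * (y ⬝ᵥ y) ≤ G.kapObs * (y ⬝ᵥ G.cov *ᵥ y) * (x ⬝ᵥ x) := by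
  have := nonempty_obsIdx hd I
  rw [eq_join_zero hx, eq_join_zero hy, dotProduct_covObs, dotProduct_covObs, join_dotProduct,
    join_dotProduct]
  simp only [zero_dotProduct, add_zero]
  set a : ObsIdx d I → ℝ := fun p => x (p.1.1, p.2)
  set b : ObsIdx d I → ℝ := fun p => y (p.1.1, p.2)
  have hp := G.posDef_covObs hG I
  have h1 := lamMax_div_le_lamMin hp (condNum_covObs_le_kapObs I)
  have hk : 0 < G.kapObs :=
    zero_lt_one.trans_le ((one_le_condNum hp).trans (condNum_covObs_le_kapObs I))
  rw [div_le_iff₀ hk] at h1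
  have ha := dotProduct_self_nonneg_real a
  have hb := dotProduct_self_nonneg_real b
  calc _ ≤ lamMax (G.covObs I) * (a ⬝ᵥ a) * (b ⬝ᵥ b) :=
        mul_le_mul_of_nonneg_right (dotProduct_mulVec_le_lamMax hp.1 a) hb
    _ = lamMax (G.covObs I) * ((a ⬝ᵥ a) * (b ⬝ᵥ b)) := by ring
    _ ≤ lamMin (G.covObs I) * G.kapObs * ((a ⬝ᵥ a) * (b ⬝ᵥ b)) :=
        mul_le_mul_of_nonneg_right h1 (mul_nonneg ha hb)
    _ = G.kapObs * (lamMin (G.covObs I) * (b ⬝ᵥ b)) * (a ⬝ᵥ a) := by ring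
    _ ≤ _ := mul_le_mul_of_nonneg_right (mul_le_mul_of_nonneg_left
        (lamMin_mul_le_dotProduct_mulVec hp.1 b) hk.le) ha

/-- When only frame `i` is observed, `gamObs` is the `1 × 1` matrix with entry `Γ i i`, so its only
eigenvalue is that entry. -/
theorem lo_le_Γ_diag (hG : G.KernelAssumption r) (hH : 2 ≤ H)
    (h : ∀ I : Pattern H, lo ≤ lamMax (G.gamObs I)) (i : Fin H) : lo ≤ G.Γ i i := by
  have hI := h (singlePattern hH i)
  set I := singlePattern hH i
  have hmem : ∀ j : {j // j ∈ I.1}, j.1 = i := fun j => Finset.mem_singleton.1 j.2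
  have : Nonempty {j // j ∈ I.1} := ⟨⟨i, Finset.mem_singleton_self i⟩⟩
  have : Subsingleton {j // j ∈ I.1} := ⟨fun a b => Subtype.ext ((hmem a).trans (hmem b).symm)⟩
  obtain ⟨x, hx, he⟩ := exists_eigenvector_lamMax (A := G.gamObs I)
    (hG.posDef_Γ.1.submatrix _)
  have j₀ : {j // j ∈ I.1} := ⟨i, Finset.mem_singleton_self i⟩
  have h1 : G.Γ i i * x j₀ = lamMax (G.gamObs I) * x j₀ := by
    have := congrFun he j₀
    rw [mulVec, dotProduct, Fintype.sum_subsingleton _ j₀] at this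
    simpa [gamObs, hmem] using this
  have h2 : x j₀ ≠ 0 := by
    intro h0
    rw [dotProduct, Fintype.sum_subsingleton _ j₀, h0] at hx
    simp at hx
  exact hI.trans (mul_right_cancel₀ h2 h1).ge

/-- The vector `w` is a top eigenvector of `Λ`, placed on a single frame. It certifies a large
eigenvalue of every covariance block that contains this frame. -/
theorem single_test (hG : G.KernelAssumption r) (hH : 2 ≤ H) (hlo : 0 < lo)
    (h : ∀ I : Pattern H, lo ≤ lamMax (G.gamObs I)) (hd : 1 ≤ d) (hΛ : lo ≤ lamMax G.Λ) :
    ∃ w : Fin d → ℝ, 0 < w ⬝ᵥ w ∧ ∀ i : Fin H,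
      lo ^ 2 * (w ⬝ᵥ w) ≤ (fun p : Fin H × Fin d => if p.1 = i then w p.2 else 0) ⬝ᵥ
        G.cov *ᵥ (fun p => if p.1 = i then w p.2 else 0) := by
  have : Nonempty (Fin d) := ⟨⟨0, hd⟩⟩
  obtain ⟨w, hw, he⟩ := exists_eigenvector_lamMax hG.posDef_Λ.1
  refine ⟨w, hw, fun i => ?_⟩
  rw [cov, single_tensor_dotProduct_kronecker, he, dotProduct_smul, smul_eq_mul, ← mul_assoc, sq]
  have := lo_le_Γ_diag hG hH h i
  have := hlo.le.trans this
  gcongr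

/-- The test vector on an observed frame forces the top eigenvalue of `covObs` to be at least `lo²`,
and the condition number carries this to the bottom eigenvalue. -/
theorem le_dotProduct_cov_of_support (hG : G.KernelAssumption r) (hH : 2 ≤ H) (hlo : 0 < lo)
    (h : ∀ I : Pattern H, lo ≤ lamMax (G.gamObs I)) (hd : 1 ≤ d) (hΛ : lo ≤ lamMax G.Λ)
    (I : Pattern H) {x : Fin H × Fin d → ℝ} (hx : ∀ p, p.1 ∉ I.1 → x p = 0) :
    lo ^ 2 / G.kapObs * (x ⬝ᵥ x) ≤ x ⬝ᵥ G.cov *ᵥ x := by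
  obtain ⟨w, hw, ht⟩ := single_test hG hH hlo h hd hΛ
  obtain ⟨i, hi⟩ := I.2.1
  have hk := one_le_kapObs hG hH hd
  have h1 := dotProduct_cov_mul_le hG hd I
    (x := fun p : Fin H × Fin d => if p.1 = i then w p.2 else 0) (y := x)
    (fun p hp => if_neg fun h : p.1 = i => hp (h ▸ hi)) hx
  rw [single_tensor_dotProduct_self] at h1
  have h2 := mul_le_mul_of_nonneg_right (ht i) (dotProduct_self_nonneg_real x)
  have h3 : lo ^ 2 * (x ⬝ᵥ x) * (w ⬝ᵥ w) ≤ G.kapObs * (x ⬝ᵥ G.cov *ᵥ x) * (w ⬝ᵥ w) := by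
    linarith
  have h4 := le_of_mul_le_mul_right h3 hw
  rw [div_mul_eq_mul_div, div_le_iff₀ (by linarith)]
  linarith

/-- Put the test vector on a second frame `j` and extend it optimally to frame `i`. The extension
lives on `{i, j}`, which for `H ≥ 3` is an admissible observed set, so `κ_obs` bounds its energy
from below. -/
theorem le_covCond_single (hG : G.KernelAssumption r) (hH : 3 ≤ H) (hlo : 0 < lo)
    (h : ∀ I : Pattern H, lo ≤ lamMax (G.gamObs I)) (hd : 1 ≤ d) (hΛ : lo ≤ lamMax G.Λ)
    (i : Fin H) : lo ^ 2 / G.kapObs ≤ lamMax (G.covCond (singlePattern (by omega) i)) := by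
  set I := singlePattern (by omega) i
  obtain ⟨w, hw, ht⟩ := single_test hG (by omega) hlo h hd hΛ
  have : Nontrivial (Fin H) := Fin.nontrivial_iff_two_le.2 (by omega)
  obtain ⟨j, hj⟩ := exists_ne i
  have hjI : j ∉ I.1 := by simpa [I, singlePattern] using hj
  set y : MissIdx d I → ℝ := fun p => if p.1.1 = j then w p.2 else 0
  obtain ⟨x, hx⟩ := G.exists_dotProduct_covCond_eq hG I y
  have hsupp : ∀ p, p.1 ∉ (pairPattern hH i j).1 → join I x y p = 0 := by
    intro p hp
    simp only [pairPattern, Finset.mem_insert, Finset.mem_singleton, not_or] at hp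
    have : p.1 ∉ I.1 := by simpa [I, singlePattern] using hp.1
    simp [join, this, y, hp.2]
  have h1 := le_dotProduct_cov_of_support hG (by omega) hlo h hd hΛ (pairPattern hH i j) hsupp
  have hyy : y ⬝ᵥ y = w ⬝ᵥ w := by
    rw [← single_tensor_dotProduct_self j w]
    have : (fun p : Fin H × Fin d => if p.1 = j then w p.2 else 0) = join I 0 y := by
      ext p
      by_cases hp : p.1 ∈ I.1
      · have : p.1 ≠ j := fun h => hjI (h ▸ hp)
        simp [join, hp, this]
      · simp [join, hp, y]
    rw [this, join_dotProduct]
    simp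
  refine le_lamMax (G.posDef_covCond hG I).1 (x := y) (by rw [hyy]; exact hw) ?_
  rw [hx]
  refine le_trans ?_ h1
  have hk := one_le_kapObs hG (by omega) hd
  refine mul_le_mul_of_nonneg_left ?_ (by positivity)
  rw [join_dotProduct]
  linarith [dotProduct_self_nonneg_real x]

/-- Lower bound of the covariance by the condition numbers. -/
theorem le_dotProduct_cov (hG : G.KernelAssumption r) (hH : 2 ≤ H) (hlo : 0 < lo)
    (h : ∀ I : Pattern H, lo ≤ lamMax (G.gamObs I)) (hd : 1 ≤ d) (hΛ : lo ≤ lamMax G.Λ)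
    (h2 : H = 2 → lo ≤ lamMin G.Γ) (x : Fin H × Fin d → ℝ) :
    lo ^ 2 / (2 * G.kapObs * G.kapCond) * (x ⬝ᵥ x) ≤ x ⬝ᵥ G.cov *ᵥ x := by
  have hko := one_le_kapObs hG hH hd
  have hkc := one_le_kapCond hG hH hd
  have hxx := dotProduct_self_nonneg_real x
  obtain rfl | hH3 := hH.eq_or_lt
  · have : Nonempty (Fin d) := ⟨⟨0, hd⟩⟩
    -- For two frames each block has a single time index, so the condition numbers see only `Λ`.
    -- They bound its smallest eigenvalue, and `Γ` is handled by the separate assumption on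
    -- `lamMin`.
    have hl : lo / G.kapObs ≤ lamMin G.Λ := by
      obtain ⟨u, hu, hue⟩ := exists_eigenvector_lamMax hG.posDef_Λ.1
      obtain ⟨v, hv, hve⟩ := exists_eigenvector_lamMin hG.posDef_Λ.1
      have h1 := dotProduct_cov_mul_le hG hd (singlePattern le_rfl 0)
        (x := fun p : Fin 2 × Fin d => if p.1 = 0 then u p.2 else 0)
        (y := fun p : Fin 2 × Fin d => if p.1 = 0 then v p.2 else 0)
        (fun p hp => if_neg (by simpa [singlePattern] using hp))
        (fun p hp => if_neg (by simpa [singlePattern] using hp))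
      rw [single_tensor_dotProduct_self, single_tensor_dotProduct_self, cov,
        single_tensor_dotProduct_kronecker, single_tensor_dotProduct_kronecker, hue, hve,
        dotProduct_smul, dotProduct_smul, smul_eq_mul, smul_eq_mul] at h1
      have hΓ := hlo.trans_le (lo_le_Γ_diag hG le_rfl h 0)
      have h3 : lamMax G.Λ * (G.Γ 0 0 * ((u ⬝ᵥ u) * (v ⬝ᵥ v))) ≤
          G.kapObs * lamMin G.Λ * (G.Γ 0 0 * ((u ⬝ᵥ u) * (v ⬝ᵥ v))) := by linarith
      have h4 := le_of_mul_le_mul_right h3 (by positivity)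
      rw [div_le_iff₀ (by linarith)]
      linarith
    have h5 := le_dotProduct_kronecker hG.posDef_Γ.1 hG.posDef_Λ.posSemidef hlo.le
      (fun y => (mul_le_mul_of_nonneg_right (h2 rfl) (dotProduct_self_nonneg_real y)).trans
        (lamMin_mul_le_dotProduct_mulVec hG.posDef_Γ.1 y))
      (fun y => (mul_le_mul_of_nonneg_right hl (dotProduct_self_nonneg_real y)).trans
        (lamMin_mul_le_dotProduct_mulVec hG.posDef_Λ.1 y)) x
    refine le_trans (mul_le_mul_of_nonneg_right ?_ hxx) h5
    rw [← mul_div_assoc, ← sq]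
    refine div_le_div_of_nonneg_left (by positivity) (by positivity) ?_
    nlinarith
  -- Observing frame `i` alone, the energy dominates the form of `covCond`, hence the squared mass
  -- of all frames other than `i`.
  · have key : ∀ i : Fin H, lo ^ 2 / (G.kapObs * G.kapCond) *
        (x ⬝ᵥ x - ∑ k, x (i, k) ^ 2) ≤ x ⬝ᵥ G.cov *ᵥ x := by
      intro i
      set I := singlePattern (by omega) i with hI
      have := nonempty_missIdx hd I
      have hp := G.posDef_covCond hG I
      set y : MissIdx d I → ℝ := fun p => x (p.1.1, p.2) with hy
      have e1 : x ⬝ᵥ x - ∑ k, x (i, k) ^ 2 = y ⬝ᵥ y := by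
        have a1 : x ⬝ᵥ x = ∑ p, x p ^ 2 := Finset.sum_congr rfl fun p _ => (sq _).symm
        have a2 : y ⬝ᵥ y = ∑ p : MissIdx d I, x (p.1.1, p.2) ^ 2 :=
          Finset.sum_congr rfl fun p _ => (sq _).symm
        rw [a1, a2, sum_split I, add_sub_assoc, add_comm, sub_add_eq_add_sub, add_sub_assoc,
          add_eq_left, sub_eq_zero, Fintype.sum_prod_type]
        have hmem : ∀ j : {j // j ∈ I.1}, j.1 = i := fun j => Finset.mem_singleton.1 j.2
        have : Subsingleton {j // j ∈ I.1} :=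
          ⟨fun a b => Subtype.ext ((hmem a).trans (hmem b).symm)⟩
        rw [Fintype.sum_subsingleton _ ⟨i, Finset.mem_singleton_self i⟩]
      have h1 := lamMax_div_le_lamMin hp (condNum_covCond_le_kapCond I)
      have h3 := le_covCond_single hG hH3 hlo h hd hΛ i
      have h4 : lo ^ 2 / (G.kapObs * G.kapCond) ≤ lamMin (G.covCond I) := by
        rw [← div_div]
        exact (div_le_div_of_nonneg_right h3 (by linarith)).trans h1
      rw [e1]
      refine (mul_le_mul_of_nonneg_right h4 (dotProduct_self_nonneg_real y)).trans
        ((lamMin_mul_le_dotProduct_mulVec hp.1 y).trans ?_)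
      have := dotProduct_covCond_le G hG I (fun p => x (p.1.1, p.2)) y
      rwa [← exists_eq_join] at this
    have k0 := key ⟨0, by omega⟩
    have k1 := key ⟨1, by omega⟩
    -- The masses of two different frames together do not exceed the total, so averaging the two
    -- bounds loses only a factor `2`.
    have hsum : ∑ k, x (⟨0, by omega⟩, k) ^ 2 + ∑ k, x (⟨1, by omega⟩, k) ^ 2 ≤ x ⬝ᵥ x := by
      have a1 : x ⬝ᵥ x = ∑ i, ∑ k, x (i, k) ^ 2 := by
        rw [← Fintype.sum_prod_type']; exact Finset.sum_congr rfl fun p _ => (sq _).symm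
      rw [a1]
      exact Finset.add_le_sum (f := fun i => ∑ k, x (i, k) ^ 2)
        (fun i _ => Finset.sum_nonneg fun k _ => sq_nonneg _)
        (Finset.mem_univ _) (Finset.mem_univ _) (by simp)
    have hc : 0 ≤ lo ^ 2 / (G.kapObs * G.kapCond) := by positivity
    have h6 := mul_le_mul_of_nonneg_left hsum hc
    have e : lo ^ 2 / (2 * G.kapObs * G.kapCond) = lo ^ 2 / (G.kapObs * G.kapCond) / 2 := by
      rw [div_div]; ring_nf
    rw [e]
    linarith

/-- The hypotheses bound only proper principal blocks. Splitting `x = a + b` along one pattern and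
using that the form is nonnegative at `a - b` bounds the whole form by twice the sum of the block
forms. -/
theorem dotProduct_Γ_le (hG : G.KernelAssumption r) (hH : 2 ≤ H)
    (h1 : ∀ I : Pattern H, lamMax (G.gamObs I) ≤ hi)
    (h2 : ∀ I : Pattern H, lamMax (G.gamMiss I) ≤ hi) (x : Fin H → ℝ) :
    x ⬝ᵥ G.Γ *ᵥ x ≤ 2 * hi * (x ⬝ᵥ x) := by
  set I := singlePattern hH ⟨0, by omega⟩
  set a : Fin H → ℝ := fun i => if i ∈ I.1 then x i else 0
  set b : Fin H → ℝ := fun i => if i ∈ I.1 then 0 else x i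
  have hab : x = a + b := by ext i; simp only [a, b, Pi.add_apply]; split <;> simp
  have ha : a ⬝ᵥ G.Γ *ᵥ a ≤ hi * (a ⬝ᵥ a) := by
    have := (dotProduct_mulVec_le_lamMax (A := G.gamObs I) (hG.posDef_Γ.1.submatrix _)
      (fun i => x i)).trans (mul_le_mul_of_nonneg_right (h1 I) (dotProduct_self_nonneg_real _))
    have e : ∀ f : Fin H → ℝ, ∑ i : {i // i ∈ I.1}, f i = ∑ i, if i ∈ I.1 then f i else 0 := by
      intro f
      rw [← Finset.sum_subtype (Finset.univ.filter fun i => i ∈ I.1) (by simp) f,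
        Finset.sum_filter]
    simp only [dotProduct, mulVec, gamObs, submatrix_apply] at this
    rw [e (fun i => x i * ∑ j : {j // j ∈ I.1}, G.Γ i j * x j), e (fun i => x i * x i)] at this
    have e2 := fun i => e (fun j => G.Γ i j * x j)
    simp only [e2] at this
    simpa [a, dotProduct, mulVec] using this
  have hb : b ⬝ᵥ G.Γ *ᵥ b ≤ hi * (b ⬝ᵥ b) := by
    have := (dotProduct_mulVec_le_lamMax (A := G.gamMiss I) (hG.posDef_Γ.1.submatrix _)
      (fun i => x i)).trans (mul_le_mul_of_nonneg_right (h2 I) (dotProduct_self_nonneg_real _))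
    have e : ∀ f : Fin H → ℝ, ∑ i : {i // i ∉ I.1}, f i = ∑ i, if i ∈ I.1 then 0 else f i := by
      intro f
      rw [← Finset.sum_subtype (Finset.univ.filter fun i => i ∉ I.1) (by simp) f,
        Finset.sum_filter]
      exact Finset.sum_congr rfl fun i _ => by split <;> simp_all
    simp only [dotProduct, mulVec, gamMiss, submatrix_apply] at this
    rw [e (fun i => x i * ∑ j : {j // j ∉ I.1}, G.Γ i j * x j), e (fun i => x i * x i)] at this
    have e2 := fun i => e (fun j => G.Γ i j * x j)
    simp only [e2] at this
    have e3 : b ⬝ᵥ b = ∑ i, if i ∈ I.1 then 0 else x i * x i :=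
      Finset.sum_congr rfl fun i _ => by simp only [b]; split <;> simp
    rw [e3]
    simpa [b, dotProduct, mulVec] using this
  have hperp : a ⬝ᵥ b = 0 :=
    Finset.sum_eq_zero fun i _ => by simp only [a, b]; split <;> simp
  have hsub := hG.posDef_Γ.posSemidef.dotProduct_mulVec_nonneg (a - b)
  have hx : x ⬝ᵥ x = a ⬝ᵥ a + b ⬝ᵥ b := by
    rw [hab, dotProduct_add, add_dotProduct, add_dotProduct, dotProduct_comm b a, hperp]; ring
  have hx2 : x ⬝ᵥ G.Γ *ᵥ x + (a - b) ⬝ᵥ G.Γ *ᵥ (a - b)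
      = 2 * (a ⬝ᵥ G.Γ *ᵥ a) + 2 * (b ⬝ᵥ G.Γ *ᵥ b) := by
    rw [hab]
    simp only [mulVec_add, mulVec_sub, dotProduct_add, dotProduct_sub, add_dotProduct,
      sub_dotProduct]
    ring
  rw [star_trivial] at hsub
  rw [hx]
  linarith

theorem dotProduct_cov_le (hG : G.KernelAssumption r) (hH : 2 ≤ H) (hhi : 0 ≤ hi)
    (h1 : ∀ I : Pattern H, lamMax (G.gamObs I) ≤ hi)
    (h2 : ∀ I : Pattern H, lamMax (G.gamMiss I) ≤ hi) (hΛ : lamMax G.Λ ≤ hi)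
    (x : Fin H × Fin d → ℝ) : x ⬝ᵥ G.cov *ᵥ x ≤ 2 * hi ^ 2 * (x ⬝ᵥ x) := by
  have := dotProduct_kronecker_le hG.posDef_Γ.1 hG.posDef_Λ.posSemidef (by positivity)
    (dotProduct_Γ_le hG hH h1 h2)
    (fun y => (dotProduct_mulVec_le_lamMax hG.posDef_Λ.1 y).trans
      (mul_le_mul_of_nonneg_right hΛ (dotProduct_self_nonneg_real y))) x
  rw [cov]
  linarith

end GPModel

/-! ### The diffused Gaussian and its score -/

theorem norm_sq_eq_dotProduct {ι : Type*} [Fintype ι] (x : EuclideanSpace ℝ ι) :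
    ‖x‖ ^ 2 = x.ofLp ⬝ᵥ x.ofLp := by
  rw [EuclideanSpace.real_norm_sq_eq]
  exact Finset.sum_congr rfl fun _ _ => sq _

theorem dotProduct_mulVec_add_self {ι : Type*} [Fintype ι] {A : Matrix ι ι ℝ}
    (hA : A.IsHermitian) (x y : ι → ℝ) :
    (x + y) ⬝ᵥ A *ᵥ (x + y) = x ⬝ᵥ A *ᵥ x + 2 * (y ⬝ᵥ A *ᵥ x) + y ⬝ᵥ A *ᵥ y := by
  rw [mulVec_add, add_dotProduct, dotProduct_add, dotProduct_add, dotProduct_mulVec_comm hA x y]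
  ring

theorem integrable_exp_of_le_neg_mul_sq {ι : Type*} [Fintype ι] {f : EuclideanSpace ℝ ι → ℝ}
    (hf : Continuous f) {b : ℝ} (hb : 0 < b) (m : EuclideanSpace ℝ ι)
    (h : ∀ z, f z ≤ -b * ‖z - m‖ ^ 2) : MeasureTheory.Integrable fun z => Real.exp (f z) := by
  have h1 : MeasureTheory.Integrable fun z : EuclideanSpace ℝ ι => Real.exp (-b * ‖z‖ ^ 2) := by
    have := (GaussianFourier.integrable_cexp_neg_mul_sq_norm_add (V := EuclideanSpace ℝ ι)
      (b := (b : ℂ)) (by simpa using hb) 0 0).norm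
    refine this.congr (Filter.Eventually.of_forall fun v => ?_)
    simp [Complex.norm_exp, ← Complex.ofReal_pow]
  refine (h1.comp_sub_right m).mono' (Real.continuous_exp.comp hf).aestronglyMeasurable
    (Filter.Eventually.of_forall fun z => ?_)
  rw [Real.norm_eq_abs, Real.abs_exp]
  exact Real.exp_le_exp.2 (h z)

theorem sigm_sq {t : ℝ} (ht : 0 ≤ t) : sigm t ^ 2 = 1 - Real.exp (-t) :=
  Real.sq_sqrt (by simpa using ht)

theorem sigm_pos {t : ℝ} (ht : 0 < t) : 0 < sigm t := Real.sqrt_pos.2 (by simpa using ht)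

theorem sigm_le_one (t : ℝ) : sigm t ≤ 1 := by
  rw [sigm, Real.sqrt_le_one]
  linarith [Real.exp_pos (-t)]

theorem sigm_mono {s t : ℝ} (h : s ≤ t) : sigm s ≤ sigm t :=
  Real.sqrt_le_sqrt (by linarith [Real.exp_le_exp.2 (neg_le_neg h)])

theorem alph_pos (t : ℝ) : 0 < alph t := Real.exp_pos _

theorem alph_le_one {t : ℝ} (ht : 0 ≤ t) : alph t ≤ 1 := Real.exp_le_one_iff.2 (by linarith)

theorem alph_sq_add_sigm_sq {t : ℝ} (ht : 0 ≤ t) : alph t ^ 2 + sigm t ^ 2 = 1 := by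
  rw [sigm_sq ht, alph, ← Real.exp_nat_mul]
  have : ((2 : ℕ) : ℝ) * (-t / 2) = -t := by push_cast; ring
  rw [this]
  ring

namespace GPModel

variable {H d dₑ : ℕ}

/-- The factor by which the forward process scales a frame. -/
def scaling (I : Pattern H) (t : ℝ) (i : Fin H) : ℝ := if i ∈ I.1 then 1 else alph t

/-- The variance of the noise that the forward process adds to a frame. -/
def noiseVar (I : Pattern H) (t : ℝ) (i : Fin H) : ℝ := if i ∈ I.1 then 0 else sigm t ^ 2

/-- Joint covariance of the observed frames and the diffused missing frames. -/
def diffCov (G : GPModel H d dₑ) (I : Pattern H) (t : ℝ) :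
    Matrix (Fin H × Fin d) (Fin H × Fin d) ℝ :=
  diagonal (fun p => scaling I t p.1) * G.cov * diagonal (fun p => scaling I t p.1) +
    diagonal (fun p => noiseVar I t p.1)

variable {G : GPModel H d dₑ} {r : ℝ} {I : Pattern H} {t : ℝ}

theorem diffCov_mulVec (z : Fin H × Fin d → ℝ) :
    G.diffCov I t *ᵥ z = fun p => scaling I t p.1 *
      (G.cov *ᵥ fun q => scaling I t q.1 * z q) p + noiseVar I t p.1 * z p := by
  ext p
  rw [diffCov, add_mulVec, ← mulVec_mulVec, ← mulVec_mulVec, Pi.add_apply, mulVec_diagonal,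
    mulVec_diagonal]
  congr 3
  ext q
  rw [mulVec_diagonal]

theorem scaling_mul_join (x : ObsIdx d I → ℝ) (y : MissIdx d I → ℝ) :
    (fun q : Fin H × Fin d => scaling I t q.1 * join I x y q) = join I x (alph t • y) := by
  ext q
  by_cases h : q.1 ∈ I.1 <;> simp [scaling, join, h]

theorem diffCov_dotProduct_join (x : ObsIdx d I → ℝ) (y : MissIdx d I → ℝ) :
    join I x y ⬝ᵥ G.diffCov I t *ᵥ join I x y =
      join I x (alph t • y) ⬝ᵥ G.cov *ᵥ join I x (alph t • y) + sigm t ^ 2 * (y ⬝ᵥ y) := by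
  rw [diffCov_mulVec, scaling_mul_join, ← scaling_mul_join]
  rw [show (sigm t ^ 2 * (y ⬝ᵥ y)) =
    join I x y ⬝ᵥ fun p => noiseVar I t p.1 * join I x y p by
      simp [dotProduct, sum_split I, noiseVar, Finset.mul_sum]
      refine Finset.sum_congr rfl fun p _ => ?_
      simp [p.1.2]; ring]
  simp only [dotProduct, ← Finset.sum_add_distrib]
  exact Finset.sum_congr rfl fun _ _ => by ring

theorem isHermitian_diffCov (hG : G.KernelAssumption r) : (G.diffCov I t).IsHermitian := by
  refine IsHermitian.add ?_ (isHermitian_diagonal _)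
  have := isHermitian_conjTranspose_mul_mul (diagonal fun p : Fin H × Fin d => scaling I t p.1)
    hG.posDef_cov.1
  rwa [diagonal_conjTranspose, star_trivial] at this

/-- On the missing frames the bound becomes `α_t² l + σ_t²`, a convex combination of `l` and `1`;
this is where `l ≤ 1` is needed. -/
theorem le_dotProduct_diffCov (ht : 0 ≤ t) {l : ℝ}
    (h : ∀ x, l * (x ⬝ᵥ x) ≤ x ⬝ᵥ G.cov *ᵥ x) (hl : l ≤ 1) (z : Fin H × Fin d → ℝ) :
    l * (z ⬝ᵥ z) ≤ z ⬝ᵥ G.diffCov I t *ᵥ z := by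
  rw [exists_eq_join I z, diffCov_dotProduct_join]
  generalize (fun p : ObsIdx d I => z (p.1.1, p.2)) = x
  generalize (fun p : MissIdx d I => z (p.1.1, p.2)) = y
  refine le_trans ?_ (add_le_add_left (h _) _)
  rw [join_dotProduct, join_dotProduct, smul_dotProduct, dotProduct_smul, smul_eq_mul, smul_eq_mul,
    ← mul_assoc, ← sq]
  have h1 := alph_sq_add_sigm_sq ht
  have h2 : alph t ^ 2 = 1 - sigm t ^ 2 := by linarith
  rw [h2]
  nlinarith [mul_nonneg (mul_nonneg (sub_nonneg.2 hl) (sq_nonneg (sigm t)))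
    (dotProduct_self_nonneg_real y)]

theorem dotProduct_diffCov_le (ht : 0 ≤ t) {u : ℝ} (hu : 0 ≤ u)
    (h : ∀ x, x ⬝ᵥ G.cov *ᵥ x ≤ u * (x ⬝ᵥ x)) (z : Fin H × Fin d → ℝ) :
    z ⬝ᵥ G.diffCov I t *ᵥ z ≤ (u + 1) * (z ⬝ᵥ z) := by
  rw [exists_eq_join I z, diffCov_dotProduct_join]
  generalize (fun p : ObsIdx d I => z (p.1.1, p.2)) = x
  generalize (fun p : MissIdx d I => z (p.1.1, p.2)) = y
  refine (add_le_add_left (h _) _).trans ?_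
  rw [join_dotProduct, join_dotProduct, smul_dotProduct, dotProduct_smul, smul_eq_mul, smul_eq_mul,
    ← mul_assoc, ← sq]
  have h1 := alph_sq_add_sigm_sq ht
  have h2 : alph t ^ 2 = 1 - sigm t ^ 2 := by linarith
  rw [h2]
  have hx := dotProduct_self_nonneg_real x
  have hy := dotProduct_self_nonneg_real y
  have := sq_nonneg (sigm t)
  have h3 : sigm t ^ 2 ≤ 1 := by nlinarith [sq_nonneg (alph t)]
  nlinarith [mul_nonneg (mul_nonneg hu this) hy, mul_nonneg (sub_nonneg.2 h3) hy]

theorem posDef_diffCov (hG : G.KernelAssumption r) (ht : 0 < t) : (G.diffCov I t).PosDef := by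
  refine Matrix.PosDef.of_dotProduct_mulVec_pos (isHermitian_diffCov hG) fun z hz => ?_
  rw [star_trivial]
  rw [exists_eq_join I z, diffCov_dotProduct_join]
  rw [exists_eq_join I z] at hz
  generalize (fun p : ObsIdx d I => z (p.1.1, p.2)) = x at hz ⊢
  generalize (fun p : MissIdx d I => z (p.1.1, p.2)) = y at hz ⊢
  have hs := sigm_pos ht
  have hne : join I x (alph t • y) ≠ 0 := by
    rw [← scaling_mul_join]
    intro h
    refine hz (funext fun p => ?_)
    have h1 := congrFun h p
    have h2 : scaling I t p.1 ≠ 0 := by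
      rw [scaling]; split
      · exact one_ne_zero
      · exact (alph_pos t).ne'
    simpa [h2] using h1
  have h1 := hG.posDef_cov.dotProduct_mulVec_pos hne
  rw [star_trivial] at h1
  have := mul_nonneg (sq_nonneg (sigm t)) (dotProduct_self_nonneg_real y)
  linarith

/-- The vector `e` is the missing part of `cov (x, α_t y)`, the minimizer of the joint exponent.
There `cov⁻¹ (a, e) = (x, α_t y)` and `b - α_t e = σ_t² y`, so the terms linear in `δ` cancel. The
minimum is `w·M⁻¹w`, and the remainder in `δ` does not involve `b`. -/
theorem cov_inv_dotProduct_complete_square (hG : G.KernelAssumption r) (ht : 0 < t)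
    {a : ObsIdx d I → ℝ} {b : MissIdx d I → ℝ} {x : ObsIdx d I → ℝ} {y : MissIdx d I → ℝ}
    (hz : G.diffCov I t *ᵥ join I x y = join I a b) :
    ∃ e : MissIdx d I → ℝ, ∀ δ : MissIdx d I → ℝ,
      join I a (e + δ) ⬝ᵥ G.cov⁻¹ *ᵥ join I a (e + δ) +
        (sigm t ^ 2)⁻¹ * ((b - alph t • (e + δ)) ⬝ᵥ (b - alph t • (e + δ))) =
      join I a b ⬝ᵥ join I x y + (join I 0 δ ⬝ᵥ G.cov⁻¹ *ᵥ join I 0 δ +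
        (sigm t ^ 2)⁻¹ * (alph t ^ 2 * (δ ⬝ᵥ δ))) := by
  have hs := (sigm_pos ht).ne'
  set e : MissIdx d I → ℝ := fun p => (G.cov *ᵥ join I x (alph t • y)) (p.1.1, p.2) with he
  rw [diffCov_mulVec, scaling_mul_join] at hz
  have h1 : G.cov *ᵥ join I x (alph t • y) = join I a e := by
    rw [exists_eq_join I (G.cov *ᵥ join I x (alph t • y))]
    congr 1
    ext p
    have := congrFun hz (p.1.1, p.2)
    simpa [scaling, noiseVar, p.1.2] using this
  have h2 : b = alph t • e + sigm t ^ 2 • y := by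
    ext p
    have := congrFun hz (p.1.1, p.2)
    rw [h1] at this
    simp only [join_miss] at this
    simpa [scaling, noiseVar, p.1.2] using this.symm
  have h3 : G.cov⁻¹ *ᵥ join I a e = join I x (alph t • y) := by
    rw [← h1, mulVec_mulVec, nonsing_inv_mul _ ((isUnit_iff_isUnit_det _).1 hG.posDef_cov.isUnit),
      one_mulVec]
  refine ⟨e, fun δ => ?_⟩
  have h4 : join I a (e + δ) = join I a e + join I 0 δ := by
    ext p; by_cases h : p.1 ∈ I.1 <;> simp [join, h]
  have h5 : b - alph t • (e + δ) = sigm t ^ 2 • y - alph t • δ := by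
    rw [h2, smul_add]; abel
  rw [h4, dotProduct_mulVec_add_self hG.posDef_cov.1.inv, h3, h5, join_dotProduct, join_dotProduct,
    join_dotProduct, h2]
  simp only [sub_dotProduct, dotProduct_sub, add_dotProduct, smul_dotProduct, dotProduct_smul,
    smul_eq_mul, zero_dotProduct, dotProduct_comm δ y]
  field_simp
  ring

theorem glue_sub_mean (x : EuclideanSpace ℝ (ObsIdx d I)) (y : EuclideanSpace ℝ (MissIdx d I)) :
    (glue I x y - G.mean).ofLp =
      join I (x - G.meanObs I).ofLp (y - G.meanMiss I).ofLp := by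
  ext p
  by_cases h : p.1 ∈ I.1 <;> simp [join, glue, meanObs, meanMiss, h]

theorem frame_ofLp (v : EuclideanSpace ℝ (MissIdx d I)) (x : EuclideanSpace ℝ (ObsIdx d I)) :
    (G.frame I v x t).ofLp =
      join I (x - G.meanObs I).ofLp (v - alph t • G.meanMiss I).ofLp := by
  ext p
  by_cases h : p.1 ∈ I.1 <;> simp [join, glue, frame, h]

theorem continuous_join_right (a : ObsIdx d I → ℝ) :
    Continuous fun y : MissIdx d I → ℝ => join I a y := by
  refine continuous_pi fun p => ?_
  by_cases h : p.1 ∈ I.1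
  · simp only [join, h, dite_true]; exact continuous_const
  · simp only [join, h, dite_false]; exact continuous_apply _

theorem integral_gaussDensity_glue_pos (hG : G.KernelAssumption r) (hd : 1 ≤ d)
    (x : EuclideanSpace ℝ (ObsIdx d I)) :
    0 < ∫ z, gaussDensity G.mean G.cov (glue I x z) := by
  have hp := hG.posDef_cov
  have : Nonempty (Fin H × Fin d) := by
    obtain ⟨i, _⟩ := I.2.1
    exact ⟨(i, ⟨0, hd⟩)⟩
  simp only [gaussDensity, glue_sub_mean]
  rw [MeasureTheory.integral_const_mul]
  have hdet := hp.det_pos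
  refine mul_pos (by positivity) (MeasureTheory.integral_exp_pos ?_)
  refine integrable_exp_of_le_neg_mul_sq ?_ (b := lamMin G.cov⁻¹ / 2)
    (half_pos (lamMin_pos hp.inv)) (G.meanMiss I) fun z => ?_
  · have := continuous_join_right (d := d) (x - G.meanObs I).ofLp
    fun_prop
  · have := lamMin_mul_le_dotProduct_mulVec hp.inv.1
      (join I (x - G.meanObs I).ofLp (z - G.meanMiss I).ofLp)
    rw [join_dotProduct, ← norm_sq_eq_dotProduct, ← norm_sq_eq_dotProduct] at this
    have h2 := mul_nonneg (lamMin_pos hp.inv).le (sq_nonneg ‖x - G.meanObs I‖)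
    linarith

/-- After the square is completed, translation invariance removes the minimizer from the integral,
and what is left is independent of `v`. The value of `K` is irrelevant, because the logarithmic
gradient only needs `K > 0`. -/
theorem diffDensity_eq (hG : G.KernelAssumption r) (hd : 1 ≤ d) (ht : 0 < t)
    (x : EuclideanSpace ℝ (ObsIdx d I)) :
    ∃ K : ℝ, 0 < K ∧ ∀ v, G.diffDensity I x t v = K * Real.exp (-(1 / 2) *
      ((G.frame I v x t).ofLp ⬝ᵥ (G.diffCov I t)⁻¹ *ᵥ (G.frame I v x t).ofLp)) := by
  have hs := sigm_pos ht
  have hdet := hG.posDef_cov.det_pos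
  have hJ := integral_gaussDensity_glue_pos hG hd x
  set J := ∫ z, gaussDensity G.mean G.cov (glue I x z) with hJdef
  set N : EuclideanSpace ℝ (MissIdx d I) → ℝ := fun δ => -(1 / 2) *
    (join I 0 δ.ofLp ⬝ᵥ G.cov⁻¹ *ᵥ join I 0 δ.ofLp +
        (sigm t ^ 2)⁻¹ * (alph t ^ 2 * (δ.ofLp ⬝ᵥ δ.ofLp))) with hN
  have hNint : 0 < ∫ δ, Real.exp (N δ) := by
    refine MeasureTheory.integral_exp_pos (integrable_exp_of_le_neg_mul_sq ?_
      (b := (sigm t ^ 2)⁻¹ * alph t ^ 2 / 2) (by have := alph_pos t; positivity) 0 fun z => ?_)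
    · have := continuous_join_right (d := d) (I := I) 0
      fun_prop
    · have := hG.posDef_cov.inv.posSemidef.dotProduct_mulVec_nonneg (join I 0 z.ofLp)
      rw [star_trivial] at this
      rw [sub_zero, norm_sq_eq_dotProduct]
      simp only [hN]
      linarith
  set c₁ : ℝ := (Real.sqrt ((2 * Real.pi) ^ Fintype.card (Fin H × Fin d) * G.cov.det))⁻¹
  have hc₁ : 0 < c₁ := by positivity
  have hdet2 : 0 < (sigm t ^ 2 • (1 : Matrix (MissIdx d I) (MissIdx d I) ℝ)).det := by
    rw [det_smul, det_one, mul_one]; positivity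
  set c₂ : ℝ := (Real.sqrt ((2 * Real.pi) ^ Fintype.card (MissIdx d I) *
    (sigm t ^ 2 • (1 : Matrix (MissIdx d I) (MissIdx d I) ℝ)).det))⁻¹
  have hc₂ : 0 < c₂ := by positivity
  refine ⟨c₁ / J * c₂ * ∫ δ, Real.exp (N δ), by positivity, fun v => ?_⟩
  set w := (G.frame I v x t).ofLp with hw
  set z := (G.diffCov I t)⁻¹ *ᵥ w with hzdef
  have hz : G.diffCov I t *ᵥ z = w := by
    rw [hzdef, mulVec_mulVec, mul_nonsing_inv _
      ((isUnit_iff_isUnit_det _).1 (posDef_diffCov hG ht).isUnit), one_mulVec]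
  rw [exists_eq_join I z, hw, frame_ofLp] at hz
  obtain ⟨e, he⟩ := cov_inv_dotProduct_complete_square hG ht hz
  rw [← exists_eq_join, ← frame_ofLp, ← hw] at he
  have hinv : (sigm t ^ 2 • (1 : Matrix (MissIdx d I) (MissIdx d I) ℝ))⁻¹ =
      (sigm t ^ 2)⁻¹ • (1 : Matrix (MissIdx d I) (MissIdx d I) ℝ) := by
    refine inv_eq_left_inv ?_
    rw [smul_mul_smul_comm, one_mul, inv_mul_cancel₀ (by positivity), one_smul]
  -- The translation by `meanMiss + e` centres the integrand at its mode; only the exponential of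
  -- `w·z` retains `v`.
  have hint : ∀ y, G.condDensity I x y * gaussDensity (alph t • y)
        (sigm t ^ 2 • (1 : Matrix (MissIdx d I) (MissIdx d I) ℝ)) v =
      c₁ / J * c₂ * Real.exp (-(1 / 2) * (w ⬝ᵥ z)) *
        Real.exp (N (y - (G.meanMiss I + WithLp.toLp 2 e))) := by
    intro y
    have h1 := he (y - (G.meanMiss I + WithLp.toLp 2 e)).ofLp
    have e1 : e + (y - (G.meanMiss I + WithLp.toLp 2 e)).ofLp = (y - G.meanMiss I).ofLp := by
      ext p; simp only [WithLp.ofLp_sub, WithLp.ofLp_add, Pi.add_apply, Pi.sub_apply]; ring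
    rw [e1] at h1
    have e2 : (v - alph t • G.meanMiss I).ofLp - alph t • (y - G.meanMiss I).ofLp =
        (v - alph t • y).ofLp := by
      ext p; simp; ring
    rw [e2] at h1
    rw [condDensity, gaussDensity, gaussDensity, glue_sub_mean, hinv, ← hJdef,
      dotProduct_smul_one_mulVec]
    rw [div_mul_eq_mul_div, mul_mul_mul_comm, ← Real.exp_add, ← mul_add, h1, mul_assoc _ _
      (Real.exp (N _)), ← Real.exp_add]
    simp only [hN]
    rw [← mul_add]
    ring
  rw [diffDensity]
  simp_rw [hint]
  rw [MeasureTheory.integral_const_mul,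
    MeasureTheory.integral_sub_right_eq_self (fun y => Real.exp (N y))]
  ring

theorem score_eq (hG : G.KernelAssumption r) (hd : 1 ≤ d) (ht : 0 < t)
    (x : EuclideanSpace ℝ (ObsIdx d I)) (v : EuclideanSpace ℝ (MissIdx d I)) :
    G.score I v x t = WithLp.toLp 2 fun q =>
      -((G.diffCov I t)⁻¹ *ᵥ (G.frame I v x t).ofLp) (q.1.1, q.2) := by
  obtain ⟨K, hK, h⟩ := diffDensity_eq hG hd ht x
  have hpos := (posDef_diffCov (I := I) hG ht).inv
  refine HasGradientAt.gradient ?_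
  simp_rw [h, Real.log_mul hK.ne' (Real.exp_pos _).ne', Real.log_exp]
  rw [hasGradientAt_iff_isLittleO]
  -- The log-density is quadratic in `v`, so the Taylor remainder is exactly the quadratic form of
  -- the increment.
  have key : ∀ v' : EuclideanSpace ℝ (MissIdx d I),
      Real.log K + -(1 / 2) * ((G.frame I v' x t).ofLp ⬝ᵥ
          (G.diffCov I t)⁻¹ *ᵥ (G.frame I v' x t).ofLp) -
        (Real.log K + -(1 / 2) * ((G.frame I v x t).ofLp ⬝ᵥ
          (G.diffCov I t)⁻¹ *ᵥ (G.frame I v x t).ofLp)) -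
        inner ℝ (WithLp.toLp 2 fun q : MissIdx d I =>
          -((G.diffCov I t)⁻¹ *ᵥ (G.frame I v x t).ofLp) (q.1.1, q.2)) (v' - v) =
      -(1 / 2) * (join I 0 (v' - v).ofLp ⬝ᵥ (G.diffCov I t)⁻¹ *ᵥ join I 0 (v' - v).ofLp) := by
    intro v'
    have e1 : (G.frame I v' x t).ofLp = (G.frame I v x t).ofLp + join I 0 (v' - v).ofLp := by
      rw [frame_ofLp, frame_ofLp]
      ext p
      by_cases h : p.1 ∈ I.1 <;> simp [join, h]
    rw [e1, dotProduct_mulVec_add_self hpos.1]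
    generalize (G.diffCov I t)⁻¹ *ᵥ (G.frame I v x t).ofLp = z
    have e2 : join I 0 (v' - v).ofLp ⬝ᵥ z =
        -inner ℝ (WithLp.toLp 2 fun q : MissIdx d I => -z (q.1.1, q.2)) (v' - v) := by
      rw [EuclideanSpace.inner_eq_star_dotProduct]
      simp [dotProduct, sum_split I]
    rw [e2]
    ring
  simp_rw [key]
  have hO : (fun v' : EuclideanSpace ℝ (MissIdx d I) => -(1 / 2) * (join I 0 (v' - v).ofLp ⬝ᵥ
      (G.diffCov I t)⁻¹ *ᵥ join I 0 (v' - v).ofLp)) =O[nhds v] fun v' => ‖v' - v‖ ^ 2 := by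
    refine Asymptotics.IsBigO.of_bound (1 / 2 * lamMax (G.diffCov I t)⁻¹)
      (Filter.Eventually.of_forall fun v' => ?_)
    have h1 := dotProduct_mulVec_le_lamMax hpos.1 (join I 0 (v' - v).ofLp)
    have h2 := hpos.posSemidef.dotProduct_mulVec_nonneg (join I 0 (v' - v).ofLp)
    rw [star_trivial] at h2
    rw [join_dotProduct, zero_dotProduct, zero_add, ← norm_sq_eq_dotProduct] at h1
    rw [Real.norm_eq_abs, Real.norm_eq_abs, abs_mul, abs_of_nonneg h2, abs_neg,
      abs_of_nonneg (sq_nonneg ‖v' - v‖), abs_of_pos (by norm_num : (0 : ℝ) < 1 / 2)]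
    linarith
  refine hO.trans_isLittleO ?_
  have h0 : Filter.Tendsto (fun v' : EuclideanSpace ℝ (MissIdx d I) => ‖v' - v‖) (nhds v)
      (nhds 0) := by
    have : Continuous fun v' : EuclideanSpace ℝ (MissIdx d I) => ‖v' - v‖ := by fun_prop
    simpa using this.tendsto v
  have h1 : (fun v' : EuclideanSpace ℝ (MissIdx d I) => ‖v' - v‖) =o[nhds v] fun _ => (1 : ℝ) :=
    (Asymptotics.isLittleO_one_iff ℝ).2 h0
  have := h1.mul_isBigO (Asymptotics.isBigO_refl
    (fun v' : EuclideanSpace ℝ (MissIdx d I) => ‖v' - v‖) (nhds v))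
  simp only [one_mul, ← sq] at this
  exact this.trans_isBigO (Asymptotics.isBigO_norm_left.2 (Asymptotics.isBigO_refl _ _))

end GPModel

/-! ### Attention layers with prescribed matrices and controlled norms -/

section Realization

theorem frob_le {m n : Type*} [Fintype m] [Fintype n] {A : Matrix m n ℝ} {B : ℝ} (hB : 0 ≤ B)
    (h : ∑ i, A i ⬝ᵥ A i ≤ B ^ 2) : frob A ≤ B := by
  refine Real.sqrt_le_iff.2 ⟨hB, le_trans (le_of_eq ?_) h⟩
  exact Finset.sum_congr rfl fun i _ => Finset.sum_congr rfl fun j _ => sq _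

theorem frob_zero {m n : Type*} [Fintype m] [Fintype n] : frob (0 : Matrix m n ℝ) = 0 := by
  simp [frob]

theorem frob_submatrix_equiv {m n m' n' : Type*} [Fintype m] [Fintype n] [Fintype m'] [Fintype n']
    (A : Matrix m n ℝ) (e : m' ≃ m) (f : n' ≃ n) : frob (A.submatrix e f) = frob A := by
  simp only [frob, submatrix_apply]
  congr 1
  rw [← e.sum_comp]
  exact Finset.sum_congr rfl fun i _ => f.sum_comp fun j => A (e i) j ^ 2

/-- Put the rows of a matrix into the rows of a larger zero matrix. -/
def extendRows {τ ι κ : Type*} (g : τ ↪ ι) (A : Matrix τ κ ℝ) : Matrix ι κ ℝ :=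
  Matrix.of fun i c => Function.extend g (fun k => A k c) 0 i

theorem extendRows_apply {τ ι κ : Type*} (g : τ ↪ ι) (A : Matrix τ κ ℝ) (k : τ) (c : κ) :
    extendRows g A (g k) c = A k c :=
  g.injective.extend_apply (fun k => A k c) 0 k

theorem extendRows_apply_of_not_mem {τ ι κ : Type*} (g : τ ↪ ι) (A : Matrix τ κ ℝ) {i : ι}
    (hi : i ∉ Set.range g) (c : κ) : extendRows g A i c = 0 :=
  Function.extend_apply' (fun k => A k c) (0 : ι → ℝ) i hi

theorem frob_extendRows {τ ι κ : Type*} [Fintype τ] [Fintype ι] [Fintype κ] (g : τ ↪ ι)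
    (A : Matrix τ κ ℝ) : frob (extendRows g A) = frob A := by
  simp only [frob]
  congr 1
  symm
  refine Fintype.sum_of_injective g g.injective _ _ (fun i hi => ?_) fun k => ?_
  · exact Finset.sum_eq_zero fun j _ => by rw [extendRows_apply_of_not_mem g A hi]; simp
  · simp only [extendRows_apply]

theorem extendRows_mul {τ ι κ n : Type*} [Fintype κ] (g : τ ↪ ι) (A : Matrix τ κ ℝ)
    (Y : Matrix κ n ℝ) : extendRows g A * Y = extendRows g (A * Y) := by
  ext i j
  by_cases hi : i ∈ Set.range g
  · obtain ⟨k, rfl⟩ := hi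
    simp only [mul_apply, extendRows_apply]
  · simp [mul_apply, extendRows_apply_of_not_mem _ _ hi]

/-- Padding queries and keys by the same zero rows leaves the attention scores unchanged, so heads
with few rows fit the square format. -/
theorem transpose_extendRows_mul {τ ι n n' : Type*} [Fintype τ] [Fintype ι] (g : τ ↪ ι)
    (A : Matrix τ n ℝ) (A' : Matrix τ n' ℝ) :
    (extendRows g A)ᵀ * extendRows g A' = Aᵀ * A' := by
  ext i j
  simp only [mul_apply, transpose_apply]
  symm
  refine Fintype.sum_of_injective g g.injective _ _ (fun a ha => ?_) fun k => ?_
  · rw [extendRows_apply_of_not_mem g A ha, zero_mul]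
  · simp only [extendRows_apply]

/-- A block with vanishing feedforward layer realizes any attention layer with few enough heads and
few enough query and key rows, after relabelling of the channels. -/
theorem exists_block {ι κ τ J : Type} [Fintype ι] [Fintype κ] [Fintype τ] [Fintype J] {M : ℕ}
    (e : κ ≃ ι) (hτ : Fintype.card τ ≤ Fintype.card ι) (hJ : Fintype.card J ≤ M) {B : ℝ}
    (hB : 0 ≤ B) (V : J → Matrix κ κ ℝ) (Q K : J → Matrix τ κ ℝ) (hV : ∀ j, frob (V j) ≤ B)
    (hQ : ∀ j, frob (Q j) ≤ B) (hK : ∀ j, frob (K j) ≤ B) :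
    ∃ b : Block ι M, b.BoundedBy B ∧ ∀ (H : ℕ) (Y : Matrix κ (Fin H) ℝ),
      b.apply (Y.submatrix e.symm id) =
        (Y + ∑ j, V j * Y * Block.relu ((Q j * Y)ᵀ * (K j * Y))).submatrix e.symm id := by
  obtain ⟨g⟩ := Function.Embedding.nonempty_of_card_le hτ
  obtain ⟨f⟩ : Nonempty (J ↪ Fin M) :=
    Function.Embedding.nonempty_of_card_le (by simpa using hJ)
  let hd : J → Head ι := fun j => ⟨(V j).submatrix e.symm e.symm,
    (extendRows g (Q j)).submatrix id e.symm, (extendRows g (K j)).submatrix id e.symm⟩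
  let b : Block ι M := ⟨Function.extend f hd fun _ => ⟨0, 0, 0⟩, 0, 0, 0, 0⟩
  have hf : ∀ j, b.head (f j) = hd j := fun j => f.injective.extend_apply hd (fun _ => ⟨0, 0, 0⟩) j
  have hf' : ∀ m, (¬ ∃ j, f j = m) → b.head m = ⟨0, 0, 0⟩ := fun m hm =>
    Function.extend_apply' hd (fun _ => ⟨0, 0, 0⟩) m hm
  have hrow : ∀ A : Matrix τ κ ℝ, frob ((extendRows g A).submatrix id e.symm) = frob A := fun A =>
    (frob_submatrix_equiv (extendRows g A) (Equiv.refl ι) e.symm).trans (frob_extendRows g A)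
  refine ⟨b, ⟨fun m => ?_, ?_, ?_, ?_, ?_⟩, fun H Y => ?_⟩
  · by_cases hm : ∃ j, f j = m
    · obtain ⟨j, rfl⟩ := hm
      rw [hf]
      exact ⟨(frob_submatrix_equiv (V j) e.symm e.symm).trans_le (hV j),
        (hrow _).trans_le (hQ j), (hrow _).trans_le (hK j)⟩
    · rw [hf' m hm]
      simpa [frob_zero] using hB
  · simpa [b, frob_zero] using hB
  · simpa [b, frob_zero] using hB
  · simpa [b, vecNorm] using hB
  · simpa [b, vecNorm] using hB
  -- With `W₁` and `b₁` zero only the skip connection of the feedforward layer survives.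
  · have h0 : ∀ Z : Matrix ι (Fin H) ℝ, b.ffn Z = Z := fun Z => by
      simp only [Block.ffn, b, Matrix.zero_mul, add_zero]
      ext i j
      simp
    rw [Block.apply, h0, Block.attn, submatrix_add, Pi.add_apply, Pi.add_apply]
    congr 1
    have hY : ∀ A : Matrix τ κ ℝ, (extendRows g A).submatrix id e.symm * Y.submatrix e.symm id =
        extendRows g (A * Y) := fun A => by
      rw [submatrix_mul_equiv, extendRows_mul, submatrix_id_id]
    have hsum : (∑ j, V j * Y * Block.relu ((Q j * Y)ᵀ * (K j * Y))).submatrix e.symm id =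
        ∑ j, (V j * Y * Block.relu ((Q j * Y)ᵀ * (K j * Y))).submatrix e.symm id := by
      ext i j
      simp [Matrix.sum_apply]
    rw [hsum]
    symm
    refine Fintype.sum_of_injective f f.injective _ _ (fun m hm => ?_) fun j => ?_
    · rw [hf' m hm]
      simp
    · rw [hf]
      simp only [hd, hY, transpose_extendRows_mul, submatrix_mul_equiv]
      rfl

/-- `P` is the orthogonal projection onto the span of the vectors. Its squared Frobenius norm is its
rank, hence at most `H`, whereas the identity would cost `n`. -/
theorem exists_projection_matrix {H n : ℕ} (v : Fin H → EuclideanSpace ℝ (Fin n)) :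
    ∃ P : Matrix (Fin n) (Fin n) ℝ, (∀ i k, P k ⬝ᵥ (v i).ofLp = v i k) ∧
      ∑ k, P k ⬝ᵥ P k ≤ H := by
  let U := Submodule.span ℝ (Set.range v)
  let b := stdOrthonormalBasis ℝ U
  refine ⟨Matrix.of fun k l => ∑ a, (b a : EuclideanSpace ℝ (Fin n)) k *
    (b a : EuclideanSpace ℝ (Fin n)) l, fun i k => ?_, ?_⟩
  · have hv : v i ∈ U := Submodule.subset_span (Set.mem_range_self i)
    have h1 := b.sum_repr' ⟨v i, hv⟩
    have h2 := congrArg (fun u : U => (u : EuclideanSpace ℝ (Fin n)) k) h1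
    simp only [AddSubmonoidClass.coe_finsetSum, Submodule.coe_smul, Submodule.coe_inner,
      WithLp.ofLp_sum, Finset.sum_apply, PiLp.smul_apply, smul_eq_mul] at h2
    rw [← h2]
    simp only [dotProduct, of_apply, Finset.sum_mul]
    rw [Finset.sum_comm]
    refine Finset.sum_congr rfl fun a _ => ?_
    rw [PiLp.inner_apply, Finset.sum_mul]
    exact Finset.sum_congr rfl fun l _ => by simp; ring
  · have h1 : ∀ a a', ∑ l, (b a : EuclideanSpace ℝ (Fin n)) l *
        (b a' : EuclideanSpace ℝ (Fin n)) l = if a = a' then 1 else 0 := fun a a' => by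
      rw [← orthonormal_iff_ite.1 b.orthonormal a a', Submodule.coe_inner, PiLp.inner_apply]
      exact Finset.sum_congr rfl fun l _ => by simp; ring
    have h2 : ∑ k, (∑ l, (∑ a, (b a : EuclideanSpace ℝ (Fin n)) k *
          (b a : EuclideanSpace ℝ (Fin n)) l) * (∑ a, (b a : EuclideanSpace ℝ (Fin n)) k *
          (b a : EuclideanSpace ℝ (Fin n)) l)) = Module.finrank ℝ U := by
      simp_rw [Finset.sum_mul_sum]
      have : ∀ k, ∑ l, ∑ a, ∑ a', (b a : EuclideanSpace ℝ (Fin n)) k *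
          (b a : EuclideanSpace ℝ (Fin n)) l * ((b a' : EuclideanSpace ℝ (Fin n)) k *
          (b a' : EuclideanSpace ℝ (Fin n)) l) = ∑ a, (b a : EuclideanSpace ℝ (Fin n)) k *
          (b a : EuclideanSpace ℝ (Fin n)) k := by
        intro k
        rw [Finset.sum_comm]
        refine Finset.sum_congr rfl fun a _ => ?_
        rw [Finset.sum_comm]
        have : ∀ a', ∑ l, (b a : EuclideanSpace ℝ (Fin n)) k *
            (b a : EuclideanSpace ℝ (Fin n)) l * ((b a' : EuclideanSpace ℝ (Fin n)) k *
            (b a' : EuclideanSpace ℝ (Fin n)) l) = (b a : EuclideanSpace ℝ (Fin n)) k *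
            (b a' : EuclideanSpace ℝ (Fin n)) k * if a = a' then 1 else 0 := by
          intro a'
          rw [← h1, Finset.mul_sum]
          exact Finset.sum_congr rfl fun l _ => by ring
        simp [this]
      simp_rw [this]
      rw [Finset.sum_comm]
      simp [h1]
    refine (le_of_eq h2).trans ?_
    exact_mod_cast (finrank_range_le_card v).trans (by simp)

end Realization

/-- Channels of a token with named buffers: iterate, scaled embedding, scaling factor. -/
abbrev WorkChannel (d dₑ : ℕ) : Type :=
  Fin d ⊕ Fin dₑ ⊕ Fin 4 ⊕ Fin 3 ⊕ Fin d ⊕ Fin d ⊕ Fin dₑ ⊕ Unit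

/-! ### Token layout with named buffers -/

namespace WorkChannel

variable {d dₑ : ℕ}

def equivChannel (d dₑ : ℕ) : WorkChannel d dₑ ≃ Channel d dₑ (d + (dₑ + 1)) :=
  (Equiv.refl _).sumCongr <| (Equiv.refl _).sumCongr <| (Equiv.refl _).sumCongr <|
    (Equiv.refl _).sumCongr <| (Equiv.refl _).sumCongr <|
      ((Equiv.refl _).sumCongr (((Equiv.refl _).sumCongr (Equiv.ofUnique Unit (Fin 1))).trans
        finSumFinEquiv)).trans finSumFinEquiv

/-- A vector of channels given by its parts; the copy of the observed frame is not used. -/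
def channelVec (y : Fin d → ℝ) (e : Fin dₑ → ℝ) (φ : Fin 4 → ℝ) (o : Fin 3 → ℝ) (c : Fin d → ℝ)
    (z : Fin d → ℝ) (e' : Fin dₑ → ℝ) (m : ℝ) : WorkChannel d dₑ → ℝ :=
  Sum.elim y <| Sum.elim e <| Sum.elim φ <| Sum.elim o <| Sum.elim c <| Sum.elim z <|
    Sum.elim e' fun _ => m

theorem channelVec_dotProduct (y e φ o c z e' m) (y₂ e₂ φ₂ o₂ c₂ z₂ e₂' m₂) :
    channelVec (d := d) (dₑ := dₑ) y e φ o c z e' m ⬝ᵥ channelVec y₂ e₂ φ₂ o₂ c₂ z₂ e₂' m₂ =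
      y ⬝ᵥ y₂ + (e ⬝ᵥ e₂ + (φ ⬝ᵥ φ₂ + (o ⬝ᵥ o₂ + (c ⬝ᵥ c₂ + (z ⬝ᵥ z₂ + (e' ⬝ᵥ e₂' + m * m₂)))))) := by
  simp [channelVec, dotProduct]

/-- A matrix that writes only into the buffers. -/
def write (z : Fin d → WorkChannel d dₑ → ℝ) (e' : Fin dₑ → WorkChannel d dₑ → ℝ)
    (m : WorkChannel d dₑ → ℝ) : Matrix (WorkChannel d dₑ) (WorkChannel d dₑ) ℝ :=
  Matrix.of <| Sum.elim 0 <| Sum.elim 0 <| Sum.elim 0 <| Sum.elim 0 <| Sum.elim 0 <| Sum.elim z <|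
    Sum.elim e' fun _ => m

theorem frob_write_le {z : Fin d → WorkChannel d dₑ → ℝ} {e' : Fin dₑ → WorkChannel d dₑ → ℝ}
    {m : WorkChannel d dₑ → ℝ} {B : ℝ} (hB : 0 ≤ B)
    (h : ∑ k, z k ⬝ᵥ z k + (∑ k, e' k ⬝ᵥ e' k + m ⬝ᵥ m) ≤ B ^ 2) : frob (write z e' m) ≤ B := by
  refine frob_le hB (le_trans (le_of_eq ?_) h)
  have hr : ∀ i, write z e' m i = (Sum.elim 0 <| Sum.elim 0 <| Sum.elim 0 <| Sum.elim 0 <|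
    Sum.elim 0 <| Sum.elim z <| Sum.elim e' fun _ => m : WorkChannel d dₑ → _) i := fun _ => rfl
  simp only [hr, Fintype.sum_sum_type]
  simp

end WorkChannel

namespace GPModel

open WorkChannel

variable {H d dₑ : ℕ} {G : GPModel H d dₑ}

/-- Observation indicators of a frame. -/
def flags (I : Pattern H) (i : Fin H) : Fin 3 → ℝ :=
  ![1, if i ∈ I.1 then 1 else 0, if i ∈ I.1 then 0 else 1]

variable (G) in
/-- The token of a frame with the given contents of the buffers. -/
def token (I : Pattern H) (v : EuclideanSpace ℝ (MissIdx d I))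
    (x : EuclideanSpace ℝ (ObsIdx d I)) (t : ℝ) (z : Fin H × Fin d → ℝ)
    (e' : Fin H → Fin dₑ → ℝ) (m : Fin H → ℝ) (i : Fin H) : WorkChannel d dₑ → ℝ :=
  channelVec (fun k => G.frame I v x t (i, k)) (G.emb i).ofLp (G.timeEmb I t)
    (flags I i) (fun k => if i ∈ I.1 then G.frame I v x t (i, k) else 0)
    (fun k => z (i, k)) (e' i) (m i)

variable (G) in
/-- All tokens, as columns. -/
def tokens (I : Pattern H) (v : EuclideanSpace ℝ (MissIdx d I))
    (x : EuclideanSpace ℝ (ObsIdx d I)) (t : ℝ) (z : Fin H × Fin d → ℝ)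
    (e' : Fin H → Fin dₑ → ℝ) (m : Fin H → ℝ) : Matrix (WorkChannel d dₑ) (Fin H) ℝ :=
  Matrix.of fun c i => G.token I v x t z e' m i c

variable {I : Pattern H} {v : EuclideanSpace ℝ (MissIdx d I)}
  {x : EuclideanSpace ℝ (ObsIdx d I)} {t : ℝ}

theorem encode_eq_tokens : G.encode (d + (dₑ + 1)) I v x t =
    (G.tokens I v x t 0 0 0).submatrix (equivChannel d dₑ).symm id := by
  have : (G.encode (d + (dₑ + 1)) I v x t).submatrix (equivChannel d dₑ) id =
      G.tokens I v x t 0 0 0 := by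
    ext (c | c | c | c | c | c | c | c) i <;> rfl
  rw [← this, submatrix_submatrix]
  simp

/-- Values are written only into the buffers, so frames, embeddings, times and flags survive every
block. This is what allows the same block to be repeated. -/
theorem tokens_add_sum_write {J : Type} [Fintype J]
    (Z : J → Fin d → WorkChannel d dₑ → ℝ)
    (E : J → Fin dₑ → WorkChannel d dₑ → ℝ) (m' : J → WorkChannel d dₑ → ℝ)
    (R : J → Matrix (Fin H) (Fin H) ℝ) (z : Fin H × Fin d → ℝ) (e' : Fin H → Fin dₑ → ℝ)
    (m : Fin H → ℝ) :
    G.tokens I v x t z e' m + ∑ j, write (Z j) (E j) (m' j) * G.tokens I v x t z e' m * R j =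
      G.tokens I v x t
        (fun p => z p + ∑ j, ∑ i, (Z j p.2 ⬝ᵥ G.token I v x t z e' m i) * R j i p.1)
        (fun q k => e' q k + ∑ j, ∑ i, (E j k ⬝ᵥ G.token I v x t z e' m i) * R j i q)
        (fun q => m q + ∑ j, ∑ i, (m' j ⬝ᵥ G.token I v x t z e' m i) * R j i q) := by
  generalize hw : G.token I v x t z e' m = w
  have h : ∀ (c : WorkChannel d dₑ) (i : Fin H) (j : J),
      (write (Z j) (E j) (m' j) * G.tokens I v x t z e' m * R j) c i =
        ∑ a, (Sum.elim 0 <| Sum.elim 0 <| Sum.elim 0 <| Sum.elim 0 <| Sum.elim 0 <|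
          Sum.elim (Z j) <| Sum.elim (E j) fun _ => m' j : WorkChannel d dₑ → _) c ⬝ᵥ w a *
            R j a i := fun c i j => by
    rw [← hw, mul_apply]; rfl
  ext c i
  rw [Matrix.add_apply, Matrix.sum_apply, Finset.sum_congr rfl fun j _ => h c i j]
  have hw' : ∀ z e' m, G.tokens I v x t z e' m c i = G.token I v x t z e' m i c :=
    fun _ _ _ => rfl
  rw [hw', hw']
  rcases c with (c | c | c | c | c | c | c | c) <;> simp [token, channelVec]

end GPModel

/-! ### Query and key matrices and their attention scores -/

namespace GPModel

open WorkChannel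

variable {H d dₑ : ℕ} {G : GPModel H d dₑ}

/-- A query or key matrix: rows that read the embedding and two further rows. -/
def queryRows (e : Fin dₑ → WorkChannel d dₑ → ℝ) (p₀ p₁ : WorkChannel d dₑ → ℝ) :
    Matrix (Fin dₑ ⊕ Bool) (WorkChannel d dₑ) ℝ :=
  Matrix.of (Sum.elim e fun b => bif b then p₁ else p₀)

theorem frob_queryRows_le {e : Fin dₑ → WorkChannel d dₑ → ℝ} {p₀ p₁ : WorkChannel d dₑ → ℝ} {B : ℝ}
    (hB : 0 ≤ B) (h : ∑ k, e k ⬝ᵥ e k + (p₀ ⬝ᵥ p₀ + p₁ ⬝ᵥ p₁) ≤ B ^ 2) :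
    frob (queryRows e p₀ p₁) ≤ B := by
  refine frob_le hB (le_trans (le_of_eq ?_) h)
  have hr : ∀ i, queryRows e p₀ p₁ i = Sum.elim e (fun b => bif b then p₁ else p₀) i := fun _ => rfl
  simp only [hr, Fintype.sum_sum_type]
  simp [add_comm]

variable {I : Pattern H} {v : EuclideanSpace ℝ (MissIdx d I)}
  {x : EuclideanSpace ℝ (ObsIdx d I)} {t : ℝ}

theorem queryRows_score (e e₂ : Fin dₑ → WorkChannel d dₑ → ℝ) (p₀ p₁ q₀ q₁ : WorkChannel d dₑ → ℝ)
    (z : Fin H × Fin d → ℝ) (e' : Fin H → Fin dₑ → ℝ) (m : Fin H → ℝ) (i j : Fin H) :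
    ((queryRows e p₀ p₁ * G.tokens I v x t z e' m)ᵀ *
        (queryRows e₂ q₀ q₁ * G.tokens I v x t z e' m)) i j =
      (∑ k, (e k ⬝ᵥ G.token I v x t z e' m i) * (e₂ k ⬝ᵥ G.token I v x t z e' m j)) +
        ((p₀ ⬝ᵥ G.token I v x t z e' m i) * (q₀ ⬝ᵥ G.token I v x t z e' m j) +
          (p₁ ⬝ᵥ G.token I v x t z e' m i) * (q₁ ⬝ᵥ G.token I v x t z e' m j)) := by
  have hr : ∀ e (p₀ p₁ : WorkChannel d dₑ → ℝ) k i,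
      (queryRows e p₀ p₁ * G.tokens I v x t z e' m) k i =
        Sum.elim e (fun b => bif b then p₁ else p₀) k ⬝ᵥ G.token I v x t z e' m i :=
    fun _ _ _ _ _ => rfl
  simp only [mul_apply (M := Matrix.transpose _), transpose_apply, hr, Fintype.sum_sum_type]
  simp [add_comm]

/-- Query matrix of a head whose scores form a diagonal matrix. -/
def diagQuery (d : ℕ) (P : Matrix (Fin dₑ) (Fin dₑ) ℝ) (N : ℝ) (φ : Fin 4 → ℝ) :
    Matrix (Fin dₑ ⊕ Bool) (WorkChannel d dₑ) ℝ :=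
  queryRows (fun k => channelVec 0 (N • P k) 0 0 0 0 0 0) (channelVec 0 0 0 ![1, 0, 0] 0 0 0 0)
    (channelVec 0 0 φ 0 0 0 0 0)

/-- Key matrix of a head whose scores form a diagonal matrix. -/
def diagKey (d : ℕ) (P : Matrix (Fin dₑ) (Fin dₑ) ℝ) (N r c₀ c₁ : ℝ) :
    Matrix (Fin dₑ ⊕ Bool) (WorkChannel d dₑ) ℝ :=
  queryRows (fun k => channelVec 0 (P k) 0 0 0 0 0 0)
    (channelVec 0 0 0 ![c₀ - N * r ^ 2, c₁, 0] 0 0 0 0) (channelVec 0 0 0 ![0, 0, 1] 0 0 0 0)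

/-- Query matrix of a head whose scores are ramps of the inner products of the scaled embeddings. -/
def rampQuery (d : ℕ) (P : Matrix (Fin dₑ) (Fin dₑ) ℝ) : Matrix (Fin dₑ ⊕ Bool) (WorkChannel d dₑ) ℝ :=
  queryRows (fun k => channelVec 0 0 0 0 0 0 (P k) 0) (channelVec 0 0 0 0 0 0 0 1) 0

/-- Key matrix of a head whose scores are ramps of the inner products of the scaled embeddings. -/
def rampKey (d : ℕ) (P : Matrix (Fin dₑ) (Fin dₑ) ℝ) (s : ℝ) :
    Matrix (Fin dₑ ⊕ Bool) (WorkChannel d dₑ) ℝ :=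
  queryRows (fun k => channelVec 0 0 0 0 0 0 (P k) 0) (channelVec 0 0 0 0 0 0 0 (-s)) 0

theorem sum_emb_mul_emb (i j : Fin H) :
    ∑ k, G.emb i k * G.emb j k = inner ℝ (G.emb i) (G.emb j) := by
  rw [PiLp.inner_apply]
  exact Finset.sum_congr rfl fun k _ => by simp [mul_comm]

theorem inner_emb {r : ℝ} (hr : ∀ i, ‖G.emb i‖ = r) (i j : Fin H) :
    inner ℝ (G.emb i) (G.emb j) = r ^ 2 - ‖G.emb i - G.emb j‖ ^ 2 / 2 := by
  rw [norm_sub_sq_real, hr, hr]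
  ring

theorem relu_apply {m n : Type*} (A : Matrix m n ℝ) (i : m) (j : n) :
    Block.relu A i j = max (A i j) 0 := rfl

/-- With weight `2/gap` the score is `μ j - ‖e_i - e_j‖²/gap`. Off the diagonal the subtracted term
is at least `1 ≥ μ j`, so ReLU kills it. The parametrization of `μ` covers the scaling factors, the
noise variances and the identity. -/
theorem relu_diag_score {P : Matrix (Fin dₑ) (Fin dₑ) ℝ}
    (hP : ∀ i k, P k ⬝ᵥ (G.emb i).ofLp = G.emb i k) {r gap : ℝ} (hgap : 0 < gap)
    (hr : ∀ i, ‖G.emb i‖ = r) (hsep : ∀ i j, i ≠ j → gap ≤ ‖G.emb i - G.emb j‖ ^ 2)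
    {c₀ c₁ : ℝ} {φ : Fin 4 → ℝ} {μ : Fin H → ℝ}
    (hμ : ∀ j, μ j = c₀ + if j ∈ I.1 then c₁ else φ ⬝ᵥ G.timeEmb I t)
    (h0 : ∀ j, 0 ≤ μ j) (h1 : ∀ j, μ j ≤ 1) (z : Fin H × Fin d → ℝ) (e' : Fin H → Fin dₑ → ℝ)
    (m : Fin H → ℝ) :
    Block.relu ((diagQuery d P (2 / gap) φ * G.tokens I v x t z e' m)ᵀ *
        (diagKey d P (2 / gap) r c₀ c₁ * G.tokens I v x t z e' m)) = diagonal μ := by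
  ext i j
  rw [relu_apply, diagQuery, diagKey, queryRows_score]
  have e1 : ((∑ k, (channelVec 0 ((2 / gap) • P k) 0 0 0 0 0 0 ⬝ᵥ G.token I v x t z e' m i) *
        (channelVec 0 (P k) 0 0 0 0 0 0 ⬝ᵥ G.token I v x t z e' m j)) +
      ((channelVec 0 0 0 ![1, 0, 0] 0 0 0 0 ⬝ᵥ G.token I v x t z e' m i) *
        (channelVec 0 0 0 ![c₀ - 2 / gap * r ^ 2, c₁, 0] 0 0 0 0 ⬝ᵥ G.token I v x t z e' m j) +
        (channelVec 0 0 φ 0 0 0 0 0 ⬝ᵥ G.token I v x t z e' m i) *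
        (channelVec 0 0 0 ![0, 0, 1] 0 0 0 0 ⬝ᵥ G.token I v x t z e' m j))) =
      μ j - ‖G.emb i - G.emb j‖ ^ 2 / gap := by
    simp only [token, channelVec_dotProduct, zero_dotProduct, add_zero, zero_add, zero_mul,
      smul_dotProduct, hP, smul_eq_mul]
    have : ∀ k, 2 / gap * G.emb i k * G.emb j k = 2 / gap * (G.emb i k * G.emb j k) :=
      fun k => mul_assoc _ _ _
    simp_rw [this]
    rw [← Finset.mul_sum, sum_emb_mul_emb, inner_emb hr, hμ]
    by_cases hj : j ∈ I.1 <;> simp [flags, hj, dotProduct, Fin.sum_univ_three] <;> field_simp <;> ring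
  rw [e1]
  by_cases hij : i = j
  · subst hij
    simp [h0]
  · rw [diagonal_apply_ne _ hij]
    refine max_eq_right ?_
    have := (one_le_div hgap).2 (hsep i j hij)
    linarith [h1 j]

/-- Both the inner product and the offset carry the factor `m i * m j`, which positive homogeneity
pulls out of the ReLU. In this way the scaling by `α_t` on both sides of the covariance is obtained
exactly. -/
theorem relu_ramp_score {P : Matrix (Fin dₑ) (Fin dₑ) ℝ}
    (hP : ∀ i k, P k ⬝ᵥ (G.emb i).ofLp = G.emb i k) {m : Fin H → ℝ} (hm : ∀ i, 0 ≤ m i) (s : ℝ)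
    (z : Fin H × Fin d → ℝ) (i j : Fin H) :
    Block.relu ((rampQuery d P * G.tokens I v x t z (fun i k => m i * G.emb i k) m)ᵀ *
        (rampKey d P s * G.tokens I v x t z (fun i k => m i * G.emb i k) m)) i j =
      m i * m j * max (inner ℝ (G.emb i) (G.emb j) - s) 0 := by
  rw [relu_apply, rampQuery, rampKey, queryRows_score]
  have hP' : ∀ i k, (P k ⬝ᵥ fun l => m i * G.emb i l) = m i * G.emb i k := fun i k => by
    rw [← hP i k, ← smul_eq_mul, ← dotProduct_smul]
    rfl
  simp only [token, channelVec_dotProduct, zero_dotProduct, mul_zero, add_zero, zero_add, zero_mul, hP']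
  have : ∀ k, m i * G.emb i k * (m j * G.emb j k) = m i * m j * (G.emb i k * G.emb j k) :=
    fun k => by ring
  simp_rw [this]
  rw [← Finset.mul_sum, sum_emb_mul_emb, mul_max_of_nonneg _ _ (mul_nonneg (hm i) (hm j)), mul_zero]
  congr 1
  ring

theorem frob_diagQuery_le {P : Matrix (Fin dₑ) (Fin dₑ) ℝ} (hP : ∑ k, P k ⬝ᵥ P k ≤ H) {N B : ℝ}
    (hB : 0 ≤ B) {φ : Fin 4 → ℝ} (hφ : φ ⬝ᵥ φ ≤ 1) (h : N ^ 2 * H + 2 ≤ B ^ 2) :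
    frob (diagQuery d P N φ) ≤ B := by
  refine frob_queryRows_le hB (le_trans ?_ h)
  simp only [channelVec_dotProduct, zero_dotProduct, mul_zero, add_zero, zero_add, smul_dotProduct,
    dotProduct_smul, smul_eq_mul]
  have : ∀ k, N * (N * (P k ⬝ᵥ P k)) = N ^ 2 * (P k ⬝ᵥ P k) := fun k => by ring
  simp_rw [this]
  rw [← Finset.mul_sum]
  have h1 := mul_le_mul_of_nonneg_left hP (sq_nonneg N)
  have h2 : (![1, 0, 0] : Fin 3 → ℝ) ⬝ᵥ ![1, 0, 0] = 1 := by simp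
  rw [h2]
  linarith

theorem frob_diagKey_le {P : Matrix (Fin dₑ) (Fin dₑ) ℝ} (hP : ∑ k, P k ⬝ᵥ P k ≤ H)
    {N r c₀ c₁ B : ℝ} (hB : 0 ≤ B)
    (h : H + ((c₀ - N * r ^ 2) ^ 2 + c₁ ^ 2 + 1) ≤ B ^ 2) :
    frob (diagKey d P N r c₀ c₁) ≤ B := by
  refine frob_queryRows_le hB (le_trans ?_ h)
  simp only [channelVec_dotProduct, zero_dotProduct, mul_zero, add_zero, zero_add]
  have h2 : (![0, 0, 1] : Fin 3 → ℝ) ⬝ᵥ ![0, 0, 1] = 1 := by simp [dotProduct, Fin.sum_univ_three]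
  have h3 : (![c₀ - N * r ^ 2, c₁, 0] : Fin 3 → ℝ) ⬝ᵥ ![c₀ - N * r ^ 2, c₁, 0] =
      (c₀ - N * r ^ 2) ^ 2 + c₁ ^ 2 := by simp [dotProduct, Fin.sum_univ_three]; ring
  rw [h2, h3]
  linarith

theorem frob_rampKey_le {P : Matrix (Fin dₑ) (Fin dₑ) ℝ} (hP : ∑ k, P k ⬝ᵥ P k ≤ H)
    {s B : ℝ} (hB : 0 ≤ B) (h : H + s ^ 2 ≤ B ^ 2) : frob (rampKey d P s) ≤ B := by
  refine frob_queryRows_le hB (le_trans ?_ h)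
  simp only [channelVec_dotProduct, zero_dotProduct, mul_zero, add_zero, zero_add]
  nlinarith

theorem frob_rampQuery_le {P : Matrix (Fin dₑ) (Fin dₑ) ℝ} (hP : ∑ k, P k ⬝ᵥ P k ≤ H)
    {B : ℝ} (hB : 0 ≤ B) (h : (H : ℝ) + 1 ≤ B ^ 2) : frob (rampQuery d P) ≤ B := by
  refine frob_queryRows_le hB (le_trans ?_ h)
  simp only [channelVec_dotProduct, zero_dotProduct, mul_zero, add_zero, zero_add]
  linarith

end GPModel

/-! ### The kernel as a sum of hat functions, and the two kinds of blocks -/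

theorem abs_apply_le_of_dotProduct_le {n : Type*} [Fintype n] [DecidableEq n] {A : Matrix n n ℝ}
    (hA : A.PosSemidef) {u : ℝ} (h : ∀ x, x ⬝ᵥ A *ᵥ x ≤ u * (x ⬝ᵥ x)) (i j : n) : |A i j| ≤ u := by
  have hd : ∀ i j, Pi.single i (1 : ℝ) ⬝ᵥ A *ᵥ Pi.single j 1 = A i j := fun i j => by
    rw [mulVec_single_one, single_one_dotProduct]; rfl
  have h1 : ∀ i, A i i ≤ u := fun i => by
    have := h (Pi.single i 1)
    rw [hd] at this
    simpa using this
  have hs : A j i = A i j := by simpa using hA.1.apply i j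
  have h2 := hA.dotProduct_mulVec_nonneg (Pi.single i 1 + Pi.single j 1)
  have h3 := hA.dotProduct_mulVec_nonneg (Pi.single i 1 - Pi.single j 1)
  rw [star_trivial] at h2 h3
  simp only [mulVec_add, add_dotProduct, dotProduct_add, mulVec_sub, sub_dotProduct,
    dotProduct_sub, hd, hs] at h2 h3
  rw [abs_le]
  constructor <;> linarith [h1 i, h1 j]

/-- A second difference of ReLU is a hat supported on `[-δ, δ]`; it isolates one time gap from the
others. -/
theorem hat_eq_zero {y δ : ℝ} (hδ : 0 < δ) (h : δ ≤ |y|) :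
    max (y + δ) 0 - 2 * max y 0 + max (y - δ) 0 = 0 := by
  rcases le_total 0 y with hy | hy
  · rw [abs_of_nonneg hy] at h
    rw [max_eq_left (by linarith), max_eq_left hy, max_eq_left (by linarith)]
    ring
  · rw [abs_of_nonpos hy] at h
    rw [max_eq_right (by linarith), max_eq_right hy, max_eq_right (by linarith)]
    ring

namespace GPModel

open WorkChannel

variable {H d dₑ : ℕ} {G : GPModel H d dₑ} {r gap : ℝ}

/-- The shift, in units of the half gap, of each of the three ramps that form a hat function. -/
def rampShift : Fin 3 → ℝ := ![-1, 0, 1]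

/-- The weight of each of the three ramps that form a hat function. -/
def rampWeight : Fin 3 → ℝ := ![1, -2, 1]

/-- The pairs `(o, m)` represent every time gap once. Inner products of different gaps differ by at
least `gap/2`, so among the hats of half-width `gap/2` only the one for `|i - j|` is nonzero. Its
height is `gap/2`, which the weight `2/gap` normalizes. -/
theorem sum_ramp_eq_Γ (hG : G.KernelAssumption r) (hgap : 0 < gap)
    (hsep : ∀ i₁ j₁ i₂ j₂ : Fin H, timeGap i₁ j₁ ≠ timeGap i₂ j₂ →
      gap ≤ |‖G.emb i₁ - G.emb j₁‖ ^ 2 - ‖G.emb i₂ - G.emb j₂‖ ^ 2|)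
    {o : Fin H} (ho : (o : ℕ) = 0) (i j : Fin H) :
    ∑ p : Fin 3 × Fin H, 2 / gap * rampWeight p.1 * G.Γ o p.2 *
      max (inner ℝ (G.emb i) (G.emb j) -
        (inner ℝ (G.emb o) (G.emb p.2) + rampShift p.1 * (gap / 2))) 0 = G.Γ i j := by
  rw [Fintype.sum_prod_type_right]
  have hg : ∀ m : Fin H, timeGap o m = m := fun m => by simp [timeGap, ho]
  let m₀ : Fin H := ⟨timeGap i j, by simp only [timeGap]; omega⟩
  obtain ⟨f, hf, -⟩ := hG.dist_emb
  obtain ⟨g, hg'⟩ := hG.kernel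
  have hm₀ : ‖G.emb o - G.emb m₀‖ = ‖G.emb i - G.emb j‖ := by rw [hf, hf, hg]
  have hhat : ∀ m : Fin H, ∑ s : Fin 3, 2 / gap * rampWeight s * G.Γ o m *
      max (inner ℝ (G.emb i) (G.emb j) -
        (inner ℝ (G.emb o) (G.emb m) + rampShift s * (gap / 2))) 0 =
      2 / gap * G.Γ o m *
        (max (inner ℝ (G.emb i) (G.emb j) - inner ℝ (G.emb o) (G.emb m) + gap / 2) 0 -
          2 * max (inner ℝ (G.emb i) (G.emb j) - inner ℝ (G.emb o) (G.emb m)) 0 +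
          max (inner ℝ (G.emb i) (G.emb j) - inner ℝ (G.emb o) (G.emb m) - gap / 2) 0) := by
    intro m
    generalize inner ℝ (G.emb i) (G.emb j) = a
    generalize inner ℝ (G.emb o) (G.emb m) = b
    simp only [Fin.sum_univ_three, rampShift, rampWeight, cons_val_zero, cons_val_one, cons_val]
    have e1 : a - (b + -1 * (gap / 2)) = a - b + gap / 2 := by ring
    have e2 : a - (b + 0 * (gap / 2)) = a - b := by ring
    have e3 : a - (b + 1 * (gap / 2)) = a - b - gap / 2 := by ring
    rw [e1, e2, e3]
    ring
  simp_rw [hhat]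
  rw [Finset.sum_eq_single m₀]
  · rw [inner_emb hG.norm_emb, inner_emb hG.norm_emb, hm₀, sub_self, zero_add, zero_sub,
      max_eq_left (by positivity), max_self, max_eq_right (by linarith), hg' o m₀, hm₀, ← hg' i j]
    field_simp
    ring
  · intro m _ hm
    rw [hat_eq_zero (by positivity), mul_zero]
    rw [inner_emb hG.norm_emb, inner_emb hG.norm_emb]
    have h1 := hsep o m i j (by rw [hg]; exact fun h => hm (Fin.ext h))
    have e : r ^ 2 - ‖G.emb i - G.emb j‖ ^ 2 / 2 - (r ^ 2 - ‖G.emb o - G.emb m‖ ^ 2 / 2) =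
        (‖G.emb o - G.emb m‖ ^ 2 - ‖G.emb i - G.emb j‖ ^ 2) / 2 := by ring
    rw [e, abs_div, abs_of_pos (by norm_num : (0 : ℝ) < 2)]
    linarith
  · simp

/-- Compare the pair `(i, j)` with the pair `(i, i)`, whose distance is zero. -/
theorem gap_le_of_ne
    (hsep : ∀ i₁ j₁ i₂ j₂ : Fin H, timeGap i₁ j₁ ≠ timeGap i₂ j₂ →
      gap ≤ |‖G.emb i₁ - G.emb j₁‖ ^ 2 - ‖G.emb i₂ - G.emb j₂‖ ^ 2|)
    (i j : Fin H) (hij : i ≠ j) : gap ≤ ‖G.emb i - G.emb j‖ ^ 2 := by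
  have h := hsep i j i i (by
    simp only [timeGap]
    have : (i : ℕ) ≠ j := fun h => hij (Fin.ext h)
    omega)
  rwa [sub_self, norm_zero, zero_pow two_ne_zero, sub_zero, abs_of_nonneg (sq_nonneg _)] at h

theorem card_query_le : Fintype.card (Fin dₑ ⊕ Bool) ≤
    Fintype.card (Channel d dₑ (d + (dₑ + 1))) := by
  simp; omega

theorem alph_eq_dotProduct (I : Pattern H) (t : ℝ) :
    (![0, 1, 0, 0] : Fin 4 → ℝ) ⬝ᵥ G.timeEmb I t = alph t := by
  simp [timeEmb, dotProduct, Fin.sum_univ_four]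

theorem sigm_sq_eq_dotProduct (I : Pattern H) (t : ℝ) :
    (![0, 0, 1, 0] : Fin 4 → ℝ) ⬝ᵥ G.timeEmb I t = sigm t ^ 2 := by
  simp [timeEmb, dotProduct, Fin.sum_univ_four]

/-- One bound on `B` serves all the queries and keys: the three conclusions are tailored to
`diagQuery`, `diagKey` and `rampKey`, and `rampQuery` is smaller. -/
theorem weight_bound_sq {N B : ℝ} (hH : 2 ≤ H) (hN : 0 ≤ N)
    (hB : (N + 3) * (1 + r ^ 2) * Real.sqrt H ≤ B) :
    N ^ 2 * H + 2 ≤ B ^ 2 ∧ H + (N * r ^ 2 + 1) ^ 2 + 2 ≤ B ^ 2 ∧ H + (3 * r ^ 2) ^ 2 ≤ B ^ 2 := by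
  have hH' : (2 : ℝ) ≤ H := by exact_mod_cast hH
  have h1 : ((N + 3) * (1 + r ^ 2) * Real.sqrt H) ^ 2 ≤ B ^ 2 :=
    pow_le_pow_left₀ (by positivity) hB 2
  rw [mul_pow, Real.sq_sqrt (by linarith)] at h1
  have hr := sq_nonneg r
  have hNr := mul_nonneg hN hr
  have key : ∀ a b : ℝ, 0 ≤ a → a ≤ (N + 3) * (1 + r ^ 2) → b ≤ a ^ 2 → b * H ≤ B ^ 2 := by
    intro a b ha hab hb
    refine le_trans ?_ h1
    have := pow_le_pow_left₀ ha hab 2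
    exact mul_le_mul_of_nonneg_right (hb.trans this) (by linarith)
  refine ⟨?_, ?_, ?_⟩
  · have := key (N + 3) (N ^ 2 + 2) (by positivity) (by nlinarith) (by nlinarith)
    nlinarith
  · have := key (N * r ^ 2 + 3) ((N * r ^ 2 + 1) ^ 2 + 2) (by positivity) (by nlinarith)
      (by nlinarith)
    nlinarith [sq_nonneg (N * r ^ 2 + 1)]
  · have := key (1 + 3 * r ^ 2) ((3 * r ^ 2) ^ 2 + 1) (by positivity) (by nlinarith) (by nlinarith)
    nlinarith [sq_nonneg (3 * r ^ 2)]

/-- The block that stores the scaling factors and the scaled embeddings. -/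
theorem exists_init_block (hG : G.KernelAssumption r) (hH : 2 ≤ H) (hgap : 0 < gap)
    (hsep : ∀ i j, i ≠ j → gap ≤ ‖G.emb i - G.emb j‖ ^ 2) {B : ℝ}
    (hB : (2 / gap + 3) * (1 + r ^ 2) * Real.sqrt H ≤ B) :
    ∃ b : Block (Channel d dₑ (d + (dₑ + 1))) (4 * H), b.BoundedBy B ∧
      ∀ I v x t, 0 ≤ t →
        b.apply ((G.tokens I v x t 0 0 0).submatrix (equivChannel d dₑ).symm id) =
        (G.tokens I v x t 0 (fun i k => scaling I t i * G.emb i k)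
          (scaling I t)).submatrix (equivChannel d dₑ).symm id := by
  obtain ⟨P, hP, hPP⟩ := exists_projection_matrix G.emb
  have hB0 : 0 ≤ B := le_trans (by positivity) hB
  obtain ⟨hB1, hB2, hB3⟩ := weight_bound_sq hH (by positivity) hB
  have hH' : (2 : ℝ) ≤ H := by exact_mod_cast hH
  let E : Fin dₑ → WorkChannel d dₑ → ℝ := fun k => channelVec 0 (P k) 0 0 0 0 0 0
  let m' : WorkChannel d dₑ → ℝ := channelVec 0 0 0 ![1, 0, 0] 0 0 0 0
  have hone : (![1, 0, 0] : Fin 3 → ℝ) ⬝ᵥ ![1, 0, 0] = 1 := by simp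
  obtain ⟨b, hb, h⟩ := exists_block (J := Unit) (M := 4 * H) (equivChannel d dₑ) card_query_le
    (by simp; omega) hB0 (fun _ => write 0 E m') (fun _ => diagQuery d P (2 / gap) ![0, 1, 0, 0])
    (fun _ => diagKey d P (2 / gap) r 0 1)
    (fun _ => by
      refine frob_write_le hB0 ?_
      simp only [E, m', channelVec_dotProduct, hone, Pi.zero_apply, zero_dotProduct, mul_zero,
        add_zero, zero_add, Finset.sum_const_zero]
      nlinarith [sq_nonneg (2 / gap * r ^ 2 + 1)])
    (fun _ => frob_diagQuery_le hPP hB0 (by simp [dotProduct, Fin.sum_univ_four]) hB1)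
    (fun _ => frob_diagKey_le hPP hB0 (by nlinarith [show 0 ≤ 2 / gap * r ^ 2 by positivity]))
  refine ⟨b, hb, fun I v x t ht => ?_⟩
  -- The diagonal score matrix multiplies column `i` of the values by its scaling factor; the values
  -- are the embedding, reproduced by `P`, and the constant channel.
  rw [h, Finset.sum_congr rfl fun _ _ => by
    rw [relu_diag_score (c₀ := 0) (c₁ := 1) (φ := ![0, 1, 0, 0]) (μ := scaling I t) hP hgap
      hG.norm_emb hsep
      (fun j => by rw [alph_eq_dotProduct, zero_add, scaling])
      (fun j => by rw [scaling]; split; exacts [zero_le_one, (alph_pos t).le])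
      (fun j => by rw [scaling]; split; exacts [le_rfl, alph_le_one ht])]]
  congr 1
  have := tokens_add_sum_write (G := G) (I := I) (v := v) (x := x) (t := t) (J := Unit)
    (fun _ => 0) (fun _ => E) (fun _ => m') (fun _ => diagonal (scaling I t)) 0 0 0
  rw [this]
  congr 1
  · ext p; simp
  · ext q k
    simp only [E, token, channelVec_dotProduct, zero_dotProduct, zero_mul, add_zero, zero_add, hP,
      Pi.zero_apply, Finset.univ_unique, Finset.sum_singleton]
    simp [diagonal_apply, mul_comm]
  · ext q
    simp only [m', token, channelVec_dotProduct, zero_dotProduct, zero_mul, add_zero, zero_add,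
      Pi.zero_apply, Finset.univ_unique, Finset.sum_singleton]
    simp [diagonal_apply, flags]

end GPModel

namespace GPModel

open WorkChannel

variable {H d dₑ : ℕ} {G : GPModel H d dₑ} {r gap hi : ℝ}

/-- Two distinct embeddings on the sphere are at distance at most `2r`, so `gap ≤ 4r²` and every
shift is at most `2r²`, on top of an inner product of size at most `r²`. -/
theorem ramp_offset_sq_le (hr : ∀ i, ‖G.emb i‖ = r) (hH : 2 ≤ H) (hgap : 0 < gap)
    (hsep : ∀ i j, i ≠ j → gap ≤ ‖G.emb i - G.emb j‖ ^ 2) (o m : Fin H) (s : Fin 3) :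
    (inner ℝ (G.emb o) (G.emb m) + rampShift s * (gap / 2)) ^ 2 ≤ (3 * r ^ 2) ^ 2 := by
  have h1 : |inner ℝ (G.emb o) (G.emb m)| ≤ r ^ 2 := by
    have := abs_real_inner_le_norm (G.emb o) (G.emb m)
    rwa [hr, hr, ← sq] at this
  have h2 : gap / 2 ≤ 2 * r ^ 2 := by
    have a1 := hsep ⟨0, by omega⟩ ⟨1, by omega⟩ (by simp)
    have a2 := norm_sub_le (G.emb ⟨0, by omega⟩) (G.emb ⟨1, by omega⟩)
    rw [hr, hr] at a2
    have a3 := pow_le_pow_left₀ (norm_nonneg _) a2 2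
    linarith
  have h3 : |rampShift s * (gap / 2)| ≤ 2 * r ^ 2 := by
    rw [abs_mul, abs_of_pos (by positivity : 0 < gap / 2)]
    have : |rampShift s| ≤ 1 := by fin_cases s <;> simp [rampShift]
    nlinarith
  refine sq_le_sq' ?_ ?_
  · linarith [neg_abs_le (inner ℝ (G.emb o) (G.emb m)), neg_abs_le (rampShift s * (gap / 2))]
  · linarith [le_abs_self (inner ℝ (G.emb o) (G.emb m)), le_abs_self (rampShift s * (gap / 2))]

/-- A block that performs one step of gradient descent on the iterate stored in the buffer. -/
theorem exists_iteration_block (hG : G.KernelAssumption r) (hH : 2 ≤ H) (hgap : 0 < gap)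
    (hsep : ∀ i₁ j₁ i₂ j₂ : Fin H, timeGap i₁ j₁ ≠ timeGap i₂ j₂ →
      gap ≤ |‖G.emb i₁ - G.emb j₁‖ ^ 2 - ‖G.emb i₂ - G.emb j₂‖ ^ 2|)
    (hΓ : ∀ i j, |G.Γ i j| ≤ 2 * hi) (hΛ : ∀ k l, |G.Λ k l| ≤ hi) {h : ℝ} (h0 : 0 ≤ h) (h1 : h ≤ 1)
    {B : ℝ} (hB : (2 / gap + 3) * (1 + r ^ 2) * Real.sqrt H ≤ B)
    (hB' : (8 * hi / gap * hi + 1) * d ≤ B) :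
    ∃ b : Block (Channel d dₑ (d + (dₑ + 1))) (4 * H), b.BoundedBy B ∧
      ∀ I v x t z, 0 ≤ t →
        b.apply ((G.tokens I v x t z (fun i k => scaling I t i * G.emb i k)
          (scaling I t)).submatrix (equivChannel d dₑ).symm id) =
        (G.tokens I v x t (z - h • ((G.frame I v x t).ofLp + G.diffCov I t *ᵥ z))
          (fun i k => scaling I t i * G.emb i k)
          (scaling I t)).submatrix (equivChannel d dₑ).symm id := by
  obtain ⟨P, hP, hPP⟩ := exists_projection_matrix G.emb
  have hsep' := gap_le_of_ne hsep
  have hB0 : 0 ≤ B := le_trans (by positivity) hB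
  obtain ⟨hB1, hB2, hB3⟩ := weight_bound_sq hH (by positivity) hB
  have hH' : (2 : ℝ) ≤ H := by exact_mod_cast hH
  have hr2 : 0 ≤ 2 / gap * r ^ 2 := by positivity
  let o : Fin H := ⟨0, by omega⟩
  have hhi : 0 ≤ hi := by linarith [abs_nonneg (G.Γ o o), hΓ o o]
  have hdB : (8 * hi / gap * hi) ^ 2 * (d : ℝ) ^ 2 ≤ B ^ 2 ∧ (d : ℝ) ^ 2 ≤ B ^ 2 := by
    have a1 : 0 ≤ 8 * hi / gap * hi := by positivity
    have a2 : (0 : ℝ) ≤ d := Nat.cast_nonneg d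
    rw [← mul_pow]
    constructor <;> refine pow_le_pow_left₀ (by positivity) (le_trans ?_ hB') 2 <;> nlinarith
  -- The descent step, the hat weight and the kernel value are all absorbed into the value matrix.
  -- The bound `8 hi/gap` below is `(2/gap) * 2 * (2 hi)`.
  let a : Fin 3 × Fin H → ℝ := fun p => -(h * (2 / gap * rampWeight p.1 * G.Γ o p.2))
  have ha : ∀ p, a p ^ 2 ≤ (8 * hi / gap) ^ 2 := by
    intro p
    have b1 : |rampWeight p.1| ≤ 2 := by
      generalize p.1 = s
      fin_cases s <;> simp [rampWeight]
    have b2 := hΓ o p.2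
    rw [← sq_abs (a p)]
    refine pow_le_pow_left₀ (abs_nonneg _) ?_ 2
    simp only [a, abs_neg, abs_mul, abs_of_nonneg h0, abs_of_pos (by positivity : 0 < 2 / gap)]
    calc h * (2 / gap * |rampWeight p.1| * |G.Γ o p.2|) ≤ 1 * (2 / gap * 2 * (2 * hi)) := by
          gcongr
      _ = 8 * hi / gap := by ring
  -- The ramp heads apply `Λ` to the iterate while their scores supply `Γ`; the head `false`
  -- subtracts the frame through the identity, and the head `true` subtracts the noise term through
  -- `diag(noiseVar)`.
  let Z : (Fin 3 × Fin H) ⊕ Bool → Fin d → WorkChannel d dₑ → ℝ :=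
    Sum.elim (fun p k => channelVec 0 0 0 0 0 (a p • G.Λ k) 0 0)
      (fun b k => bif b then channelVec 0 0 0 0 0 (Pi.single k (-h)) 0 0
        else channelVec (Pi.single k (-h)) 0 0 0 0 0 0 0)
  let Q : (Fin 3 × Fin H) ⊕ Bool → Matrix (Fin dₑ ⊕ Bool) (WorkChannel d dₑ) ℝ :=
    Sum.elim (fun _ => rampQuery d P)
      (fun b => diagQuery d P (2 / gap) (bif b then ![0, 0, 1, 0] else 0))
  let K : (Fin 3 × Fin H) ⊕ Bool → Matrix (Fin dₑ ⊕ Bool) (WorkChannel d dₑ) ℝ :=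
    Sum.elim
      (fun p => rampKey d P (inner ℝ (G.emb o) (G.emb p.2) + rampShift p.1 * (gap / 2)))
      (fun b => diagKey d P (2 / gap) r (bif b then 0 else 1) 0)
  have hZ : ∀ j, ∑ k, Z j k ⬝ᵥ Z j k ≤ B ^ 2 := by
    rintro (p | b)
    · simp only [Z, Sum.elim_inl, channelVec_dotProduct, zero_dotProduct, mul_zero, add_zero,
        zero_add, smul_dotProduct, dotProduct_smul, smul_eq_mul]
      have b1 : ∀ k, G.Λ k ⬝ᵥ G.Λ k ≤ d * hi ^ 2 := by
        intro k
        calc G.Λ k ⬝ᵥ G.Λ k ≤ ∑ _l : Fin d, hi ^ 2 := by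
              refine Finset.sum_le_sum fun l _ => ?_
              rw [← sq, ← sq_abs]
              exact pow_le_pow_left₀ (abs_nonneg _) (hΛ k l) 2
          _ = d * hi ^ 2 := by simp
      calc ∑ k, a p * (a p * (G.Λ k ⬝ᵥ G.Λ k)) ≤ ∑ _k : Fin d, (8 * hi / gap) ^ 2 * (d * hi ^ 2) := by
            refine Finset.sum_le_sum fun k _ => ?_
            rw [← mul_assoc, ← sq]
            exact mul_le_mul (ha p) (b1 k) (dotProduct_self_nonneg_real _) (sq_nonneg _)
        _ = (8 * hi / gap * hi) ^ 2 * (d : ℝ) ^ 2 := by simp; ring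
        _ ≤ B ^ 2 := hdB.1
    · have b1 : ∑ k : Fin d, (Pi.single k (-h) : Fin d → ℝ) ⬝ᵥ Pi.single k (-h) ≤ B ^ 2 := by
        simp only [dotProduct_single, Pi.single_eq_same, Finset.sum_const, Finset.card_univ,
          Fintype.card_fin, nsmul_eq_mul]
        refine le_trans ?_ hdB.2
        have b2 : -h * -h ≤ 1 := by nlinarith
        have b3 : (d : ℝ) ≤ (d : ℝ) ^ 2 := by
          exact_mod_cast Nat.le_self_pow two_ne_zero d
        have b4 : (0 : ℝ) ≤ d := Nat.cast_nonneg d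
        nlinarith
      cases b <;> simpa only [Z, Sum.elim_inr, cond_true, cond_false, channelVec_dotProduct,
        zero_dotProduct, mul_zero, add_zero, zero_add] using b1
  -- The head count is `3H + 2`, at most `4H` because `H ≥ 2`.
  obtain ⟨b, hb, hbb⟩ := exists_block (J := (Fin 3 × Fin H) ⊕ Bool) (M := 4 * H)
    (equivChannel d dₑ) card_query_le (by simp; omega) hB0 (fun j => write (Z j) 0 0) Q K
    (fun j => frob_write_le hB0 (by simpa using hZ j))
    (by
      rintro (p | b)
      · exact frob_rampQuery_le hPP hB0 (by nlinarith [sq_nonneg (2 / gap * r ^ 2 + 1)])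
      · refine frob_diagQuery_le hPP hB0 ?_ hB1
        cases b <;> simp [dotProduct, Fin.sum_univ_four])
    (by
      rintro (p | b)
      · refine frob_rampKey_le hPP hB0 (le_trans ?_ hB3)
        linarith [ramp_offset_sq_le hG.norm_emb hH hgap hsep' o p.2 p.1]
      · refine frob_diagKey_le hPP hB0 (le_trans ?_ hB2)
        cases b <;> simp only [cond_true, cond_false] <;> nlinarith)
  refine ⟨b, hb, fun I v x t z ht => ?_⟩
  have hm0 : ∀ i, 0 ≤ scaling I t i := fun i => by
    rw [scaling]; split
    exacts [zero_le_one, (alph_pos t).le]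
  set e' : Fin H → Fin dₑ → ℝ := fun i k => scaling I t i * G.emb i k with he'
  let R : (Fin 3 × Fin H) ⊕ Bool → Matrix (Fin H) (Fin H) ℝ := Sum.elim
    (fun p => Matrix.of fun i j => scaling I t i * scaling I t j *
      max (inner ℝ (G.emb i) (G.emb j) -
        (inner ℝ (G.emb o) (G.emb p.2) + rampShift p.1 * (gap / 2))) 0)
    (fun b => bif b then diagonal (noiseVar I t) else 1)
  have hR : ∀ j, Block.relu ((Q j * G.tokens I v x t z e' (scaling I t))ᵀ *
      (K j * G.tokens I v x t z e' (scaling I t))) = R j := by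
    have hs1 : sigm t ^ 2 ≤ 1 := pow_le_one₀ (Real.sqrt_nonneg _) (sigm_le_one t)
    rintro (p | (_ | _))
    · ext i j
      exact relu_ramp_score hP hm0 _ z i j
    · refine (relu_diag_score (c₀ := 1) (c₁ := 0) (φ := 0) (μ := 1) hP hgap hG.norm_emb hsep'
        (fun j => by simp) (fun j => zero_le_one) (fun j => le_rfl) z e' (scaling I t)).trans ?_
      exact diagonal_one
    · exact relu_diag_score (c₀ := 0) (c₁ := 0) (φ := ![0, 0, 1, 0]) (μ := noiseVar I t) hP hgap
        hG.norm_emb hsep' (fun j => by rw [sigm_sq_eq_dotProduct, zero_add, noiseVar])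
        (fun j => by rw [noiseVar]; split; exacts [le_rfl, sq_nonneg _])
        (fun j => by rw [noiseVar]; split; exacts [zero_le_one, hs1]) z e' (scaling I t)
  rw [hbb]
  simp_rw [hR]
  congr 1
  refine (tokens_add_sum_write Z 0 0 R z e' (scaling I t)).trans ?_
  congr 1
  · ext ⟨q, k⟩
    have hramp : ∑ p : Fin 3 × Fin H, ∑ i, (Z (Sum.inl p) k ⬝ᵥ
        G.token I v x t z e' (scaling I t) i) * R (Sum.inl p) i q =
        -h * (scaling I t q * (G.cov *ᵥ fun p => scaling I t p.1 * z p) (q, k)) := by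
      rw [Finset.sum_comm]
      have c1 : ∀ i, ∑ p : Fin 3 × Fin H, (Z (Sum.inl p) k ⬝ᵥ
          G.token I v x t z e' (scaling I t) i) * R (Sum.inl p) i q =
          -h * (scaling I t i * scaling I t q * (G.Λ k ⬝ᵥ fun l => z (i, l)) * G.Γ q i) := by
        intro i
        have hsymm : G.Γ q i = G.Γ i q := by simpa using hG.posDef_Γ.1.apply i q
        rw [hsymm, ← sum_ramp_eq_Γ hG hgap hsep (o := o) rfl i q, Finset.mul_sum, Finset.mul_sum]
        refine Finset.sum_congr rfl fun p _ => ?_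
        simp only [Z, R, a, Sum.elim_inl, token, channelVec_dotProduct, zero_dotProduct, zero_mul,
          add_zero, zero_add, smul_dotProduct, smul_eq_mul, of_apply]
        ring
      simp_rw [c1]
      rw [← Finset.mul_sum]
      congr 1
      simp only [mulVec, dotProduct, Fintype.sum_prod_type, cov, kroneckerMap_apply,
        Finset.mul_sum, Finset.sum_mul]
      exact Finset.sum_congr rfl fun i _ => Finset.sum_congr rfl fun l _ => by ring
    have hy : ∑ i, (Z (Sum.inr false) k ⬝ᵥ G.token I v x t z e' (scaling I t) i) *
        R (Sum.inr false) i q = -h * G.frame I v x t (q, k) := by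
      simp only [Z, R, Sum.elim_inr, cond_false, token, channelVec_dotProduct, zero_dotProduct,
        zero_mul, add_zero, single_dotProduct, one_apply]
      simp
    have hn : ∑ i, (Z (Sum.inr true) k ⬝ᵥ G.token I v x t z e' (scaling I t) i) *
        R (Sum.inr true) i q = -h * (noiseVar I t q * z (q, k)) := by
      simp only [Z, R, Sum.elim_inr, cond_true, token, channelVec_dotProduct, zero_dotProduct,
        zero_mul, add_zero, zero_add, single_dotProduct, diagonal_apply]
      simp
      ring
    rw [Fintype.sum_sum_type, Fintype.sum_bool, hramp, hy, hn, Pi.sub_apply, Pi.smul_apply,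
      Pi.add_apply, diffCov_mulVec, smul_eq_mul]
    ring
  · ext q k; simp
  · ext q; simp

end GPModel

/-! ### Truncation and elementary estimates -/

theorem norm_clip_le {E : Type*} [NormedAddCommGroup E] [NormedSpace ℝ E] {R : ℝ} (hR : 0 ≤ R)
    (s : E) : ‖clip R s‖ ≤ R := by
  rw [clip]
  split_ifs with h
  · exact h
  · have hs : 0 < ‖s‖ := hR.trans_lt (not_le.1 h)
    rw [norm_smul, Real.norm_eq_abs, abs_of_nonneg (by positivity), div_mul_cancel₀ _ hs.ne']

/-- When `s` lies outside the ball, truncation moves it by `‖s‖ - R ≤ ‖s‖ - ‖y‖ ≤ ‖s - y‖`; the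
triangle inequality gives the factor `2`. -/
theorem norm_clip_sub_le {E : Type*} [NormedAddCommGroup E] [NormedSpace ℝ E] {R : ℝ} {s y : E}
    (hy : ‖y‖ ≤ R) : ‖clip R s - y‖ ≤ 2 * ‖s - y‖ := by
  have hR := (norm_nonneg y).trans hy
  have h1 : ‖clip R s - s‖ ≤ ‖s - y‖ := by
    rw [clip]
    split_ifs with h
    · simp
    · have hs : 0 < ‖s‖ := hR.trans_lt (not_le.1 h)
      have e : (R / ‖s‖) • s - s = (R / ‖s‖ - 1) • s := by rw [sub_smul, one_smul]
      have h2 : R / ‖s‖ - 1 ≤ 0 := by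
        rw [sub_nonpos, div_le_one hs]; exact (not_le.1 h).le
      rw [e, norm_smul, Real.norm_eq_abs, abs_of_nonpos h2]
      have h3 : -(R / ‖s‖ - 1) * ‖s‖ = ‖s‖ - R := by field_simp; ring
      rw [h3]
      linarith [norm_sub_norm_le s y]
  have h2 : clip R s - y = (clip R s - s) + (s - y) := by abel
  rw [h2]
  linarith [norm_add_le (clip R s - s) (s - y)]

/-- The inequality `1 - q ≤ exp(-q)` turns the contraction into `exp(-q k) ≤ Y⁻¹`. -/
theorem one_sub_pow_mul_le {q S E Y : ℝ} (hq : q ≤ 1) (hE : 0 ≤ E) (hY : 0 < Y)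
    (hS : S ≤ Y * E) {k : ℕ} (hk : Real.log Y ≤ q * k) : (1 - q) ^ k * S ≤ E := by
  have h1 : (1 - q) ^ k ≤ Real.exp (-(q * k)) := by
    have := pow_le_pow_left₀ (sub_nonneg.2 hq) (Real.one_sub_le_exp_neg q) k
    rwa [← Real.exp_nat_mul, mul_comm, neg_mul] at this
  have h2 : Real.exp (-(q * k)) ≤ Y⁻¹ := by
    rw [Real.exp_neg]
    refine inv_anti₀ hY ?_
    rwa [← Real.log_le_iff_le_exp hY]
  calc (1 - q) ^ k * S ≤ (1 - q) ^ k * (Y * E) :=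
        mul_le_mul_of_nonneg_left hS (pow_nonneg (sub_nonneg.2 hq) _)
    _ ≤ Y⁻¹ * (Y * E) := mul_le_mul_of_nonneg_right (h1.trans h2) (by positivity)
    _ = E := by field_simp

theorem dotProduct_sq_le {ι : Type*} [Fintype ι] (x y : ι → ℝ) :
    (x ⬝ᵥ y) ^ 2 ≤ (x ⬝ᵥ x) * (y ⬝ᵥ y) := by
  have := Finset.sum_mul_sq_le_sq_mul_sq Finset.univ x y
  simp only [sq (x _), sq (y _)] at this
  exact this

/-- Solutions of a linear system with a coercive matrix are controlled by the right-hand side. -/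
theorem sq_mul_dotProduct_self_le {ι : Type*} [Fintype ι] {l : ℝ} (hl : 0 ≤ l) {s y : ι → ℝ}
    (h : l * (s ⬝ᵥ s) ≤ s ⬝ᵥ y) : l ^ 2 * (s ⬝ᵥ s) ≤ y ⬝ᵥ y := by
  have h1 := dotProduct_sq_le s y
  have hs := dotProduct_self_nonneg_real s
  have hy := dotProduct_self_nonneg_real y
  obtain hs0 | hs0 := hs.eq_or_lt
  · rw [← hs0]; simpa using hy
  · have h2 := pow_le_pow_left₀ (mul_nonneg hl hs) h 2
    have h3 : (l ^ 2 * (s ⬝ᵥ s)) * (s ⬝ᵥ s) ≤ (y ⬝ᵥ y) * (s ⬝ᵥ s) := by nlinarith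
    exact le_of_mul_le_mul_right h3 hs0

/-! ### Size of the score and error of gradient descent -/

namespace GPModel

open WorkChannel

variable {H d dₑ : ℕ} {G : GPModel H d dₑ} {r lo u t : ℝ} {I : Pattern H}

/-- The solution of the linear system stays bounded by the inverse noise level on the missing
frames. -/
theorem sigm_sq_mul_le_of_diffCov_mulVec (hG : G.KernelAssumption r) (ht : 0 < t)
    (hu : 0 < u) (hcov : ∀ x, x ⬝ᵥ G.cov *ᵥ x ≤ u * (x ⬝ᵥ x)) {l : ℝ} (hl : 0 < l)
    (hobs : ∀ x : Fin H × Fin d → ℝ, (∀ p, p.1 ∉ I.1 → x p = 0) → l * (x ⬝ᵥ x) ≤ x ⬝ᵥ G.cov *ᵥ x)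
    {a : ObsIdx d I → ℝ} {b : MissIdx d I → ℝ} {x : ObsIdx d I → ℝ} {y : MissIdx d I → ℝ}
    (hz : G.diffCov I t *ᵥ join I x y = join I a b) {A : ℝ} (hA : 0 ≤ A) (ha : a ⬝ᵥ a ≤ A ^ 2)
    (hb : b ⬝ᵥ b ≤ A ^ 2) : y ⬝ᵥ y ≤ ((sigm t ^ 2)⁻¹ * (1 + u / l) * A) ^ 2 := by
  have hs := sigm_pos ht
  have hnn : ∀ x, 0 ≤ x ⬝ᵥ G.cov *ᵥ x := fun x => by
    simpa using hG.posDef_cov.posSemidef.dotProduct_mulVec_nonneg x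
  -- The vector `(w, 0)` solves the observed equations exactly. Subtracting it leaves a right-hand
  -- side supported on the missing frames.
  set w := (G.covObs I)⁻¹ *ᵥ a with hw
  have hwa : G.covObs I *ᵥ w = a := by
    rw [hw, mulVec_mulVec, mul_nonsing_inv _
      ((isUnit_iff_isUnit_det _).1 (G.posDef_covObs hG I).isUnit), one_mulVec]
  have hww : l ^ 2 * (w ⬝ᵥ w) ≤ a ⬝ᵥ a := by
    refine sq_mul_dotProduct_self_le hl.le ?_
    have := hobs (join I w 0) (fun p hp => by simp [join, hp])
    rwa [join_dotProduct, dotProduct_covObs, hwa, zero_dotProduct, add_zero] at this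
  set f : MissIdx d I → ℝ := fun p => (G.cov *ᵥ join I w 0) (p.1.1, p.2) with hf
  have hfa : G.cov *ᵥ join I w 0 = join I a f := by
    rw [exists_eq_join I (G.cov *ᵥ join I w 0)]
    congr 1
    ext p
    rw [← hwa]
    simp [mulVec, dotProduct, sum_split I, covObs]
  have hff : f ⬝ᵥ f ≤ u ^ 2 * (w ⬝ᵥ w) := by
    have := mulVec_dotProduct_mulVec_le_sq hG.posDef_cov.1 hu hnn hcov (join I w 0)
    rw [hfa, join_dotProduct, join_dotProduct, zero_dotProduct, add_zero] at this
    linarith [dotProduct_self_nonneg_real a]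
  have hM : G.diffCov I t *ᵥ join I w 0 = join I a (alph t • f) := by
    rw [diffCov_mulVec, scaling_mul_join, smul_zero, hfa]
    ext p
    by_cases h : p.1 ∈ I.1 <;> simp [join, scaling, noiseVar, h]
  have hsub : join I x y - join I w 0 = join I (x - w) y := by
    ext p; by_cases h : p.1 ∈ I.1 <;> simp [join, h]
  have hsub2 : join I a b - join I a (alph t • f) = join I 0 (b - alph t • f) := by
    ext p; by_cases h : p.1 ∈ I.1 <;> simp [join, h]
  -- Testing the reduced system with its own solution and dropping the nonnegative covariance energy
  -- leaves the noise term, which controls `y`.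
  have hen : sigm t ^ 2 * (y ⬝ᵥ y) ≤ y ⬝ᵥ (b - alph t • f) := by
    have h1 := diffCov_dotProduct_join (G := G) (I := I) (t := t) (x - w) y
    rw [← hsub, mulVec_sub, hz, hM, hsub2, hsub, join_dotProduct, dotProduct_zero, zero_add] at h1
    linarith [hnn (join I (x - w) (alph t • y))]
  have h2 := sq_mul_dotProduct_self_le (by positivity) hen
  have hf2 : f ⬝ᵥ f ≤ (u / l * A) ^ 2 := by
    refine hff.trans ?_
    have : w ⬝ᵥ w ≤ A ^ 2 / l ^ 2 := by
      rw [le_div_iff₀ (by positivity)]; linarith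
    calc u ^ 2 * (w ⬝ᵥ w) ≤ u ^ 2 * (A ^ 2 / l ^ 2) := by gcongr
      _ = (u / l * A) ^ 2 := by field_simp
  have hbf : (b - alph t • f) ⬝ᵥ (b - alph t • f) ≤ ((1 + u / l) * A) ^ 2 := by
    have hα0 := alph_pos t
    have hα1 := alph_le_one ht.le
    have e1 : ‖WithLp.toLp 2 b‖ ≤ A := by
      refine le_of_sq_le_sq ?_ hA
      rw [norm_sq_eq_dotProduct]; exact hb
    have e2 : ‖WithLp.toLp 2 f‖ ≤ u / l * A := by
      refine le_of_sq_le_sq ?_ (by positivity)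
      rw [norm_sq_eq_dotProduct]; exact hf2
    have e3 : ‖WithLp.toLp 2 b - alph t • WithLp.toLp 2 f‖ ≤ (1 + u / l) * A := by
      refine (norm_sub_le _ _).trans ?_
      rw [norm_smul, Real.norm_eq_abs, abs_of_pos hα0]
      nlinarith [norm_nonneg (WithLp.toLp 2 f)]
    have e4 := pow_le_pow_left₀ (norm_nonneg _) e3 2
    rw [norm_sq_eq_dotProduct] at e4
    exact e4
  have h3 := h2.trans hbf
  have e : ((sigm t ^ 2)⁻¹ * (1 + u / l) * A) ^ 2 =
      ((1 + u / l) * A) ^ 2 / (sigm t ^ 2) ^ 2 := by field_simp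
  rw [e, le_div_iff₀ (by positivity)]
  linarith

theorem run_replicate (b : Block (Channel d dₑ (d + (dₑ + 1))) (4 * H)) (h : ℝ)
    (v : EuclideanSpace ℝ (MissIdx d I)) (x : EuclideanSpace ℝ (ObsIdx d I))
    {e' : Fin H → Fin dₑ → ℝ} {m : Fin H → ℝ}
    (hb : ∀ z, b.apply ((G.tokens I v x t z e' m).submatrix (equivChannel d dₑ).symm id) =
        (G.tokens I v x t (z - h • ((G.frame I v x t).ofLp + G.diffCov I t *ᵥ z)) e' m).submatrix
          (equivChannel d dₑ).symm id) (k : ℕ) (z : Fin H × Fin d → ℝ) :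
    Block.run (List.replicate k b)
        ((G.tokens I v x t z e' m).submatrix (equivChannel d dₑ).symm id) =
      (G.tokens I v x t ((fun z => z - h • ((G.frame I v x t).ofLp + G.diffCov I t *ᵥ z))^[k] z)
        e' m).submatrix (equivChannel d dₑ).symm id := by
  induction k generalizing z with
  | zero => rfl
  | succ k ih =>
    have : Block.run (List.replicate (k + 1) b)
        ((G.tokens I v x t z e' m).submatrix (equivChannel d dₑ).symm id) =
        Block.run (List.replicate k b)
          (b.apply ((G.tokens I v x t z e' m).submatrix (equivChannel d dₑ).symm id)) := rfl
    rw [this, hb, ih, Function.iterate_succ_apply]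

theorem frame_dotProduct_le {v : EuclideanSpace ℝ (MissIdx d I)}
    {x : EuclideanSpace ℝ (ObsIdx d I)} {A : ℝ} (hx : ‖x - G.meanObs I‖ ≤ A)
    (hv : ‖v - alph t • G.meanMiss I‖ ≤ A) :
    (G.frame I v x t).ofLp ⬝ᵥ (G.frame I v x t).ofLp ≤ 2 * A ^ 2 := by
  rw [frame_ofLp, join_dotProduct, ← norm_sq_eq_dotProduct, ← norm_sq_eq_dotProduct]
  have h1 := pow_le_pow_left₀ (norm_nonneg _) hx 2
  have h2 := pow_le_pow_left₀ (norm_nonneg _) hv 2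
  linarith

theorem diffCov_mulVec_inv (hG : G.KernelAssumption r) (ht : 0 < t) (w : Fin H × Fin d → ℝ) :
    G.diffCov I t *ᵥ ((G.diffCov I t)⁻¹ *ᵥ w) = w := by
  rw [mulVec_mulVec, mul_nonsing_inv _
    ((isUnit_iff_isUnit_det _).1 (posDef_diffCov hG ht).isUnit), one_mulVec]

/-- The coercivity of the full covariance would bring in `κ_cond`; the energy estimate uses
coercivity on the observed frames only, at the price of `σ_t⁻²`. -/
theorem norm_score_le (hG : G.KernelAssumption r) (hd : 1 ≤ d) (ht : 0 < t)
    (hu : 0 < u) (hcov : ∀ x, x ⬝ᵥ G.cov *ᵥ x ≤ u * (x ⬝ᵥ x)) {l : ℝ} (hl : 0 < l)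
    (hobs : ∀ x : Fin H × Fin d → ℝ, (∀ p, p.1 ∉ I.1 → x p = 0) → l * (x ⬝ᵥ x) ≤ x ⬝ᵥ G.cov *ᵥ x)
    {v : EuclideanSpace ℝ (MissIdx d I)} {x : EuclideanSpace ℝ (ObsIdx d I)} {A : ℝ}
    (hx : ‖x - G.meanObs I‖ ≤ A) (hv : ‖v - alph t • G.meanMiss I‖ ≤ A) :
    ‖G.score I v x t‖ ≤ (sigm t ^ 2)⁻¹ * (1 + u / l) * A := by
  have hA : 0 ≤ A := (norm_nonneg _).trans hx
  have hs := sigm_pos ht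
  have hz := diffCov_mulVec_inv (I := I) hG ht (G.frame I v x t).ofLp
  rw [exists_eq_join I ((G.diffCov I t)⁻¹ *ᵥ (G.frame I v x t).ofLp)] at hz
  nth_rewrite 3 [frame_ofLp] at hz
  have h1 := sigm_sq_mul_le_of_diffCov_mulVec hG ht hu hcov hl hobs hz hA
    (by rw [← norm_sq_eq_dotProduct]; exact pow_le_pow_left₀ (norm_nonneg _) hx 2)
    (by rw [← norm_sq_eq_dotProduct]; exact pow_le_pow_left₀ (norm_nonneg _) hv 2)
  refine le_of_sq_le_sq ?_ (by positivity)
  rw [score_eq hG hd ht, norm_sq_eq_dotProduct]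
  refine le_trans (le_of_eq ?_) h1
  simp [dotProduct]

/-- Gradient descent approximates the score. -/
theorem norm_iterate_sub_score_le (hG : G.KernelAssumption r) (hd : 1 ≤ d) (ht : 0 < t)
    (hu : 0 ≤ u) (hcov : ∀ x, x ⬝ᵥ G.cov *ᵥ x ≤ u * (x ⬝ᵥ x)) {l : ℝ} (hl : 0 < l) (hl1 : l ≤ 1)
    (hlow : ∀ x, l * (x ⬝ᵥ x) ≤ x ⬝ᵥ G.cov *ᵥ x)
    {v : EuclideanSpace ℝ (MissIdx d I)} {x : EuclideanSpace ℝ (ObsIdx d I)} {A : ℝ}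
    (hx : ‖x - G.meanObs I‖ ≤ A) (hv : ‖v - alph t • G.meanMiss I‖ ≤ A) {δ Y : ℝ} (hδ : 0 ≤ δ)
    (hY : 0 < Y) (hAY : 2 * A ^ 2 / l ^ 2 ≤ Y * δ ^ 2) {k : ℕ}
    (hk : Real.log Y ≤ (u + 1)⁻¹ * l * k) :
    ‖WithLp.toLp 2 (fun q : MissIdx d I =>
        (fun z => z - (u + 1)⁻¹ • ((G.frame I v x t).ofLp + G.diffCov I t *ᵥ z))^[k] 0 (q.1.1, q.2)) -
      G.score I v x t‖ ≤ δ := by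
  set w := (G.frame I v x t).ofLp with hw
  set s : Fin H × Fin d → ℝ := -((G.diffCov I t)⁻¹ *ᵥ w) with hs
  have hMs : G.diffCov I t *ᵥ s = -w := by
    rw [hs, mulVec_neg, diffCov_mulVec_inv hG ht]
  have hh : 0 < (u + 1)⁻¹ := by positivity
  have hh1 : (u + 1)⁻¹ ≤ 1 := inv_le_one_of_one_le₀ (by linarith)
  have hMlow := le_dotProduct_diffCov (I := I) ht.le hlow hl1
  have hMup := dotProduct_diffCov_le (I := I) ht.le hu hcov
  have hq : (u + 1)⁻¹ * l ≤ 1 := mul_le_one₀ hh1 hl.le hl1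
  have hit := iterate_richardson_sub (isHermitian_diffCov hG) hMlow hl.le hh.le hq
    (fun z => by rw [inv_mul_le_iff₀ (by positivity)]; exact hMup z) w s hMs k
  -- Coercivity bounds the initial error by `‖w‖²/l²`, and `‖w‖² ≤ 2A²` since both parts of the
  -- frame are at most `A`.
  have hss : s ⬝ᵥ s ≤ Y * δ ^ 2 := by
    have h1 := sq_mul_dotProduct_self_le hl.le (hMlow s)
    rw [hMs, neg_dotProduct_neg w w] at h1
    refine le_trans ?_ hAY
    rw [le_div_iff₀ (by positivity)]
    linarith [frame_dotProduct_le hx hv]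
  have hfin := hit.trans (one_sub_pow_mul_le hq (sq_nonneg δ) hY hss hk)
  refine le_of_sq_le_sq ?_ hδ
  refine le_trans ?_ hfin
  rw [score_eq hG hd ht, norm_sq_eq_dotProduct]
  generalize (fun z => z - (u + 1)⁻¹ • (w + G.diffCov I t *ᵥ z))^[k] 0 = z
  have e : (z - s) ⬝ᵥ (z - s) = ∑ p, (z - s) p * (z - s) p := rfl
  rw [e, sum_split I]
  refine le_add_of_nonneg_of_le (Finset.sum_nonneg fun _ _ => mul_self_nonneg _) (le_of_eq ?_)
  simp [dotProduct, hs, hw]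

end GPModel

/-- The channels of the buffer of frames. -/
def WorkChannel.outChannel (d dₑ : ℕ) : Fin d ↪ Channel d dₑ (d + (dₑ + 1)) where
  toFun k := WorkChannel.equivChannel d dₑ (.inr (.inr (.inr (.inr (.inr (.inl k))))))
  inj' k k' h := by simpa using (WorkChannel.equivChannel d dₑ).injective h

namespace GPModel

open WorkChannel

variable {H d dₑ : ℕ} {G : GPModel H d dₑ} {r : ℝ}

theorem decode_tokens {t : ℝ} {I : Pattern H} (R : ℝ)
    {v : EuclideanSpace ℝ (MissIdx d I)} {x : EuclideanSpace ℝ (ObsIdx d I)}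
    (z : Fin H × Fin d → ℝ) (e' : Fin H → Fin dₑ → ℝ) (m : Fin H → ℝ) :
    decode (outChannel d dₑ) R I ((G.tokens I v x t z e' m).submatrix (equivChannel d dₑ).symm id) =
      clip R (WithLp.toLp 2 fun p : MissIdx d I => z (p.1.1, p.2)) := by
  have h : ∀ c i, (G.tokens I v x t z e' m).submatrix (equivChannel d dₑ).symm id
      (equivChannel d dₑ c) i = G.token I v x t z e' m i c := fun c i => by
    rw [submatrix_apply, Equiv.symm_apply_apply]; rfl
  have h' : ∀ p : MissIdx d I, (G.tokens I v x t z e' m).submatrix (equivChannel d dₑ).symm id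
      (outChannel d dₑ p.2) p.1.1 = z (p.1.1, p.2) := fun p => h _ _
  unfold decode
  simp only [h']

/-- A transformer that runs `k` steps of gradient descent. -/
theorem exists_blocks_iterate (hG : G.KernelAssumption r) (hH : 2 ≤ H) {gap hi : ℝ} (hgap : 0 < gap)
    (hsep : ∀ i₁ j₁ i₂ j₂ : Fin H, timeGap i₁ j₁ ≠ timeGap i₂ j₂ →
      gap ≤ |‖G.emb i₁ - G.emb j₁‖ ^ 2 - ‖G.emb i₂ - G.emb j₂‖ ^ 2|)
    (hΓ : ∀ x, x ⬝ᵥ G.Γ *ᵥ x ≤ 2 * hi * (x ⬝ᵥ x)) (hΛ : lamMax G.Λ ≤ hi) {h : ℝ} (h0 : 0 ≤ h)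
    (h1 : h ≤ 1) {B : ℝ} (hB : (2 / gap + 3) * (1 + r ^ 2) * Real.sqrt H ≤ B)
    (hB' : (8 * hi / gap * hi + 1) * d ≤ B) (k : ℕ) :
    ∃ bs : List (Block (Channel d dₑ (d + (dₑ + 1))) (4 * H)), bs.length = k + 1 ∧
      (∀ b ∈ bs, b.BoundedBy B) ∧ ∀ R I v x t, 0 ≤ t →
        decode (outChannel d dₑ) R I (Block.run bs (G.encode (d + (dₑ + 1)) I v x t)) =
          clip R (WithLp.toLp 2 (fun p : MissIdx d I =>
            (fun z => z - h • ((G.frame I v x t).ofLp + G.diffCov I t *ᵥ z))^[k] 0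
              (p.1.1, p.2))) := by
  have hΓb := abs_apply_le_of_dotProduct_le hG.posDef_Γ.posSemidef hΓ
  have hΛb := abs_apply_le_of_dotProduct_le hG.posDef_Λ.posSemidef (u := hi) fun x =>
    (dotProduct_mulVec_le_lamMax hG.posDef_Λ.1 x).trans (mul_le_mul_of_nonneg_right
      hΛ (dotProduct_self_nonneg_real x))
  obtain ⟨b₀, hb₀, hrun₀⟩ := exists_init_block (d := d) hG hH hgap (gap_le_of_ne hsep) hB
  obtain ⟨b₁, hb₁, hrun₁⟩ := exists_iteration_block hG hH hgap hsep hΓb hΛb h0 h1 hB hB'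
  refine ⟨b₀ :: List.replicate k b₁, by simp, fun b hb => ?_, fun R I v x t ht => ?_⟩
  · rcases List.mem_cons.1 hb with rfl | hb
    · exact hb₀
    · rw [List.eq_of_mem_replicate hb]
      exact hb₁
  · have hrun : Block.run (b₀ :: List.replicate k b₁) (G.encode (d + (dₑ + 1)) I v x t) = _ :=
      (congrArg (Block.run _) encode_eq_tokens).trans
        ((congrArg (Block.run (List.replicate k b₁)) (hrun₀ I v x t ht)).trans
          (run_replicate b₁ h v x (fun z => hrun₁ I v x t z ht) k 0))
    rw [hrun]
    exact decode_tokens R _ _ _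

end GPModel

/-! ### Comparison of constants with the stated budgets -/

theorem weight_scale_le {H d : ℕ} {a b C r κ σ : ℝ} (hd : 1 ≤ (d : ℝ)) (ha : 0 ≤ a) (hb : 0 ≤ b)
    (hC : a + b ≤ C) (hκ : 1 ≤ κ * σ) :
    a * (1 + r ^ 2) * Real.sqrt H ≤ C * (Real.sqrt (H * d ^ 3) * (r ^ 2 + κ * σ)) := by
  have e1 : Real.sqrt H ≤ Real.sqrt (H * d ^ 3) :=
    Real.sqrt_le_sqrt (le_mul_of_one_le_right (by positivity) (one_le_pow₀ hd))
  have e2 : a ≤ C := by linarith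
  have e3 : r ^ 2 + 1 ≤ r ^ 2 + κ * σ := by linarith
  calc a * (1 + r ^ 2) * Real.sqrt H = a * (Real.sqrt H * (r ^ 2 + 1)) := by ring
    _ ≤ C * (Real.sqrt (H * d ^ 3) * (r ^ 2 + κ * σ)) :=
      mul_le_mul e2 (mul_le_mul e1 e3 (by positivity) (by positivity)) (by positivity) (by linarith)

theorem weight_scale_le' {H d : ℕ} {a b C r κ σ : ℝ} (hH : 1 ≤ (H : ℝ)) (hd : 1 ≤ (d : ℝ))
    (ha : 0 ≤ a) (hb : 0 ≤ b) (hC : a + b ≤ C) (hκ : 1 ≤ κ * σ) :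
    b * d ≤ C * (Real.sqrt (H * d ^ 3) * (r ^ 2 + κ * σ)) := by
  have e1 : (d : ℝ) ≤ Real.sqrt (H * d ^ 3) := by
    refine Real.le_sqrt_of_sq_le ?_
    have h3 := pow_le_pow_right₀ hd (show 2 ≤ 3 by norm_num)
    have h4 := le_mul_of_one_le_left (show (0 : ℝ) ≤ d ^ 3 by positivity) hH
    linarith
  have e2 : b ≤ C := by linarith
  have e3 : 1 ≤ r ^ 2 + κ * σ := by linarith [sq_nonneg r]
  calc b * d = b * (d * 1) := by ring
    _ ≤ C * (Real.sqrt (H * d ^ 3) * (r ^ 2 + κ * σ)) :=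
      mul_le_mul e2 (mul_le_mul e1 e3 (by positivity) (by positivity)) (by positivity) (by linarith)

/-- The number of gradient steps is within the depth budget. -/
theorem ceil_add_one_le {a u l κo κc y z C : ℝ} (ha : 0 ≤ a) (hu : 0 ≤ u) (hl : 0 < l)
    (hκo : 1 ≤ κo) (hκc : 1 ≤ κc) (hz : 0 < z) (hy : z ≤ y)
    (hC : a * (u + 1) / (l * z ^ 2) + 2 / z ^ 3 ≤ C) :
    ((⌈a * y / ((u + 1)⁻¹ * (l / (κo * κc)))⌉₊ + 1 : ℕ) : ℝ) ≤ C * (κc ^ 2 * κo * y ^ 3) := by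
  have hy0 : 0 < y := hz.trans_le hy
  have hκo0 := one_pos.trans_le hκo
  have hκc0 := one_pos.trans_le hκc
  have h1 := (Nat.ceil_lt_add_one
    (show 0 ≤ a * y / ((u + 1)⁻¹ * (l / (κo * κc))) by positivity)).le
  have e1 : a * y / ((u + 1)⁻¹ * (l / (κo * κc))) = a * (u + 1) / l * (κo * κc * y) := by
    field_simp
  have hkk : κo * κc ≤ κc ^ 2 * κo := by nlinarith [mul_pos hκo0 hκc0]
  have hb2 : y * z ^ 2 ≤ y ^ 3 := by
    rw [pow_succ' y 2]
    exact mul_le_mul_of_nonneg_left (pow_le_pow_left₀ hz.le hy 2) hy0.le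
  have hb3 : z ^ 3 ≤ y ^ 3 := pow_le_pow_left₀ hz.le hy 3
  have t1 : a * (u + 1) / l * (κo * κc * y) ≤
      a * (u + 1) / (l * z ^ 2) * (κc ^ 2 * κo * y ^ 3) := by
    have e2 : a * (u + 1) / l * (κo * κc * y) =
        a * (u + 1) / (l * z ^ 2) * (κo * κc * (y * z ^ 2)) := by field_simp
    rw [e2]
    exact mul_le_mul_of_nonneg_left (mul_le_mul hkk hb2 (by positivity) (by positivity))
      (by positivity)
  -- The `2` pays for rounding up and for the preliminary block.
  have t2 : 2 ≤ 2 / z ^ 3 * (κc ^ 2 * κo * y ^ 3) := by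
    rw [div_mul_eq_mul_div, le_div_iff₀ (by positivity)]
    refine mul_le_mul_of_nonneg_left (hb3.trans ?_) zero_le_two
    exact le_mul_of_one_le_left (by positivity)
      (one_le_mul_of_one_le_of_one_le (one_le_pow₀ hκc) hκo)
  have t3 := mul_le_mul_of_nonneg_right hC (show 0 ≤ κc ^ 2 * κo * y ^ 3 by positivity)
  rw [add_mul] at t3
  push_cast
  linarith

/-- The number of gradient steps suffices for the accuracy. -/
theorem log_le_mul_ceil {A X q : ℝ} (hA : 1 ≤ A) (hX : 2 ≤ X) (hq : 0 < q) :
    Real.log (A * X ^ 2) ≤ q * ⌈(Real.log A / Real.log 2 + 2) * Real.log X / q⌉₊ := by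
  have hlog2 : 0 < Real.log 2 := Real.log_pos one_lt_two
  rw [Real.log_mul (by positivity) (by positivity), Real.log_pow]
  have h1 : Real.log A ≤ Real.log A / Real.log 2 * Real.log X := by
    rw [div_mul_eq_mul_div, le_div_iff₀ hlog2]
    exact mul_le_mul_of_nonneg_left (Real.log_le_log two_pos hX) (Real.log_nonneg hA)
  have h3 := (div_le_iff₀' hq).1
    (Nat.le_ceil ((Real.log A / Real.log 2 + 2) * Real.log X / q))
  push_cast
  linarith

/-- The target is `ε/2` because truncation doubles the error. The `8` offsets the resulting `1/4`;
the added `1` keeps the constant at least `1`, so that its logarithm is nonnegative. `N` plays the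
role of `H d`. -/
theorem initial_error_le {c l N κo κc ε : ℝ} (hl : 0 < l) (hN : 1 ≤ N) (hκo : 1 ≤ κo)
    (hκc : 1 ≤ κc) (hε : 0 < ε) :
    2 * (c * Real.sqrt N) ^ 2 / (l / (κo * κc)) ^ 2 ≤
      (8 * c ^ 2 / l ^ 2 + 1) * (N * κc ^ 2 * κo / ε) ^ 2 * (ε / 2) ^ 2 := by
  have hκo0 := one_pos.trans_le hκo
  have hκc0 := one_pos.trans_le hκc
  rw [mul_pow, Real.sq_sqrt (by linarith)]
  have e1 : 2 * (c ^ 2 * N) / (l / (κo * κc)) ^ 2 = 2 * c ^ 2 / l ^ 2 * (N * κc ^ 2 * κo ^ 2) := by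
    field_simp
  have e2 : (8 * c ^ 2 / l ^ 2 + 1) * (N * κc ^ 2 * κo / ε) ^ 2 * (ε / 2) ^ 2 =
      (2 * c ^ 2 / l ^ 2 + 1 / 4) * (N * κc ^ 2 * κo) ^ 2 := by
    field_simp
    ring
  have e4 : N * κc ^ 2 * κo ^ 2 ≤ (N * κc ^ 2 * κo) ^ 2 := by
    have h1 : 1 ≤ N * κc ^ 2 := one_le_mul_of_one_le_of_one_le hN (one_le_pow₀ hκc)
    rw [mul_pow]
    exact mul_le_mul_of_nonneg_right (le_self_pow₀ h1 two_ne_zero) (sq_nonneg _)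
  rw [e1, e2]
  exact mul_le_mul (by linarith) e4 (by positivity) (by positivity)

theorem two_le_div {H d : ℕ} {κo κc ε : ℝ} (hH : 2 ≤ (H : ℝ)) (hd : 1 ≤ (d : ℝ)) (hκo : 1 ≤ κo)
    (hκc : 1 ≤ κc) (hε : 0 < ε) (hε1 : ε < 1) : 2 ≤ H * d * κc ^ 2 * κo / ε := by
  rw [le_div_iff₀ hε]
  have h1 : 1 ≤ d * κc ^ 2 * κo :=
    one_le_mul_of_one_le_of_one_le (one_le_mul_of_one_le_of_one_le hd (one_le_pow₀ hκc)) hκo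
  nlinarith

end

/-! ### Choice of constants and assembly -/

theorem theorem1 (lo hi gap c : ℝ) (hlo : 0 < lo) (hgap : 0 < gap) :
    ∃ C : ℝ, 0 < C ∧
      ∀ (H d dₑ : ℕ) (_ : 2 ≤ H) (_ : 1 ≤ d) (G : GPModel H d dₑ) (r : ℝ)
        (_ : G.KernelAssumption r)
        -- the largest eigenvalues of the covariance factors are of order one
        (_ : ∀ I : Pattern H, lo ≤ lamMax (G.gamObs I) ∧ lamMax (G.gamObs I) ≤ hi ∧
          lo ≤ lamMax (G.gamMiss I) ∧ lamMax (G.gamMiss I) ≤ hi)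
        (_ : lo ≤ lamMax G.Λ ∧ lamMax G.Λ ≤ hi)
        -- for two frames, no condition number measures the temporal correlation
        (_ : H = 2 → lo ≤ lamMin G.Γ)
        -- separation of the squared embedding distances of different time gaps
        (_ : ∀ i₁ j₁ i₂ j₂ : Fin H, timeGap i₁ j₁ ≠ timeGap i₂ j₂ →
          gap ≤ |‖G.emb i₁ - G.emb j₁‖ ^ 2 - ‖G.emb i₂ - G.emb j₂‖ ^ 2|)
        (t₀ T ε : ℝ) (_ : 0 < t₀) (_ : t₀ ≤ T) (_ : 0 < ε) (_ : ε < 1),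
        ∃ (D L : ℕ) (B R : ℝ),
          (D : ℝ) ≤ C * (d + dₑ) ∧
          (L : ℝ) ≤ C * (G.kapCond ^ 2 * G.kapObs *
            Real.log (H * d * G.kapCond ^ 2 * G.kapObs / ε) ^ 3) ∧
          B ≤ C * (Real.sqrt (H * d ^ 3) * (r ^ 2 + G.kapObs * (sigm t₀)⁻¹)) ∧
          R ≤ C * ((sigm t₀ ^ 2)⁻¹ * Real.sqrt (H * d) * G.kapObs) ∧
          ∃ s ∈ transformerClass G D L (4 * H) B R,
            ∀ (I : Pattern H) (t : ℝ), t ∈ Set.Icc t₀ T →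
              ∀ (v : EuclideanSpace ℝ (MissIdx d I)) (x : EuclideanSpace ℝ (ObsIdx d I)),
                ‖x - G.meanObs I‖ ≤ c * Real.sqrt (H * d) →
                ‖v - alph t • G.meanMiss I‖ ≤ c * Real.sqrt (H * d) →
                ‖s I v x t - G.score I v x t‖ ≤ (sigm t)⁻¹ * ε := by
  -- The maximum makes `m` positive without any sign condition on `hi`; `|c|` replaces `c` below for
  -- the same reason.
  set m := max hi lo with hm
  have hm0 : 0 < m := lt_max_of_lt_right hlo
  set u := 2 * m ^ 2 with hu
  have hu0 : 0 < u := by positivity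
  -- `lo²/2` comes from the lower bound on `cov`; the cap at `1` gives `l ≤ 1`, as the mixture with
  -- unit noise requires.
  set l₀ := min (lo ^ 2 / 2) 1 with hl₀
  have hl₀0 : 0 < l₀ := lt_min (by positivity) one_pos
  have hlog2 : 0 < Real.log 2 := Real.log_pos one_lt_two
  obtain ⟨A, hA⟩ : ∃ A, A = 8 * |c| ^ 2 / l₀ ^ 2 + 1 := ⟨_, rfl⟩
  have hA1 : 1 ≤ A := hA ▸ le_add_of_nonneg_left (by positivity)
  obtain ⟨a, ha⟩ : ∃ a, a = Real.log A / Real.log 2 + 2 := ⟨_, rfl⟩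
  have ha0 : 0 < a := by
    rw [ha]; exact add_pos_of_nonneg_of_pos (div_nonneg (Real.log_nonneg hA1) hlog2.le) two_pos
  obtain ⟨CL, hCL⟩ : ∃ CL, CL = a * (u + 1) / (l₀ * Real.log 2 ^ 2) + 2 / Real.log 2 ^ 3 := ⟨_, rfl⟩
  obtain ⟨CR, hCR⟩ : ∃ CR, CR = |c| * (1 + u / lo ^ 2) := ⟨_, rfl⟩
  obtain ⟨a₁, ha₁⟩ : ∃ a₁, a₁ = 2 / gap + 3 := ⟨_, rfl⟩
  obtain ⟨a₂, ha₂⟩ : ∃ a₂, a₂ = 8 * m / gap * m + 1 := ⟨_, rfl⟩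
  have hCL0 : 0 ≤ CL := by rw [hCL]; positivity
  have hCR0 : 0 ≤ CR := by rw [hCR]; positivity
  have ha₁0 : 0 ≤ a₁ := by rw [ha₁]; positivity
  have ha₂0 : 0 ≤ a₂ := by rw [ha₂]; positivity
  -- The summands serve, in order, the token dimension, the depth, the output radius and the
  -- weights.
  obtain ⟨C, hC⟩ : ∃ C, C = 11 + CL + CR + (a₁ + a₂) := ⟨_, rfl⟩
  refine ⟨C, by rw [hC]; positivity, ?_⟩
  intro H d dₑ hH hd G r hG hΓ hΛ h2 hsep t₀ T ε ht₀ htT hε hε1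
  have hko := GPModel.one_le_kapObs hG hH hd
  have hkc := GPModel.one_le_kapCond hG hH hd
  have hH' : (2 : ℝ) ≤ H := by exact_mod_cast hH
  have hd' : (1 : ℝ) ≤ d := by exact_mod_cast hd
  have hs₀ := sigm_pos ht₀
  have hcov : ∀ x, x ⬝ᵥ G.cov *ᵥ x ≤ u * (x ⬝ᵥ x) := GPModel.dotProduct_cov_le hG hH hm0.le
    (fun I => (hΓ I).2.1.trans (le_max_left _ _)) (fun I => (hΓ I).2.2.2.trans (le_max_left _ _))
    (hΛ.2.trans (le_max_left _ _))
  have hlow' := GPModel.le_dotProduct_cov hG hH hlo (fun I => (hΓ I).1) hd hΛ.1 h2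
  have hobs : ∀ (I : Pattern H) (x : Fin H × Fin d → ℝ), (∀ p, p.1 ∉ I.1 → x p = 0) →
      lo ^ 2 / G.kapObs * (x ⬝ᵥ x) ≤ x ⬝ᵥ G.cov *ᵥ x := fun I _ hx =>
    GPModel.le_dotProduct_cov_of_support hG hH hlo (fun I => (hΓ I).1) hd hΛ.1 I hx
  have hΓu := GPModel.dotProduct_Γ_le hG hH
    (fun I => (hΓ I).2.1.trans (le_max_left _ lo)) (fun I => (hΓ I).2.2.2.trans (le_max_left _ lo))
  -- From here the condition numbers enter only as real numbers that are at least `1`.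
  generalize G.kapObs = κo at *
  generalize G.kapCond = κc at *
  have hkk : 1 ≤ κo * κc := one_le_mul_of_one_le_of_one_le hko hkc
  have hκo0 := one_pos.trans_le hko
  have hκc0 := one_pos.trans_le hkc
  obtain ⟨l, hl⟩ : ∃ l, l = l₀ / (κo * κc) := ⟨_, rfl⟩
  have hl0 : 0 < l := by rw [hl]; positivity
  have hl1 : l ≤ 1 := by
    rw [hl, div_le_one (by positivity)]
    exact (min_le_right _ _).trans hkk
  have hlow : ∀ x, l * (x ⬝ᵥ x) ≤ x ⬝ᵥ G.cov *ᵥ x := fun x => by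
    refine le_trans (mul_le_mul_of_nonneg_right ?_ (dotProduct_self_nonneg_real x)) (hlow' x)
    rw [hl, mul_assoc, ← div_div (lo ^ 2)]
    exact div_le_div_of_nonneg_right (min_le_left _ _) (mul_pos hκo0 hκc0).le
  have hX2 := two_le_div hH' hd' hko hkc hε hε1
  have hq0 : 0 < (u + 1)⁻¹ * l := by positivity
  have hone : 1 ≤ κo * (sigm t₀)⁻¹ := one_le_mul_of_one_le_of_one_le hko
    ((one_le_inv₀ hs₀).2 (sigm_le_one t₀))
  have hlogY := log_le_mul_ceil hA1 hX2 hq0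
  have hk := ceil_add_one_le (C := C) ha0.le hu0.le hl₀0 hko hkc hlog2
    (Real.log_le_log two_pos hX2) (by rw [← hCL, hC]; linarith)
  rw [← hl] at hk
  rw [← ha] at hlogY
  obtain ⟨bs, hlen, hbs, hdec⟩ := GPModel.exists_blocks_iterate (d := d) hG hH hgap hsep hΓu
    (hΛ.2.trans (le_max_left _ lo)) (h := (u + 1)⁻¹) (by positivity)
    (inv_le_one_of_one_le₀ (by linarith))
    (B := C * (Real.sqrt (H * d ^ 3) * (r ^ 2 + κo * (sigm t₀)⁻¹)))
    (ha₁ ▸ weight_scale_le hd' ha₁0 ha₂0 (by rw [hC]; linarith) hone)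
    (ha₂ ▸ weight_scale_le' (by linarith) hd' ha₁0 ha₂0 (by rw [hC]; linarith) hone)
    ⌈a * Real.log (H * d * κc ^ 2 * κo / ε) / ((u + 1)⁻¹ * l)⌉₊
  generalize ⌈a * Real.log (H * d * κc ^ 2 * κo / ε) / ((u + 1)⁻¹ * l)⌉₊ = k at *
  have hC0 : 0 ≤ C := by rw [hC]; positivity
  have hR0 : 0 ≤ C * ((sigm t₀ ^ 2)⁻¹ * Real.sqrt (H * d) * κo) := by positivity
  have hCRC : CR ≤ C := by rw [hC]; linarith
  refine ⟨Fintype.card (Channel d dₑ (d + (dₑ + 1))), k + 1, _,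
    C * ((sigm t₀ ^ 2)⁻¹ * Real.sqrt (H * d) * κo), ?_, hk, le_rfl, le_rfl,
    fun I v x t => decode (WorkChannel.outChannel d dₑ) _ I
      (Block.run bs (G.encode (d + (dₑ + 1)) I v x t)),
    ⟨_, bs, WorkChannel.outChannel d dₑ, rfl, hlen, hbs, fun _ _ _ _ => rfl,
      fun I v x t => norm_clip_le hR0 _⟩, ?_⟩
  -- Since `d ≥ 1`, the `8` is at most `8d`, which gives the factor `11`.
  · have e : (Fintype.card (Channel d dₑ (d + (dₑ + 1))) : ℝ) = 3 * d + 2 * dₑ + 8 := by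
      simp; ring
    have h11 : 11 ≤ C := by rw [hC]; linarith
    have := mul_le_mul_of_nonneg_right h11 (show (0 : ℝ) ≤ d + dₑ by positivity)
    have : (0 : ℝ) ≤ dₑ := Nat.cast_nonneg _
    rw [e]
    linarith
  · intro I t ht v x hx hv
    have ht0 : 0 < t := ht₀.trans_le ht.1
    have hst := sigm_pos ht0
    replace hx := hx.trans (mul_le_mul_of_nonneg_right (le_abs_self c) (Real.sqrt_nonneg _))
    replace hv := hv.trans (mul_le_mul_of_nonneg_right (le_abs_self c) (Real.sqrt_nonneg _))
    have hscore : ‖G.score I v x t‖ ≤ C * ((sigm t₀ ^ 2)⁻¹ * Real.sqrt (H * d) * κo) := by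
      refine (GPModel.norm_score_le hG hd ht0 hu0 hcov (l := lo ^ 2 / κo) (by positivity)
        (hobs I) hx hv).trans ?_
      have e1 : (sigm t ^ 2)⁻¹ ≤ (sigm t₀ ^ 2)⁻¹ :=
        inv_anti₀ (by positivity) (pow_le_pow_left₀ hs₀.le (sigm_mono ht.1) 2)
      have e2 : 1 + u / (lo ^ 2 / κo) ≤ κo * (1 + u / lo ^ 2) := by
        have : u / (lo ^ 2 / κo) = κo * (u / lo ^ 2) := by field_simp
        rw [this]; linarith
      calc (sigm t ^ 2)⁻¹ * (1 + u / (lo ^ 2 / κo)) * (|c| * Real.sqrt (H * d))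
          ≤ (sigm t₀ ^ 2)⁻¹ * (κo * (1 + u / lo ^ 2)) * (|c| * Real.sqrt (H * d)) := by gcongr
        _ = CR * ((sigm t₀ ^ 2)⁻¹ * Real.sqrt (H * d) * κo) := by rw [hCR]; ring
        _ ≤ _ := mul_le_mul_of_nonneg_right hCRC (by positivity)
    beta_reduce
    rw [hdec _ I v x t ht0.le]
    -- The iterate is within `ε/2` of the score, so the truncated output is within `ε`; `σ_t ≤ 1`
    -- then gives `ε ≤ σ_t⁻¹ ε`.
    refine (norm_clip_sub_le hscore).trans ?_
    have hAY := initial_error_le (c := |c|) hl₀0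
      (one_le_mul_of_one_le_of_one_le (by linarith) hd' : 1 ≤ (H * d : ℝ)) hko hkc hε
    rw [← hl, ← hA] at hAY
    have hfin := GPModel.norm_iterate_sub_score_le hG hd ht0 hu0.le hcov hl0 hl1 hlow hx hv
      (by positivity) (by positivity) hAY hlogY
    have hone' := le_mul_of_one_le_left hε.le ((one_le_inv₀ hst).2 (sigm_le_one t))
    linarith
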